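/- **Setting.** Let $N, L \ge 1$, and let $\Omega\subset\mathbb R^N$ be a bounded open set subdivided by a (finite) conforming simplicial mesh, i.e. $\Omega$ is the interior of the union of the mesh simplices. Let $\mathcal L^1,\dots,\mathcal L^N$ and $\mathcal G$ be symmetric $L\times L$ matrix fields on $\Omega$, constant on each mesh element, with $\mathcal G$ positive definite on each element and $\sum_j\partial_j\mathcal L^j=0$ in $\Omega$ in the sense of distributions. Put $g(y)=\mathcal G y$, $[f(y)]_{lj}=\sum_k\mathcal L^j_{lk}y_k$, and $\mathcal D=\sum_j n_j\mathcal L^j$ on $\partial\Omega$, where $n$ is the outward unit normal. Let $\mathcal B:\partial\Omega\to\mathbb R^{L\times L}$ satisfy, almost everywhere on $\partial\Omega$, $\ker(\mathcal D-\mathcal B)+\ker(\mathcal D+\mathcal B)=\mathbb R^L$ and $\mathcal B+\mathcal B^t\ge 0$. The maximal wave speed $c$ is the supremum of $|\lambda|$ over all generalized eigenvalues, $\sum_j\nu_j\mathcal L^je=\lambda\mathcal Ge$ with $e\neq0$, at the points of the mesh elements and over all unit vectors $\nu$. Let $\mathtt v$ be a mesh vertex and let $\Omega^{\mathtt v}$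 be the union of the closed elements with vertex $\mathtt v$. Let $\varphi_{\rm bot},\varphi_{\rm top}$ be continuous functions on $\Omega^{\mathtt v}$ that are affine on each of these elements, with $\varphi_{\rm bot}(\mathtt v)<\varphi_{\rm top}(\mathtt v)$ and $\varphi_{\rm bot}=\varphi_{\rm top}$ at all other vertices of these elements. Put $\delta=\varphi_{\rm top}-\varphi_{\rm bot}$ and $\varphi(x,\tau)=\varphi_{\rm bot}(x)+\tau\delta(x)$. The tent is $T^{\mathtt v}=\{(x,t):x\in\Omega^{\mathtt v},\ \varphi_{\rm bot}(x)\le t\le\varphi_{\rm top}(x)\}$, and $\Phi(x,\tau)=(x,\varphi(x,\tau))$ maps $\Omega^{\mathtt v}\times[0,1]$ onto it. Let $\partial_{\rm bdr}T^{\mathtt v}$ be the set of points $(x,t)$ of $\partial T^{\mathtt v}$ with $t\ne\varphi_{\rm bot}(x)$ and $t\ne\varphi_{\rm top}(x)$. Assume causality: for a given $\hat c>c$, $\|\nabla\varphi_{\rm bot}\|_2\le1/\hat c$ and $\|\nabla\varphi_{\rm top}\|_2\le1/\hat c$ inside every element of $\Omega^{\mathtt v}$. Let $M(\tau)=M_0-\tau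 M_1$, where $M_0$ and $M_1$ are the operators on $L^2(\Omega^{\mathtt v})^L$ of multiplication by $\mathcal G-\sum_j(\partial_j\varphi_{\rm bot})\mathcal L^j$ and $\sum_j(\partial_j\delta)\mathcal L^j$, and let $\|w\|_{M(\tau)}=\big(\int_{\Omega^{\mathtt v}}M(\tau)w\cdot w\big)^{1/2}$. **Proposition.** Suppose that $u:T^{\mathtt v}\to\mathbb R^L$ is locally integrable in the interior of $T^{\mathtt v}$ and is such that $\hat u=u\circ\Phi$ belongs to $C^1([0,1];H^1(\Omega^{\mathtt v})^L)$, that is, there is a $C^1$ curve in $H^1(\Omega^{\mathtt v})^L$ whose value at each $\tau\in[0,1]$ equals $u(\Phi(\cdot,\tau))$ almost everywhere. Suppose that $$\partial_t g(u)+\operatorname{div}_x f(u)=0\ \text{ in the interior of } T^{\mathtt v},\qquad (\mathcal D-\mathcal B)u=0\ \text{ on }\partial_{\rm bdr}T^{\mathtt v},$$ the equation in the sense of distributions, and the boundary condition in the sense of traces: for each $\tau\in(0,1)$ the trace of $\hat u(\tau)$ satisfies it at almost every $x\in\partial\Omega\cap\partial\Omega^{\mathtt v}$ with $\Phi(x,\tau)\in\partial_{\rm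 bdr}T^{\mathtt v}$. Then $$\|\hat u(\tau)\|_{M(\tau)}\le\|\hat u(0)\|_{M(0)}\qquad\text{for all }\tau\in[0,1].$$ In particular $\|u\|_{\partial_{\rm top}T^{\mathtt v}}\le\|u\|_{\partial_{\rm bot}T^{\mathtt v}}$, where, for $\flat\in\{\rm top,bot\}$, $$\|w\|_{\partial_\flat T^{\mathtt v}}^2=\int_{\Omega^{\mathtt v}}\big[g(w(x,\varphi_\flat(x)))-f(w(x,\varphi_\flat(x)))\,\nabla\varphi_\flat(x)\big]\cdot w(x,\varphi_\flat(x))\,dx .$$ -/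

import Mathlib

open Set MeasureTheory Filter
open scoped Topology ContDiff Matrix Gradient ENNReal

noncomputable section

namespace TentPitching

/-- The space `ℝ^N`. -/
abbrev Space (N : ℕ) := EuclideanSpace ℝ (Fin N)

/-- The space `ℝ^L` of values of the unknown. -/
abbrev State (L : ℕ) := EuclideanSpace ℝ (Fin L)

/-- The `j`th standard basis vector of `ℝ^N`. -/
abbrev basisVec {N : ℕ} (j : Fin N) : Space N := EuclideanSpace.single j (1 : ℝ)

/-! ### The space `H¹(U)^L` -/

/-- `g` is the weak partial derivative `∂_j w` on the open set `U`. -/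
def IsWeakPartial {N L : ℕ} (U : Set (Space N)) (j : Fin N) (w g : Space N → State L) : Prop :=
  ∀ ψ : Space N → ℝ, ContDiff ℝ ∞ ψ → HasCompactSupport ψ → tsupport ψ ⊆ U →
    ∫ x in U, (fderiv ℝ ψ x (basisVec j)) • w x = - ∫ x in U, ψ x • g x

/-- The space `H¹(U)^L`. An element is stored as the tuple `(w, ∂_1 w, …, ∂_N w)` of `L²`
functions (`none` is the slot of `w`, `some j` that of the weak derivative `∂_j w`), so the norm
inherited from the Hilbert sum is
`‖w‖² = ‖w‖²_{L²} + ∑ j, ‖∂_j w‖²_{L²}`, the usual norm of `H¹(U)^L`. -/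
def H1 {N : ℕ} (U : Set (Space N)) (L : ℕ) :
    Submodule ℝ (PiLp 2 fun _ : Option (Fin N) => Lp (State L) 2 (volume.restrict U)) where
  carrier := {z | ∀ j : Fin N, IsWeakPartial U j (z none) (z (some j))}
  zero_mem' := by
    intro j ψ hψ hc hs
    have h0 : ∀ χ : Space N → ℝ, ∫ x in U, χ x •
        ((0 : Lp (State L) 2 (volume.restrict U)) : Space N → State L) x = 0 := by
      intro χ
      apply integral_eq_zero_of_ae
      filter_upwards [Lp.coeFn_zero (State L) 2 (volume.restrict U)] with x hx
      rw [hx]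
      simp
    simp only [PiLp.zero_apply]
    rw [h0, h0, neg_zero]
  add_mem' := by
    intro a b ha hb j ψ hψ hc hs
    have key : ∀ (χ : Space N → ℝ), Continuous χ → HasCompactSupport χ →
        ∀ v w : Lp (State L) 2 (volume.restrict U),
        ∫ x in U, χ x • ((v + w : Lp (State L) 2 (volume.restrict U)) : Space N → State L) x
          = (∫ x in U, χ x • v x) + ∫ x in U, χ x • w x := by
      intro χ hχ hχc v w
      have hi : ∀ v : Lp (State L) 2 (volume.restrict U),
          Integrable (fun x => χ x • v x) (volume.restrict U) := fun v =>
        ((Lp.memLp v).locallyIntegrable (by norm_num)).integrable_smul_left_of_hasCompactSupport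
          hχ hχc
      rw [← integral_add (hi v) (hi w)]
      apply integral_congr_ae
      filter_upwards [Lp.coeFn_add v w] with x hx
      rw [hx, Pi.add_apply, smul_add]
    have hd : Continuous fun x => fderiv ℝ ψ x (basisVec j) :=
      (hψ.continuous_fderiv (by simp)).clm_apply continuous_const
    have e1 := key _ hd (hc.fderiv_apply ℝ _) (a none) (b none)
    have e2 := key _ hψ.continuous hc (a (some j)) (b (some j))
    have ea := ha j ψ hψ hc hs
    have eb := hb j ψ hψ hc hs
    simp only [PiLp.add_apply]
    rw [e1, e2, ea, eb, neg_add]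
  smul_mem' := by
    intro c a ha j ψ hψ hc hs
    have key : ∀ (χ : Space N → ℝ) (v : Lp (State L) 2 (volume.restrict U)),
        ∫ x in U, χ x • ((c • v : Lp (State L) 2 (volume.restrict U)) : Space N → State L) x
          = c • ∫ x in U, χ x • v x := by
      intro χ v
      rw [← integral_smul]
      apply integral_congr_ae
      filter_upwards [Lp.coeFn_smul c v] with x hx
      rw [hx, Pi.smul_apply, smul_comm]
    simp only [PiLp.smul_apply]
    rw [key, key, ha j ψ hψ hc hs, smul_neg]

namespace H1

variable {N L : ℕ} {U : Set (Space N)}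

/-- The `L²` function underlying an element of `H¹(U)^L`. -/
def func (z : H1 U L) : Lp (State L) 2 (volume.restrict U) := z.1 none

/-- The weak partial derivative `∂_j z`. -/
def weakPartial (j : Fin N) (z : H1 U L) : Lp (State L) 2 (volume.restrict U) := z.1 (some j)

end H1

/-! ### The spatial mesh -/

/-- A conforming simplicial mesh of a bounded region of `ℝ^N`: a finite simplicial complex, each
of whose simplices is a face of an `N`-dimensional one. -/
structure SpatialMesh (N : ℕ) where
  complex : Geometry.SimplicialComplex ℝ (Space N)
  finite : complex.faces.Finite
  pure : ∀ f ∈ complex.faces, ∃ s ∈ complex.faces, f ⊆ s ∧ s.card = N + 1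

namespace SpatialMesh

variable {N : ℕ} (mesh : SpatialMesh N)

/-- The mesh elements, given by their `N + 1` vertices. -/
def Element : Type := {s : Finset (Space N) // s ∈ mesh.complex.faces ∧ s.card = N + 1}

/-- The open bounded domain `Ω` that is subdivided by the mesh. -/
def domain : Set (Space N) := interior mesh.complex.space

variable {mesh}

/-- The closed simplex of a mesh element. -/
def Element.cell (s : mesh.Element) : Set (Space N) := convexHull ℝ (s.1 : Set (Space N))

/-- The matrix field on `Ω` that is constant, with value `A s`, on each (open) element `s`. Its
values on the mesh skeleton, a null set, are immaterial (they are set to `0`). -/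
def field {L : ℕ} (A : mesh.Element → Matrix (Fin L) (Fin L) ℝ) (x : Space N) :
    Matrix (Fin L) (Fin L) ℝ :=
  ∑ᶠ s : mesh.Element, (interior s.cell).indicator (fun _ => A s) x

/-- `f` is a facet (given by its `N` vertices) of the element `s`, it is contained in `∂Ω`, and
`n` is its unit normal pointing out of `s`. -/
structure IsBoundaryFacet (s : mesh.Element) (f : Finset (Space N)) (n : Space N) : Prop where
  subset : f ⊆ s.1
  card : f.card = N
  boundary : convexHull ℝ (f : Set (Space N)) ⊆ frontier mesh.domain
  norm_eq : ‖n‖ = 1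
  tangent : ∀ a ∈ f, ∀ b ∈ f, inner ℝ n (b - a) = 0
  outward : ∀ a ∈ f, ∀ b ∈ s.1, b ∉ f → inner ℝ n (b - a) < 0

end SpatialMesh

/-- Surface measure on a facet (up to a normalising constant that depends on `N` only). -/
def facetMeasure {N : ℕ} (f : Finset (Space N)) : Measure (Space N) :=
  (Measure.hausdorffMeasure ((N : ℝ) - 1)).restrict (convexHull ℝ (f : Set (Space N)))

/-- `h` is the trace on the facet `f` of the mesh element `s` of the function `z ∈ H¹(U)^L`,
where `U` contains the interior of `s`: it is the `L²` limit on `f` of smooth functions that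
converge to `z` in `H¹` of the interior of `s`. -/
def IsTrace {N L : ℕ} {mesh : SpatialMesh N} {U : Set (Space N)} (z : H1 U L)
    (s : mesh.Element) (f : Finset (Space N)) (h : Space N → State L) : Prop :=
  MemLp h 2 (facetMeasure f) ∧
  ∃ W : ℕ → Space N → State L, (∀ k, ContDiff ℝ ∞ (W k)) ∧
    Tendsto (fun k => eLpNorm (fun x => W k x - H1.func z x) 2
      (volume.restrict (interior s.cell))) atTop (𝓝 0) ∧
    (∀ j, Tendsto (fun k => eLpNorm (fun x => fderiv ℝ (W k) x (basisVec j) - H1.weakPartial j z x) 2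
      (volume.restrict (interior s.cell))) atTop (𝓝 0)) ∧
    Tendsto (fun k => eLpNorm (fun x => W k x - h x) 2 (facetMeasure f)) atTop (𝓝 0)

/-! ### The hyperbolic system -/

/-- The symmetric linear hyperbolic system `∂_t g(u) + div_x f(u) = 0` on `Ω` with
`g(u) = 𝒢 u` and `[f(u)]_{lj} = ∑ k, ℒ^j_{lk} u_k`, together with the boundary matrix `ℬ` of
Friedrichs boundary conditions. The coefficients are constant on each mesh element (so that
boundedness and uniform positive definiteness are automatic, the mesh being finite). -/
structure HyperbolicSystem {N : ℕ} (mesh : SpatialMesh N) (L : ℕ) where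
  /-- the values of `𝒢` on the elements -/
  G : mesh.Element → Matrix (Fin L) (Fin L) ℝ
  /-- the values of `ℒ^j` on the elements -/
  A : Fin N → mesh.Element → Matrix (Fin L) (Fin L) ℝ
  /-- the boundary matrix `ℬ`; only its values on `∂Ω` matter -/
  bdry : Space N → Matrix (Fin L) (Fin L) ℝ
  G_posDef : ∀ s, (G s).PosDef
  A_symm : ∀ j s, (A j s).IsSymm
  /-- `∑ j, ∂_j ℒ^j = 0` in `Ω` in the sense of distributions -/
  div_free : ∀ (l m : Fin L) (ψ : Space N → ℝ), ContDiff ℝ ∞ ψ → HasCompactSupport ψ →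
    tsupport ψ ⊆ mesh.domain →
    ∑ j, ∫ x in mesh.domain, mesh.field (A j) x l m * fderiv ℝ ψ x (basisVec j) = 0
  /-- `ker (𝒟 - ℬ) + ker (𝒟 + ℬ) = ℝ^L` on `∂Ω`, where `𝒟 = ∑ j, n_j ℒ^j` -/
  bdry_ker : ∀ s f n, mesh.IsBoundaryFacet s f n → ∀ᵐ x ∂(facetMeasure f),
    LinearMap.ker (Matrix.mulVecLin ((∑ j, n j • A j s) - bdry x)) ⊔
      LinearMap.ker (Matrix.mulVecLin ((∑ j, n j • A j s) + bdry x)) = ⊤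
  /-- `ℬ + ℬᵗ ≥ 0` on `∂Ω` -/
  bdry_nonneg : ∀ s f n, mesh.IsBoundaryFacet s f n → ∀ᵐ x ∂(facetMeasure f),
    (bdry x + (bdry x)ᵀ).PosSemidef

namespace HyperbolicSystem

variable {N L : ℕ} {mesh : SpatialMesh N} (sys : HyperbolicSystem mesh L)

/-- `𝒟^{(ν)} = ∑ j, ν_j ℒ^j` on the element `s`. -/
def normalMatrix (s : mesh.Element) (ν : Space N) : Matrix (Fin L) (Fin L) ℝ :=
  ∑ j, ν j • sys.A j s

/-- `g(y) = 𝒢 y` at the point `x`. -/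
def g (x : Space N) (y : State L) : Fin L → ℝ := mesh.field sys.G x *ᵥ y.ofLp

/-- `[f(y)]_{lj} = ∑ k, ℒ^j_{lk} y_k` at the point `x`. -/
def f (x : Space N) (y : State L) : Matrix (Fin L) (Fin N) ℝ :=
  Matrix.of fun l j => (mesh.field (sys.A j) x *ᵥ y.ofLp) l

/-- The maximal wave speed `c`: the largest `|λ|` over all generalised eigenvalues
`𝒟^{(ν)} e = λ 𝒢 e` with unit vectors `ν`, at all points of `Ω`. -/
def maxWaveSpeed : ℝ :=
  sSup {r | ∃ (s : mesh.Element) (ν : Space N) (lam : ℝ) (e : Fin L → ℝ), ‖ν‖ = 1 ∧ e ≠ 0 ∧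
    sys.normalMatrix s ν *ᵥ e = lam • (sys.G s *ᵥ e) ∧ r = |lam|}

end HyperbolicSystem

/-! ### Tents -/

/-- A spacetime tent pitched at the mesh vertex `v`: the region between two graphs over the
vertex patch, which are continuous and piecewise linear with respect to the mesh, the top being
obtained from the bottom by moving the vertex `v` forward in time while the other vertices of the
patch stay fixed. -/
structure Tent {N : ℕ} (mesh : SpatialMesh N) where
  v : Space N
  v_mem : v ∈ mesh.complex.vertices
  bot : Space N → ℝ
  top : Space N → ℝ
  bot_continuous : ContinuousOn bot (⋃ s : {s : mesh.Element // v ∈ s.1}, s.1.cell)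
  top_continuous : ContinuousOn top (⋃ s : {s : mesh.Element // v ∈ s.1}, s.1.cell)
  bot_linear : ∀ s : mesh.Element, v ∈ s.1 → ∃ a : Space N →ᵃ[ℝ] ℝ, EqOn bot a s.cell
  top_linear : ∀ s : mesh.Element, v ∈ s.1 → ∃ a : Space N →ᵃ[ℝ] ℝ, EqOn top a s.cell
  pitched : bot v < top v
  fixed : ∀ s : mesh.Element, v ∈ s.1 → ∀ p ∈ s.1, p ≠ v → top p = bot p

namespace Tent

variable {N L : ℕ} {mesh : SpatialMesh N} (T : Tent mesh)

/-- The vertex patch `Ω^v`, the union of all mesh elements with vertex `v`. -/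
def patch : Set (Space N) := ⋃ s : {s : mesh.Element // T.v ∈ s.1}, s.1.cell

/-- `δ = φ_top - φ_bot`. -/
def delta (x : Space N) : ℝ := T.top x - T.bot x

/-- `φ(x, τ) = φ_bot(x) + τ δ(x)`. -/
def phi (x : Space N) (τ : ℝ) : ℝ := T.bot x + τ * T.delta x

/-- The tent `{(x, t) : x ∈ Ω^v, φ_bot(x) ≤ t ≤ φ_top(x)}`. -/
def region : Set (Space N × ℝ) := {p | p.1 ∈ T.patch ∧ T.bot p.1 ≤ p.2 ∧ p.2 ≤ T.top p.1}

/-- The map `Φ(x, τ) = (x, φ(x, τ))` from the cylinder `Ω^v × [0, 1]` onto the tent. -/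
def Phi (p : Space N × ℝ) : Space N × ℝ := (p.1, T.phi p.1 p.2)

/-- The top part of the boundary of the tent. -/
def topBoundary : Set (Space N × ℝ) := {p ∈ frontier T.region | p.2 = T.top p.1}

/-- The bottom part of the boundary of the tent. -/
def botBoundary : Set (Space N × ℝ) := {p ∈ frontier T.region | p.2 = T.bot p.1}

/-- The remaining part `∂_bdr` of the boundary of the tent. -/
def bdrBoundary : Set (Space N × ℝ) :=
  {p ∈ frontier T.region | p ∉ T.topBoundary ∧ p ∉ T.botBoundary}

variable (sys : HyperbolicSystem mesh L)

/-- The causality condition `‖grad φ‖ ≤ 1 / ĉ < 1 / c` (`< ∞` if `c = 0`) on the top and on the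
bottom of the tent, for a given strict upper bound `ĉ` of the maximal wave speed `c`. -/
def IsCausal (chat : ℝ) : Prop :=
  sys.maxWaveSpeed < chat ∧
  ∀ s : mesh.Element, T.v ∈ s.1 → ∀ x ∈ interior s.cell,
    ‖∇ T.bot x‖ ≤ 1 / chat ∧ ‖∇ T.top x‖ ≤ 1 / chat

/-- `u` solves `∂_t g(u) + div_x f(u) = 0` in the interior of the tent, in the sense of
distributions. -/
def IsSolution (u : Space N × ℝ → State L) : Prop :=
  LocallyIntegrableOn u (interior T.region) ∧
  ∀ ψ : Space N × ℝ → State L, ContDiff ℝ ∞ ψ → HasCompactSupport ψ →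
    tsupport ψ ⊆ interior T.region →
    ∫ p in T.region, (sys.g p.1 (u p) ⬝ᵥ (fderiv ℝ ψ p (0, 1)).ofLp +
      ∑ j, (sys.f p.1 (u p)).col j ⬝ᵥ (fderiv ℝ ψ p (basisVec j, 0)).ofLp) = 0

/-- The Friedrichs boundary condition `(𝒟 - ℬ) u = 0` on `∂_bdr` of the tent, for a function `u`
whose pull-back `û = u ∘ Φ` is a family of functions in `H¹(Ω^v)^L`. The boundary values of `u` at
the points `Φ(x, τ)` of `∂_bdr` are those of the trace of `û(τ)`, and `𝒟 = ∑ j, n_j ℒ^j`. -/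
def SatisfiesBoundaryCondition (uhat : ℝ → H1 (interior T.patch) L) : Prop :=
  ∀ τ ∈ Ioo (0 : ℝ) 1, ∀ (s : mesh.Element) (f : Finset (Space N)) (n : Space N), T.v ∈ s.1 →
    mesh.IsBoundaryFacet s f n →
    ∃ h : Space N → State L, IsTrace (uhat τ) s f h ∧
      ∀ᵐ x ∂(facetMeasure f), T.Phi (x, τ) ∈ T.bdrBoundary →
        (sys.normalMatrix s n - sys.bdry x) *ᵥ (h x).ofLp = 0

/-- The matrix field of the operator `M₀`. -/
def M0 (x : Space N) : Matrix (Fin L) (Fin L) ℝ :=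
  mesh.field sys.G x - ∑ j, (∇ T.bot x) j • mesh.field (sys.A j) x

/-- The matrix field of the operator `M₁`. -/
def M1 (x : Space N) : Matrix (Fin L) (Fin L) ℝ :=
  ∑ j, (∇ T.delta x) j • mesh.field (sys.A j) x

/-- The form `(M(τ) w, z)` on `L²(Ω^v)^L`, where `M(τ) = M₀ - τ M₁`. -/
def massForm (τ : ℝ) (w z : Space N → State L) : ℝ :=
  ∫ x in T.patch, ((T.M0 sys x - τ • T.M1 sys x) *ᵥ (w x).ofLp) ⬝ᵥ (z x).ofLp

/-- `‖w‖_{M(τ)} = (M(τ) w, w)^{1/2}`. -/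
def massNorm (τ : ℝ) (w : Space N → State L) : ℝ := Real.sqrt (T.massForm sys τ w w)

/-- The tent-specific norm of `w` on the graph over `Ω^v` of a front `φ`:
the square root of `∫ [g(w(x, φ(x))) - f(w(x, φ(x))) grad φ(x)] · w(x, φ(x))`. -/
def frontNorm (φ : Space N → ℝ) (w : Space N × ℝ → State L) : ℝ :=
  Real.sqrt (∫ x in T.patch,
    (sys.g x (w (x, φ x)) - sys.f x (w (x, φ x)) *ᵥ (∇ φ x).ofLp) ⬝ᵥ (w (x, φ x)).ofLp)

end Tent

end TentPitching

end

noncomputable section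
namespace TentPitching

/-! ### Integration over a simplex in cone coordinates -/

/-! The map `Phi` flattens the tent to a cylinder. Its Jacobian is δ, and the chain rule turns the
equation into ∂_τ(M(τ)û) + ∑ ∂_j(δ ℒ^j û) = 0 over each open element. There the matrices are
constant and ∑ (∂_j δ) ℒ^j is M₁, so differentiating M(τ) = M₀ - τ M₁ produces a term -M₁û that the
derivative of δ cancels, leaving M(τ)û' + δ ∑ ℒ^j ∂_j û = 0 (`ae_equation`). By symmetry the energy
E = (M(τ)û, û) then satisfies E' = 2(Mû', û) - (M₁û, û) = -∑_s ∫_s div(δ ℒû·û), the sum running over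
the elements s of the patch.

The divergence theorem on each element leaves a sum over facets, of three kinds. On a facet opposite
to the tent vertex δ is zero. A facet through that vertex shared by two elements contributes
nothing, because ∑ ∂_j ℒ^j = 0 makes the normal matrix continuous across it (`facetMatrix_jump`),
while δ and û do not jump. The other facets lie in ∂Ω; there 𝒟û = ℬû, so 𝒟û·û = ½(ℬ + ℬᵗ)û·û ≥ 0.
Hence E' ≤ 0 (`sum_radialFlux_nonneg`, `antitoneOn_massForm`).

As û(τ) is only in H¹, facet integrals are replaced by element integrals. The radial field x - p
centred at a vertex p is tangent to the facets through p, so for smooth q the integral of div((x -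
p) q) is a positive multiple of the integral of q over the facet opposite p (`exists_facet_formula`,
by cone coordinates). For quadratic q the left side makes sense for H¹ functions and is continuous
in H¹; this is `radialFlux`. A constant field is a combination of the radial fields of the vertices,
which yields the usual divergence theorem (`sum_radialFlux_facetMatrix`). Vanishing and cancellation
of facet terms are proved for smooth functions and passed to the limit; an actual trace enters only
on ∂Ω.

The smooth approximations come from contracting towards an interior point and then mollifying
(`exists_smoothApprox`), so no extension operator is needed. For an interior facet the contraction
is centred at its barycentre, which gives one approximating sequence valid on both sides. -/

/-- The splitting of a space into the kernel of a functional and the line of a vector `d`. -/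
def kerProdEquiv {N : ℕ} (ℓ : Space N →ₗ[ℝ] ℝ) (d : Space N) (hd : ℓ d = -1) :
    (LinearMap.ker ℓ × ℝ) ≃L[ℝ] Space N :=
  LinearEquiv.toContinuousLinearEquiv
    { toFun := fun q => (q.1 : Space N) + q.2 • d
      map_add' := by intro x y; simp only [Prod.fst_add, Prod.snd_add, Submodule.coe_add]; module
      map_smul' := by
        intro c x
        simp only [Prod.smul_fst, Prod.smul_snd, Submodule.coe_smul, RingHom.id_apply, smul_eq_mul]
        module
      invFun := fun x => (⟨x + ℓ x • d, by simp [hd]⟩, -ℓ x)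
      left_inv := by
        rintro ⟨⟨z, hz⟩, t⟩
        have hz' : ℓ z = 0 := hz
        ext <;> simp [hz', hd]
      right_inv := by intro x; simp }

theorem finrank_ker_add_one {N : ℕ} (ℓ : Space N →ₗ[ℝ] ℝ) (d : Space N) (hd : ℓ d = -1) :
    Module.finrank ℝ (LinearMap.ker ℓ) + 1 = N := by
  have := (kerProdEquiv ℓ d hd).toLinearEquiv.finrank_eq
  simpa using this

/-- The surface measure on a hyperplane through the origin is a Haar measure. -/
theorem isAddHaarMeasure_ker {N : ℕ} (ℓ : Space N →ₗ[ℝ] ℝ) (d : Space N) (hd : ℓ d = -1) :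
    (Measure.hausdorffMeasure ((N : ℝ) - 1) : Measure (LinearMap.ker ℓ)).IsAddHaarMeasure := by
  have h : (N : ℝ) - 1 = (Module.finrank ℝ (LinearMap.ker ℓ) : ℝ) := by
    have := finrank_ker_add_one ℓ d hd
    have h2 : ((Module.finrank ℝ (LinearMap.ker ℓ) : ℕ) : ℝ) + 1 = N := by exact_mod_cast this
    linarith
  rw [h]; infer_instance

/-- Both sides are Haar measures, hence proportional. The factor, which depends on `d` and on the
normalisation of Hausdorff measure, is never computed: only its positivity and finiteness matter. -/
theorem exists_volume_eq_smul_map {N : ℕ} (ℓ : Space N →ₗ[ℝ] ℝ) (d : Space N) (hd : ℓ d = -1) :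
    ∃ c : ℝ≥0∞, c ≠ 0 ∧ c ≠ ⊤ ∧ (volume : Measure (Space N)) =
      c • Measure.map (kerProdEquiv ℓ d hd)
        ((Measure.hausdorffMeasure ((N : ℝ) - 1) : Measure (LinearMap.ker ℓ)).prod volume) := by
  have := isAddHaarMeasure_ker ℓ d hd
  have : (Measure.map (kerProdEquiv ℓ d hd)
        ((Measure.hausdorffMeasure ((N : ℝ) - 1) : Measure (LinearMap.ker ℓ)).prod
          volume)).IsAddHaarMeasure := ContinuousLinearEquiv.isAddHaarMeasure_map _ _
  set μ := (Measure.map (kerProdEquiv ℓ d hd)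
        ((Measure.hausdorffMeasure ((N : ℝ) - 1) : Measure (LinearMap.ker ℓ)).prod
          volume))
  refine ⟨(Measure.addHaarScalarFactor (volume : Measure (Space N)) μ : ℝ≥0∞), ?_, by simp, ?_⟩
  · exact ENNReal.coe_ne_zero.mpr (Measure.addHaarScalarFactor_pos_of_isAddHaarMeasure _ _).ne'
  · exact Measure.isAddLeftInvariant_eq_smul _ _

section AffineBasis
variable {N : ℕ} {ι : Type*} (b : AffineBasis ι ℝ (Space N))

theorem coord_linear_sub (k : ι) (x y : Space N) :
    (b.coord k).linear (x - y) = b.coord k x - b.coord k y := by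
  have := (b.coord k).linearMap_vsub x y
  simpa using this

theorem coord_add_linear (k : ι) (x y : Space N) :
    b.coord k (x + y) = b.coord k x + (b.coord k).linear y := by
  have := (b.coord k).map_vadd x y
  simp only [vadd_eq_add] at this
  rw [add_comm x y, this, add_comm]

theorem isCompact_simplex [Finite ι] : IsCompact (convexHull ℝ (range b)) :=
  (finite_range b).isCompact_convexHull ℝ

theorem volume_frontier_simplex : volume (frontier (convexHull ℝ (range b))) = 0 :=
  (convex_convexHull ℝ _).addHaar_frontier _

theorem setIntegral_interior_simplex (f : Space N → ℝ) :
    ∫ x in interior (convexHull ℝ (range b)), f x = ∫ x in convexHull ℝ (range b), f x := by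
  apply setIntegral_congr_set
  exact interior_ae_eq_of_null_frontier (volume_frontier_simplex b)

/-- Moving along the ray from the apex `b i` multiplies every other barycentric coordinate by `t`
and makes the coordinate of the apex `1 - t`. So membership for one `t` in `(0, 1]` is decided on
the base facet, at `t = 1`. -/
theorem cone_mem_simplex_iff {i j : ι} (hj : j ≠ i) (z : LinearMap.ker (b.coord i).linear) {t : ℝ}
    (ht : t ∈ Ioc (0:ℝ) 1) :
    b i + t • ((z : Space N) + (b j - b i)) ∈ convexHull ℝ (range b) ↔
      b j + (z : Space N) ∈ convexHull ℝ (range b) := by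
  classical
  rw [b.convexHull_eq_nonneg_coord]
  have hz : (b.coord i).linear (z : Space N) = 0 := z.2
  have key : ∀ k, k ≠ i → b.coord k (b i + t • ((z : Space N) + (b j - b i))) =
      t * b.coord k (b j + (z : Space N)) := by
    intro k hk
    rw [coord_add_linear, map_smul, map_add, coord_linear_sub, coord_add_linear]
    simp only [b.coord_apply, if_neg hk, smul_eq_mul]; ring
  have key2 : b.coord i (b i + t • ((z : Space N) + (b j - b i))) = 1 - t := by
    rw [coord_add_linear, map_smul, map_add, coord_linear_sub, hz]
    simp only [b.coord_apply, if_neg hj.symm, smul_eq_mul, if_true]; ring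
  have key3 : b.coord i (b j + (z : Space N)) = 0 := by
    rw [coord_add_linear, hz]; simp [b.coord_apply, hj.symm]
  constructor
  · intro h k
    by_cases hk : k = i
    · rw [hk, key3]
    · have := h k
      rw [key k hk] at this
      exact nonneg_of_mul_nonneg_right this ht.1
  · intro h k
    by_cases hk : k = i
    · rw [hk, key2]; linarith [ht.2]
    · rw [key k hk]; exact mul_nonneg ht.1.le (h k)

/-- The coordinate of the apex is `1 - t` and the others sum to `t`, which forces `0 ≤ t ≤ 1` inside
the simplex. The apex level `t = 0` is excluded because it is a null set in `t`. -/
theorem cone_notMem_simplex [Fintype ι] {i j : ι} (hj : j ≠ i)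
    (z : LinearMap.ker (b.coord i).linear) {t : ℝ} (ht0 : t ≠ 0) (ht : t ∉ Ioc (0:ℝ) 1) :
    b i + ((z : Space N) + t • (b j - b i)) ∉ convexHull ℝ (range b) := by
  classical
  rw [b.convexHull_eq_nonneg_coord]
  intro h
  have hz : (b.coord i).linear (z : Space N) = 0 := z.2
  have key2 : b.coord i (b i + ((z : Space N) + t • (b j - b i))) = 1 - t := by
    rw [coord_add_linear, map_add, map_smul, coord_linear_sub, hz]
    simp only [b.coord_apply, if_neg hj.symm, smul_eq_mul, if_true]; ring
  have h1 := h i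
  rw [key2] at h1
  have h2 := b.sum_coord_apply_eq_one (b i + ((z : Space N) + t • (b j - b i)))
  rw [← Finset.add_sum_erase _ _ (Finset.mem_univ i), key2] at h2
  have h3 : 0 ≤ ∑ k ∈ Finset.univ.erase i, b.coord k (b i + ((z : Space N) + t • (b j - b i))) :=
    Finset.sum_nonneg fun k _ => h k
  exact ht ⟨lt_of_le_of_ne (by linarith) ht0.symm, by linarith⟩

/-- The cone formula for the facet of a simplex opposite to a vertex: the divergence theorem for
the radial vector field with centre at that vertex. -/
theorem exists_facet_formula [Fintype ι] {i j : ι} (hj : j ≠ i) : ∃ C : ℝ, 0 < C ∧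
    (∀ w : Space N → ℝ, ContDiff ℝ 1 w →
      ∫ x in interior (convexHull ℝ (range b)), (N * w x + fderiv ℝ w x (x - b i)) =
        C * ∫ z in {z : LinearMap.ker (b.coord i).linear |
          b j + (z : Space N) ∈ convexHull ℝ (range b)}, w (b j + z)
            ∂(Measure.hausdorffMeasure ((N : ℝ) - 1))) := by
  set ℓ := (b.coord i).linear with hℓ
  set d : Space N := b j - b i with hd'
  have hd : ℓ d = -1 := by
    classical
    rw [hd', coord_linear_sub]; simp [b.coord_apply, hj.symm]
  set S := convexHull ℝ (range b) with hS
  have hScomp : IsCompact S := isCompact_simplex b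
  obtain ⟨c, hc0, hctop, hvol⟩ := exists_volume_eq_smul_map ℓ d hd
  have hHaar := isAddHaarMeasure_ker ℓ d hd
  set μ : Measure (LinearMap.ker ℓ) := Measure.hausdorffMeasure ((N : ℝ) - 1) with hμ
  have hrank := finrank_ker_add_one ℓ d hd
  set n := Module.finrank ℝ (LinearMap.ker ℓ) with hn
  refine ⟨c.toReal, ENNReal.toReal_pos hc0 hctop, fun w hw => ?_⟩
  rw [setIntegral_interior_simplex]
  set F : Set (LinearMap.ker ℓ) := {z | b j + (z : Space N) ∈ S} with hF
  have hFcomp : IsCompact F := by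
    have h1 : Topology.IsClosedEmbedding (fun z : LinearMap.ker ℓ => b j + (z : Space N)) :=
      (Homeomorph.addLeft (b j)).isClosedEmbedding.comp
        ((LinearMap.ker ℓ).closed_of_finiteDimensional.isClosedEmbedding_subtypeVal)
    exact h1.isCompact_preimage hScomp
  set G : Space N → ℝ := fun x => N * w x + fderiv ℝ w x (x - b i) with hG
  have hGc : Continuous G := by
    have := hw.continuous
    have := hw.continuous_fderiv (by norm_num)
    fun_prop
  -- The integrand, extended by zero and with the apex moved to the origin, where dilations act
  -- linearly.
  set Q : Space N → ℝ := fun y => S.indicator G (b i + y) with hQ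
  have hQint : Integrable Q volume := by
    have h1 : Integrable (S.indicator G) volume :=
      (hGc.continuousOn.integrableOn_compact hScomp).integrable_indicator hScomp.measurableSet
    exact h1.comp_add_left (b i)
  have hme : MeasurableEmbedding (kerProdEquiv ℓ d hd) :=
    (kerProdEquiv ℓ d hd).toHomeomorph.measurableEmbedding
  have hQprod : Integrable (fun q : LinearMap.ker ℓ × ℝ => Q (q.1 + q.2 • d)) (μ.prod volume) := by
    rw [hvol, integrable_smul_measure hc0 hctop,
      hme.integrable_map_iff] at hQint
    exact hQint
  have e1 : ∫ x in S, G x = c.toReal * ∫ q : LinearMap.ker ℓ × ℝ, Q (q.1 + q.2 • d) ∂(μ.prod volume) := by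
    rw [← integral_indicator hScomp.measurableSet,
      ← integral_add_left_eq_self (μ := (volume : Measure (Space N))) _ (b i)]
    conv_lhs => rw [hvol]
    rw [integral_smul_measure, smul_eq_mul,
      hme.integral_map]
    rfl
  -- The slice of the cone at level `t` is the base slice dilated by `t`; substituting `t • z` in a
  -- hyperplane of dimension `n = N - 1` brings out the factor `t ^ n`.
  have e2 : ∀ t : ℝ, t ≠ 0 → ∫ z, Q ((z : Space N) + t • d) ∂μ =
      (Ioc (0:ℝ) 1).indicator (fun t => ∫ z in F, t ^ n * G (b i + t • ((z : Space N) + d)) ∂μ) t := by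
    intro t ht0
    by_cases ht : t ∈ Ioc (0:ℝ) 1
    · rw [indicator_of_mem ht]
      have h3 := Measure.integral_comp_smul μ (fun z : LinearMap.ker ℓ => Q ((z : Space N) + t • d)) t
      rw [← hn, abs_of_pos (inv_pos.mpr (pow_pos ht.1 n)), smul_eq_mul,
        eq_inv_mul_iff_mul_eq₀ (pow_pos ht.1 n).ne'] at h3
      rw [← h3, integral_const_mul, ← integral_indicator hFcomp.measurableSet]
      congr 1
      apply integral_congr_ae
      filter_upwards with z
      have h4 : b i + (((t • z : LinearMap.ker ℓ) : Space N) + t • d) =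
          b i + t • ((z : Space N) + d) := by
        rw [Submodule.coe_smul, smul_add]
      simp only [hQ, h4]
      have h5 := cone_mem_simplex_iff b hj z ht
      by_cases hz : z ∈ F
      · rw [indicator_of_mem hz, indicator_of_mem (h5.mpr hz)]
      · rw [indicator_of_notMem hz, indicator_of_notMem (fun h => hz (h5.mp h))]
    · rw [indicator_of_notMem ht]
      apply integral_eq_zero_of_ae
      filter_upwards with z
      exact indicator_of_notMem (cone_notMem_simplex b hj z ht0 ht) _
  rw [e1, integral_prod_symm _ hQprod]
  congr 1
  have e3 : ∫ t : ℝ, ∫ z, Q ((z : Space N) + t • d) ∂μ =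
      ∫ t in Ioc (0:ℝ) 1, ∫ z in F, t ^ n * G (b i + t • ((z : Space N) + d)) ∂μ := by
    rw [← integral_indicator measurableSet_Ioc]
    apply integral_congr_ae
    filter_upwards [Measure.ae_ne volume (0:ℝ)] with t ht
    exact e2 t ht
  rw [e3]
  have hcont : Continuous (fun q : ℝ × LinearMap.ker ℓ =>
      q.1 ^ n * G (b i + q.1 • ((q.2 : Space N) + d))) := by
    have : Continuous (fun q : ℝ × LinearMap.ker ℓ => (q.2 : Space N)) :=
      continuous_subtype_val.comp continuous_snd
    fun_prop
  rw [integral_integral_swap]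
  · apply setIntegral_congr_fun hFcomp.measurableSet
    intro z hz
    beta_reduce
    rw [← intervalIntegral.integral_of_le zero_le_one]
    -- Along a ray, `t ^ (N - 1)` times the radial divergence is the exact derivative of `t ^ N *
    -- w`. The value at `0` vanishes since `N > 0`, and at `1` the ray has reached `b j + z` on the
    -- base.
    have hder : ∀ t : ℝ, HasDerivAt (fun t : ℝ => t ^ N * w (b i + t • ((z : Space N) + d)))
        (t ^ n * G (b i + t • ((z : Space N) + d))) t := by
      intro t
      have h1 : HasDerivAt (fun t : ℝ => b i + t • ((z : Space N) + d)) ((z : Space N) + d) t := by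
        simpa using ((hasDerivAt_id t).smul_const ((z : Space N) + d)).const_add (b i)
      have h2 := ((hw.differentiable (by norm_num)) (b i + t • ((z : Space N) + d))).hasFDerivAt
      have h3 := (hasDerivAt_pow N t).mul (h2.comp_hasDerivAt t h1)
      refine HasDerivAt.congr_deriv h3 ?_
      simp only [hG, add_sub_cancel_left, map_smul, smul_eq_mul, Function.comp_apply]
      have hN1 : N - 1 = n := by omega
      rw [hN1]
      have h5 : t ^ N = t ^ n * t := by rw [← hrank, pow_succ]
      rw [h5]; ring
    rw [intervalIntegral.integral_eq_sub_of_hasDerivAt (fun t _ => hder t)]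
    · have : 0 < N := by omega
      simp only [one_pow, one_smul, one_mul, zero_pow this.ne', zero_mul, sub_zero]
      congr 1
      rw [hd']; abel
    · apply Continuous.intervalIntegrable
      exact hcont.comp (Continuous.prodMk continuous_id continuous_const)
  · have h1 : IntegrableOn (fun q : ℝ × LinearMap.ker ℓ =>
      q.1 ^ n * G (b i + q.1 • ((q.2 : Space N) + d))) (Icc 0 1 ×ˢ F) (volume.prod μ) :=
      hcont.continuousOn.integrableOn_compact (isCompact_Icc.prod hFcomp)
    have h2 := h1.mono_set (prod_mono Ioc_subset_Icc_self (Subset.refl F))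
    rw [IntegrableOn, ← Measure.prod_restrict] at h2
    exact h2

end AffineBasis

/-! ### Geometry of the mesh -/

theorem affineMap_sum {N : ℕ} (α : Space N →ᵃ[ℝ] ℝ) {ι : Type*} (f : Finset ι) (w : ι → ℝ)
    (q : ι → Space N) (hw : ∑ k ∈ f, w k = 1) :
    α (∑ k ∈ f, w k • q k) = ∑ k ∈ f, w k * α (q k) := by
  have h : ∀ x, α x = α.linear x + α 0 := fun x => by
    have := congrFun α.decomp x; simpa using this
  rw [h, map_sum]
  simp_rw [h (q _), mul_add, Finset.sum_add_distrib, ← Finset.sum_mul, hw, map_smul, smul_eq_mul,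
    one_mul]

theorem affineMap_add {N : ℕ} (α : Space N →ᵃ[ℝ] ℝ) (x y : Space N) :
    α (x + y) = α x + α.linear y := by
  have := α.map_vadd x y
  simp only [vadd_eq_add] at this
  rw [add_comm x y, this, add_comm]

theorem affineMap_linear_sub {N : ℕ} (α : Space N →ᵃ[ℝ] ℝ) (x y : Space N) :
    α.linear (x - y) = α x - α y := by
  have := α.linearMap_vsub x y
  simpa using this

theorem continuous_affineMap {N : ℕ} (α : Space N →ᵃ[ℝ] ℝ) : Continuous α :=
  α.continuous_of_finiteDimensional

/-- The barycentre of a finite set of points. -/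
def barycentre {N : ℕ} (f : Finset (Space N)) : Space N := ∑ q ∈ f, (1 / (f.card : ℝ)) • q

theorem affineMap_barycentre {N : ℕ} (α : Space N →ᵃ[ℝ] ℝ) {f : Finset (Space N)}
    (hf : f.Nonempty) : α (barycentre f) = ∑ q ∈ f, (1 / (f.card : ℝ)) * α q := by
  apply affineMap_sum α f _ id
  have : (f.card : ℝ) ≠ 0 := by exact_mod_cast hf.card_pos.ne'
  rw [Finset.sum_const, nsmul_eq_mul]
  field_simp

namespace SpatialMesh
variable {N : ℕ} {mesh : SpatialMesh N}

instance : Finite mesh.Element := by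
  have : Finite mesh.complex.faces := mesh.finite
  exact Finite.of_injective
    (fun s : mesh.Element => (⟨s.1, s.2.1⟩ : mesh.complex.faces))
    (fun s t h => Subtype.ext (congrArg (fun x : mesh.complex.faces => x.1) h))

instance : Fintype mesh.Element := Fintype.ofFinite _

namespace Element
variable (s t : mesh.Element)

/-- The vertices of an element, as an affine basis. -/
def basis : AffineBasis s.1 ℝ (Space N) where
  toFun := fun p => p
  ind' := mesh.complex.indep s.2.1
  tot' := by
    have h : AffineIndependent ℝ (fun p : s.1 => (p : Space N)) := mesh.complex.indep s.2.1
    rw [h.affineSpan_eq_top_iff_card_eq_finrank_add_one]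
    simp [s.2.2]

@[simp] theorem basis_apply (p : s.1) : s.basis p = p := rfl

theorem range_basis : range s.basis = (s.1 : Set (Space N)) := by
  ext x; simp

theorem cell_eq : s.cell = convexHull ℝ (range s.basis) := by rw [range_basis]; rfl

theorem mem_cell {x : Space N} : x ∈ s.cell ↔ ∀ p, 0 ≤ s.basis.coord p x := by
  rw [cell_eq, s.basis.convexHull_eq_nonneg_coord]; rfl

theorem mem_interior_cell {x : Space N} : x ∈ interior s.cell ↔ ∀ p, 0 < s.basis.coord p x := by
  rw [cell_eq, s.basis.interior_convexHull]; rfl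

theorem isCompact_cell : IsCompact s.cell := by rw [cell_eq]; exact isCompact_simplex _

theorem interior_ae_eq : interior s.cell =ᵐ[volume] s.cell := by
  rw [cell_eq]; exact interior_ae_eq_of_null_frontier (volume_frontier_simplex _)

theorem mem_cell_of_mem {p : Space N} (hp : p ∈ s.1) : p ∈ s.cell := subset_convexHull ℝ _ hp

variable {s t}

theorem coord_vertex (p : s.1) {q : Space N} (hq : q ∈ s.1) :
    s.basis.coord p q = if (p : Space N) = q then 1 else 0 := by
  classical
  have := s.basis.coord_apply p ⟨q, hq⟩
  rw [basis_apply] at this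
  rw [this]
  simp only [Subtype.ext_iff]

theorem sum_coord_smul (x : Space N) : ∑ p, s.basis.coord p x • (p : Space N) = x :=
  s.basis.linear_combination_coord_eq_self x

theorem affineMap_eq_sum (α : Space N →ᵃ[ℝ] ℝ) (x : Space N) :
    α x = ∑ p : s.1, s.basis.coord p x * α p := by
  conv_lhs => rw [← sum_coord_smul (s := s) x]
  exact affineMap_sum α _ _ _ (s.basis.sum_coord_apply_eq_one x)

theorem facet_nonempty (hN : 0 < N) {f : Finset (Space N)} (hf : f.card = N) : f.Nonempty :=
  Finset.card_pos.mp (hf.symm ▸ hN)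

theorem card_erase [DecidableEq (Space N)] (p : s.1) : (s.1.erase p).card = N := by
  rw [Finset.card_erase_of_mem p.2, s.2.2]; simp

/-- This lets facets be handled through the vanishing of one barycentric coordinate instead of
through convex hulls. -/
theorem mem_convexHull_erase_iff [DecidableEq (Space N)] (p : s.1) {x : Space N} :
    x ∈ convexHull ℝ (s.1.erase p : Set (Space N)) ↔ x ∈ s.cell ∧ s.basis.coord p x = 0 := by
  constructor
  · intro hx
    refine ⟨convexHull_mono (by simp) hx, ?_⟩
    have h1 : Convex ℝ {x | s.basis.coord p x = 0} := by
      have := (convex_singleton (0 : ℝ)).affine_preimage (s.basis.coord p)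
      exact this
    refine convexHull_min ?_ h1 hx
    intro q hq
    rw [Finset.mem_coe, Finset.mem_erase] at hq
    simp [coord_vertex p hq.2, hq.1.symm]
  · rintro ⟨hx, h0⟩
    rw [mem_cell] at hx
    have h1 := s.basis.sum_coord_apply_eq_one x
    rw [← Finset.add_sum_erase _ _ (Finset.mem_univ p), h0, zero_add] at h1
    have h2 := sum_coord_smul (s := s) x
    rw [← Finset.add_sum_erase _ _ (Finset.mem_univ p), h0, zero_smul, zero_add] at h2
    rw [← h2]
    refine (convex_convexHull ℝ _).sum_mem (fun k _ => hx k) h1 fun k hk => ?_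
    apply subset_convexHull
    simp only [Finset.mem_erase, Finset.mem_univ, and_true] at hk
    rw [Finset.mem_coe, Finset.mem_erase]
    exact ⟨fun h => hk (Subtype.ext h), k.2⟩

/-- This is how conformity of the mesh is used: two cells meet in the hull of their common vertices,
and there the coordinate of any vertex not shared is zero. -/
theorem mem_of_coord_pos {x : Space N} (hs : x ∈ s.cell) (ht : x ∈ t.cell) {p : s.1}
    (hp : 0 < s.basis.coord p x) : (p : Space N) ∈ t.1 := by
  by_contra hpt
  have h1 := mesh.complex.inter_subset_convexHull s.2.1 t.2.1 ⟨hs, ht⟩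
  have h2 : Convex ℝ {x | s.basis.coord p x = 0} :=
    (convex_singleton (0 : ℝ)).affine_preimage (s.basis.coord p)
  have h3 : x ∈ {x | s.basis.coord p x = 0} := by
    refine convexHull_min ?_ h2 h1
    rintro q ⟨hqs, hqt⟩
    have : (p : Space N) ≠ q := fun h => hpt (h ▸ hqt)
    show s.basis.coord p q = 0
    rw [coord_vertex p hqs, if_neg this]
  exact hp.ne' h3

theorem eq_of_subset (h : s.1 ⊆ t.1) : s = t :=
  Subtype.ext (Finset.eq_of_subset_of_card_le h (by rw [s.2.2, t.2.2]))

theorem eq_of_mem_interior {x : Space N} (hs : x ∈ interior s.cell) (ht : x ∈ t.cell) : s = t :=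
  eq_of_subset fun p hp => mem_of_coord_pos (interior_subset hs) ht
    (p := ⟨p, hp⟩) (s.mem_interior_cell.mp hs _)

theorem field_eq {L : ℕ} (A : mesh.Element → Matrix (Fin L) (Fin L) ℝ) {x : Space N}
    (hx : x ∈ interior s.cell) : mesh.field A x = A s := by
  rw [field, finsum_eq_single _ s, indicator_of_mem hx]
  intro t ht
  exact indicator_of_notMem (fun h => ht (eq_of_mem_interior h (interior_subset hx))) _

theorem cell_subset_space : s.cell ⊆ mesh.complex.space :=
  Geometry.SimplicialComplex.convexHull_subset_space s.2.1

theorem interior_cell_subset_domain : interior s.cell ⊆ mesh.domain :=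
  interior_mono cell_subset_space

theorem cell_subset_closure_interior : s.cell ⊆ closure (interior s.cell) := by
  have h : (interior s.cell).Nonempty := by
    rw [cell_eq]
    exact ⟨_, s.basis.centroid_mem_interior_convexHull⟩
  have hc : Convex ℝ s.cell := convex_convexHull ℝ _
  rw [hc.closure_interior_eq_closure_of_nonempty_interior h]
  exact subset_closure

theorem coord_barycentre_erase [DecidableEq (Space N)] (hN : 0 < N) (p k : s.1) :
    s.basis.coord k (barycentre (s.1.erase p)) = if k = p then 0 else 1 / (N : ℝ) := by
  have hc := card_erase p
  rw [affineMap_barycentre _ (facet_nonempty hN hc), hc]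
  have : ∀ q ∈ s.1.erase (p : Space N), (1 / (N : ℝ)) * s.basis.coord k q =
      if (k : Space N) = q then 1 / (N : ℝ) else 0 := by
    intro q hq
    rw [coord_vertex k (Finset.mem_of_mem_erase hq)]
    split_ifs <;> simp
  rw [Finset.sum_congr rfl this, Finset.sum_ite_eq]
  simp only [Finset.mem_erase, k.2, and_true, Subtype.coe_ne_coe]
  split_ifs <;> simp_all

/-- Two elements with a common facet lie on opposite sides of it. -/
theorem coord_neg_of_ne [DecidableEq (Space N)] (hN : 0 < N) (hst : s ≠ t) {p : s.1} {q : t.1}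
    (hf : s.1.erase p = t.1.erase q) : s.basis.coord p q < 0 := by
  by_contra hneg
  have hsub : s.1.erase p ⊆ t.1 := hf ▸ Finset.erase_subset _ _
  have hpt : (p : Space N) ∉ t.1 := by
    intro h
    refine hst (eq_of_subset fun r hr => ?_)
    by_cases hrp : r = p
    · rwa [hrp]
    · exact hsub (Finset.mem_erase.mpr ⟨hrp, hr⟩)
  -- Assuming the coordinate nonnegative, a small step from the barycentre of the facet towards `q`
  -- stays in both cells. If the step has positive `p`-coordinate, conformity puts `p` into `t`; if
  -- it is zero, the coordinate vanishes at all vertices of `t`, hence everywhere. Both are absurd.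
  set c := barycentre (s.1.erase p) with hc
  -- a point of `t` close to the barycentre of the facet
  have hlim : ∀ k : s.1, k ≠ p → ∀ᶠ ε : ℝ in 𝓝[>] 0,
      0 < s.basis.coord k (c + ε • ((q : Space N) - c)) := by
    intro k hk
    have h1 : Tendsto (fun ε : ℝ => s.basis.coord k (c + ε • ((q : Space N) - c))) (𝓝 0)
        (𝓝 (s.basis.coord k c)) := by
      have h2 : Continuous (fun ε : ℝ => s.basis.coord k (c + ε • ((q : Space N) - c))) :=
        (continuous_affineMap _).comp (by fun_prop)
      simpa using h2.tendsto 0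
    have h3 : 0 < s.basis.coord k c := by
      rw [hc, coord_barycentre_erase hN, if_neg hk]; positivity
    exact (h1.eventually (lt_mem_nhds h3)).filter_mono nhdsWithin_le_nhds
  have h4 : ∀ᶠ ε : ℝ in 𝓝[>] 0, ∀ k : s.1, k ≠ p →
      0 < s.basis.coord k (c + ε • ((q : Space N) - c)) :=
    eventually_all.mpr fun k => by
      by_cases hk : k = p
      · simp [hk]
      · simpa [hk] using hlim k hk
  obtain ⟨ε, hε, hε0, hε1⟩ := (h4.and (Ioc_mem_nhdsGT (zero_lt_one' ℝ))).exists
  set x := c + ε • ((q : Space N) - c) with hx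
  have hct : c ∈ t.cell := by
    rw [mem_cell]
    intro k
    rw [hc, hf, coord_barycentre_erase hN]
    split_ifs <;> positivity
  have hxt : x ∈ t.cell := by
    have := (convex_convexHull ℝ _ : Convex ℝ t.cell).add_smul_sub_mem hct
      (t.mem_cell_of_mem q.2) ⟨hε0.le, hε1⟩
    exact this
  have hxp : s.basis.coord p x = ε * s.basis.coord p q := by
    rw [hx, affineMap_add, map_smul, affineMap_linear_sub, hc, coord_barycentre_erase hN]
    simp
  have hxp0 : 0 ≤ s.basis.coord p x := by
    rw [hxp]; exact mul_nonneg hε0.le (not_lt.mp hneg)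
  have hxs : x ∈ s.cell := by
    rw [mem_cell]
    intro k
    by_cases hk : k = p
    · rw [hk]; exact hxp0
    · exact (hε k hk).le
  rcases hxp0.eq_or_lt with h0 | h0
  · -- then `q` would lie in the hyperplane of the facet
    have hq0 : s.basis.coord p q = 0 := by
      rw [hxp] at h0
      rcases mul_eq_zero.mp h0.symm with h | h
      · exact absurd h hε0.ne'
      · exact h
    have hall : ∀ y, s.basis.coord p y = 0 := by
      intro y
      rw [affineMap_eq_sum (s := t)]
      apply Finset.sum_eq_zero
      intro r _
      by_cases hr : r = q
      · rw [hr, hq0, mul_zero]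
      · have : (r : Space N) ∈ s.1.erase p := by
          rw [hf]; exact Finset.mem_erase.mpr ⟨fun h => hr (Subtype.ext h), r.2⟩
        rw [Finset.mem_erase] at this
        rw [coord_vertex p this.2, if_neg this.1.symm, mul_zero]
    have h1 := hall p
    rw [coord_vertex p p.2] at h1
    simp at h1
  · exact hpt (mem_of_coord_pos hxs hxt h0)

/-- The barycentric coordinates of two elements with a common facet are proportional. -/
theorem coord_eq_mul [DecidableEq (Space N)] {p : s.1} {q : t.1}
    (hf : s.1.erase p = t.1.erase q) (x : Space N) :
    s.basis.coord p x = s.basis.coord p q * t.basis.coord q x := by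
  rw [affineMap_eq_sum (s := t), Finset.sum_eq_single q, mul_comm]
  · intro r _ hr
    have : (r : Space N) ∈ s.1.erase p := by
      rw [hf]; exact Finset.mem_erase.mpr ⟨fun h => hr (Subtype.ext h), r.2⟩
    rw [Finset.mem_erase] at this
    rw [coord_vertex p this.2, if_neg this.1.symm, mul_zero]
  · simp

/-- At most two elements share a facet. -/
theorem eq_of_common_facet [DecidableEq (Space N)] (hN : 0 < N) {r : mesh.Element} (hst : s ≠ t)
    (hsr : s ≠ r) {p : s.1} {q : t.1} {k : r.1} (hf : s.1.erase p = t.1.erase q)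
    (hg : s.1.erase p = r.1.erase k) : t = r := by
  by_contra htr
  have h1 := coord_neg_of_ne hN hst hf
  have h2 := coord_neg_of_ne hN hsr hg
  have h3 := coord_neg_of_ne hN htr (hf.symm.trans hg)
  -- If three elements shared the facet, each pair would lie on opposite sides of it; but the
  -- opposite of the opposite side is the original one, as the product of two negative numbers is
  -- positive.
  rw [coord_eq_mul hf] at h2
  nlinarith

theorem exists_erase_eq [DecidableEq (Space N)] {p : s.1} (hf : s.1.erase p ⊆ t.1) :
    ∃ q : t.1, s.1.erase p = t.1.erase q := by
  have h1 : (t.1 \ s.1.erase p).card = 1 := by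
    rw [Finset.card_sdiff_of_subset hf, t.2.2, card_erase]; simp
  obtain ⟨q, hq⟩ := Finset.card_eq_one.mp h1
  have hqt : q ∈ t.1 \ s.1.erase p := by rw [hq]; simp
  rw [Finset.mem_sdiff] at hqt
  refine ⟨⟨q, hqt.1⟩, ?_⟩
  apply Finset.eq_of_subset_of_card_le
  · intro x hx
    exact Finset.mem_erase.mpr ⟨fun h => hqt.2 (by have h' : x = q := h; rwa [h'] at hx), hf hx⟩
  · rw [card_erase (s := t) ⟨q, hqt.1⟩, card_erase]

/-- The open set of points for which all barycentric coordinates other than that of `p` are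
positive. -/
def facetNhd (p : s.1) : Set (Space N) := {x | ∀ k : s.1, k ≠ p → 0 < s.basis.coord k x}

theorem isOpen_facetNhd (p : s.1) : IsOpen (facetNhd p) := by
  have : facetNhd p = ⋂ k : s.1, {x | k ≠ p → 0 < s.basis.coord k x} := by
    ext x; simp [facetNhd]
  rw [this]
  apply isOpen_iInter_of_finite
  intro k
  by_cases hk : k = p
  · simp [hk]
  · simpa [hk] using isOpen_lt continuous_const (continuous_affineMap (s.basis.coord k))

theorem barycentre_mem_facetNhd [DecidableEq (Space N)] (hN : 0 < N) (p : s.1) :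
    barycentre (s.1.erase p) ∈ facetNhd p := by
  intro k hk
  rw [coord_barycentre_erase hN, if_neg hk]
  positivity

/-- The coordinates of the two opposite vertices are negative multiples of each other, so at each
point at least one is nonnegative; all the others are positive by assumption. Together with
openness, this shows that the relative interior of a shared facet is interior to the union. -/
theorem facetNhd_inter_subset [DecidableEq (Space N)] (hN : 0 < N) (hst : s ≠ t) {p : s.1}
    {q : t.1} (hf : s.1.erase p = t.1.erase q) :
    facetNhd p ∩ facetNhd q ⊆ s.cell ∪ t.cell := by
  rintro x ⟨hs, ht⟩
  have h1 := coord_neg_of_ne hN hst hf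
  have h2 := coord_eq_mul hf x
  by_cases h : 0 ≤ s.basis.coord p x
  · left
    rw [mem_cell]
    intro k
    by_cases hk : k = p
    · rwa [hk]
    · exact (hs k hk).le
  · right
    rw [mem_cell]
    intro k
    by_cases hk : k = q
    · rw [hk]; by_contra h3; nlinarith
    · exact (ht k hk).le

/-- On the hyperplane of the common facet, the coordinates of the two elements agree. -/
theorem coord_eq_of_common_facet [DecidableEq (Space N)] {p : s.1} {q : t.1}
    (hf : s.1.erase p = t.1.erase q) {x : Space N} (hx : s.basis.coord p x = 0) {r : Space N}
    (hrs : r ∈ s.1) (hrt : r ∈ t.1) :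
    t.basis.coord ⟨r, hrt⟩ x = s.basis.coord ⟨r, hrs⟩ x := by
  rw [affineMap_eq_sum (s := s) (t.basis.coord ⟨r, hrt⟩) x, Finset.sum_eq_single ⟨r, hrs⟩]
  · rw [coord_vertex _ hrt]; simp
  · intro k _ hk
    by_cases hkp : k = p
    · rw [hkp, hx, zero_mul]
    · have : (k : Space N) ∈ t.1.erase q := by
        rw [← hf]; exact Finset.mem_erase.mpr ⟨fun h => hkp (Subtype.ext h), k.2⟩
      rw [coord_vertex _ (Finset.mem_of_mem_erase this), if_neg, mul_zero]
      intro h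
      exact hk (Subtype.ext h.symm)
  · simp

end Element

theorem space_eq : mesh.complex.space = ⋃ s : mesh.Element, s.cell := by
  ext x
  rw [Geometry.SimplicialComplex.mem_space_iff]
  constructor
  · rintro ⟨f, hf, hx⟩
    obtain ⟨s, hs, hfs, hc⟩ := mesh.pure f hf
    exact mem_iUnion.mpr ⟨⟨s, hs, hc⟩, convexHull_mono (by exact_mod_cast hfs) hx⟩
  · intro hx
    obtain ⟨s, hs⟩ := mem_iUnion.mp hx
    exact ⟨s.1, s.2.1, hs⟩

/-- A facet that belongs to one element only lies in the boundary of the domain. -/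
theorem facet_subset_frontier [DecidableEq (Space N)] (hN : 0 < N) {s : mesh.Element} {p : s.1}
    (h : ∀ t : mesh.Element, s.1.erase p ⊆ t.1 → t = s) :
    convexHull ℝ (s.1.erase p : Set (Space N)) ⊆ frontier mesh.domain := by
  intro x hx
  rw [Element.mem_convexHull_erase_iff] at hx
  obtain ⟨hxs, hxp⟩ := hx
  have hdom : IsOpen mesh.domain := isOpen_interior
  rw [hdom.frontier_eq]
  -- If `x` were interior to the domain, then so would be a nearby point `y`, obtained by moving
  -- towards the barycentre, for which all coordinates except that of `p` are positive.
  refine ⟨closure_mono Element.interior_cell_subset_domain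
    (Element.cell_subset_closure_interior hxs), fun hxd => ?_⟩
  set c := barycentre (s.1.erase p) with hc
  have hev : ∀ᶠ ε : ℝ in 𝓝[>] 0, x + ε • (c - x) ∈ mesh.domain := by
    have h2 : Continuous (fun ε : ℝ => x + ε • (c - x)) := by fun_prop
    have h3 : Tendsto (fun ε : ℝ => x + ε • (c - x)) (𝓝 0) (𝓝 x) := by
      simpa using h2.tendsto 0
    exact (h3.eventually (hdom.mem_nhds hxd)).filter_mono nhdsWithin_le_nhds
  obtain ⟨ε, hε, hε0, hε1⟩ := (hev.and (Ioc_mem_nhdsGT (zero_lt_one' ℝ))).exists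
  set y := x + ε • (c - x) with hy
  have hyp : s.basis.coord p y = 0 := by
    rw [hy, affineMap_add, map_smul, affineMap_linear_sub, hxp, hc,
      Element.coord_barycentre_erase hN]; simp
  have hyk : ∀ k : s.1, k ≠ p → 0 < s.basis.coord k y := by
    intro k hk
    rw [hy, affineMap_add, map_smul, affineMap_linear_sub, hc,
      Element.coord_barycentre_erase hN, if_neg hk, smul_eq_mul]
    have h0 := s.mem_cell.mp hxs k
    have : 0 < ε * (1 / (N : ℝ)) := by positivity
    nlinarith
  have hys : y ∈ s.cell := by
    rw [Element.mem_cell]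
    intro k
    by_cases hk : k = p
    · rw [hk, hyp]
    · exact (hyk k hk).le
  have h2 : Continuous (fun η : ℝ => y - η • ((p : Space N) - c)) := by fun_prop
  have h3 : Tendsto (fun η : ℝ => y - η • ((p : Space N) - c)) (𝓝[>] 0) (𝓝 y) := by
    have := h2.tendsto 0
    simp only [zero_smul, sub_zero] at this
    exact this.mono_left nhdsWithin_le_nhds
  -- Points just across the facet from `y` lie in the domain but not in `s`, hence in other
  -- elements. Finitely many cells have closed union, so `y` is in another cell, and conformity
  -- makes that element contain the whole facet.
  have hclosed : IsClosed (⋃ t : {t : mesh.Element // t ≠ s}, t.1.cell) :=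
    isClosed_iUnion_of_finite fun t => t.1.isCompact_cell.isClosed
  have hmem : y ∈ ⋃ t : {t : mesh.Element // t ≠ s}, t.1.cell := by
    refine hclosed.mem_of_tendsto h3 ?_
    filter_upwards [h3.eventually (hdom.mem_nhds hε), self_mem_nhdsWithin] with η hη hη0
    have hη0' : (0:ℝ) < η := hη0
    have h4 := interior_subset hη
    rw [space_eq] at h4
    obtain ⟨t, ht⟩ := mem_iUnion.mp h4
    refine mem_iUnion.mpr ⟨⟨t, ?_⟩, ht⟩
    rintro rfl
    have h5 := t.mem_cell.mp ht p
    rw [sub_eq_add_neg, affineMap_add, map_neg, map_smul, affineMap_linear_sub, hyp, hc,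
      Element.coord_barycentre_erase hN, if_pos rfl, Element.coord_vertex p p.2] at h5
    simp at h5
    linarith
  obtain ⟨⟨t, hts⟩, hyt⟩ := mem_iUnion.mp hmem
  refine hts (h t fun k hk => ?_)
  rw [Finset.mem_erase] at hk
  exact Element.mem_of_coord_pos hys hyt (p := ⟨k, hk.2⟩)
    (hyk _ fun h => hk.1 (congrArg Subtype.val h))

end SpatialMesh
-- Surface measure on facets and radial vector fields
namespace SpatialMesh
variable {N : ℕ} {mesh : SpatialMesh N}
namespace Element
variable {s t : mesh.Element}

theorem exists_ne_vertex (hN : 0 < N) (p : s.1) : ∃ q : s.1, q ≠ p := by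
  classical
  obtain ⟨q, hq⟩ := facet_nonempty hN (card_erase p)
  rw [Finset.mem_erase] at hq
  exact ⟨⟨q, hq.2⟩, fun h => hq.1 (congrArg Subtype.val h)⟩

theorem coord_linear_sub_vertex {p q : s.1} (hq : q ≠ p) :
    (s.basis.coord p).linear ((q : Space N) - p) = -1 := by
  rw [affineMap_linear_sub, coord_vertex p q.2, coord_vertex p p.2,
    if_neg (fun h => hq (Subtype.ext h.symm)), if_pos rfl]
  norm_num

theorem coord_add_ker {p q : s.1} (hq : q ≠ p) (z : LinearMap.ker (s.basis.coord p).linear) :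
    s.basis.coord p ((q : Space N) + z) = 0 := by
  have hz : (s.basis.coord p).linear (z : Space N) = 0 := z.2
  rw [affineMap_add, hz, coord_vertex p q.2, if_neg (fun h => hq (Subtype.ext h.symm)), zero_add]

theorem isometry_add_ker (p q : s.1) :
    Isometry (fun z : LinearMap.ker (s.basis.coord p).linear => (q : Space N) + z) :=
  (IsometryEquiv.addLeft (q : Space N)).isometry.comp isometry_subtype_coe

theorem isClosedEmbedding_add_ker (p q : s.1) : Topology.IsClosedEmbedding
    (fun z : LinearMap.ker (s.basis.coord p).linear => (q : Space N) + z) :=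
  (isometry_add_ker p q).isClosedEmbedding

/-- The surface measure on a facet, in coordinates of its hyperplane. -/
theorem facetMeasure_eq_map [DecidableEq (Space N)] (hN : 0 < N) {p q : s.1} (hq : q ≠ p) :
    facetMeasure (s.1.erase p) =
      Measure.map (fun z : LinearMap.ker (s.basis.coord p).linear => (q : Space N) + z)
        ((Measure.hausdorffMeasure ((N : ℝ) - 1)).restrict
          {z | (q : Space N) + z ∈ s.cell}) := by
  have hd : (0:ℝ) ≤ (N : ℝ) - 1 := by
    have : (1:ℝ) ≤ N := by exact_mod_cast hN
    linarith
  have hpre : {z : LinearMap.ker (s.basis.coord p).linear | (q : Space N) + z ∈ s.cell} =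
      (fun z : LinearMap.ker (s.basis.coord p).linear => (q : Space N) + z) ⁻¹'
        (convexHull ℝ (s.1.erase p : Set (Space N))) := by
    ext z
    rw [mem_preimage, mem_convexHull_erase_iff]
    exact (and_iff_left (coord_add_ker hq z)).symm
  rw [hpre, ← (isClosedEmbedding_add_ker p q).measurableEmbedding.restrict_map,
    (isometry_add_ker p q).map_hausdorffMeasure (Or.inl hd), Measure.restrict_restrict, facetMeasure]
  · congr 1
    refine (inter_eq_left.mpr ?_).symm
    intro x hx
    rw [mem_convexHull_erase_iff] at hx
    refine ⟨⟨x - q, ?_⟩, by simp⟩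
    rw [LinearMap.mem_ker, affineMap_linear_sub, hx.2, coord_vertex p q.2,
      if_neg (fun h => hq (Subtype.ext h.symm)), sub_zero]
  · exact ((Finset.finite_toSet _).isCompact_convexHull ℝ).measurableSet

theorem isCompact_preimage_cell (p q : s.1) :
    IsCompact {z : LinearMap.ker (s.basis.coord p).linear | (q : Space N) + z ∈ s.cell} :=
  (isClosedEmbedding_add_ker p q).isCompact_preimage s.isCompact_cell

theorem isAddHaarMeasure_facet {p q : s.1} (hq : q ≠ p) :
    (Measure.hausdorffMeasure ((N : ℝ) - 1) :
      Measure (LinearMap.ker (s.basis.coord p).linear)).IsAddHaarMeasure :=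
  isAddHaarMeasure_ker _ _ (coord_linear_sub_vertex hq)

theorem isFiniteMeasure_facetMeasure [DecidableEq (Space N)] (hN : 0 < N) (p : s.1) :
    IsFiniteMeasure (facetMeasure (s.1.erase p)) := by
  obtain ⟨q, hq⟩ := exists_ne_vertex hN p
  have := isAddHaarMeasure_facet hq
  rw [facetMeasure_eq_map hN hq]
  have : IsFiniteMeasure ((Measure.hausdorffMeasure ((N : ℝ) - 1) :
      Measure (LinearMap.ker (s.basis.coord p).linear)).restrict
          {z | (q : Space N) + z ∈ s.cell}) :=
    ⟨by rw [Measure.restrict_apply_univ]; exact (isCompact_preimage_cell p q).measure_lt_top⟩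
  infer_instance

theorem integrable_facetMeasure [DecidableEq (Space N)] {E : Type*} [NormedAddCommGroup E]
    (hN : 0 < N) (p : s.1) {w : Space N → E} (hw : Continuous w) :
    Integrable w (facetMeasure (s.1.erase p)) := by
  have hc : IsCompact (convexHull ℝ (s.1.erase p : Set (Space N))) :=
    (Finset.finite_toSet _).isCompact_convexHull ℝ
  have hf := isFiniteMeasure_facetMeasure hN p
  have : IntegrableOn w (convexHull ℝ (s.1.erase p : Set (Space N)))
      (facetMeasure (s.1.erase p)) := hw.continuousOn.integrableOn_compact hc
  rwa [IntegrableOn, facetMeasure, Measure.restrict_restrict hc.measurableSet, inter_self] at this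

/-- The radial form of the divergence theorem for a facet of a mesh element. -/
theorem exists_facet_formula [DecidableEq (Space N)] (hN : 0 < N) (p : s.1) :
    ∃ C : ℝ, 0 < C ∧ ∀ w : Space N → ℝ, ContDiff ℝ 1 w →
      ∫ x in interior s.cell, (N * w x + fderiv ℝ w x (x - p)) =
        C * ∫ x, w x ∂(facetMeasure (s.1.erase p)) := by
  obtain ⟨q, hq⟩ := exists_ne_vertex hN p
  obtain ⟨C, hC, h⟩ := TentPitching.exists_facet_formula s.basis hq
  refine ⟨C, hC, fun w hw => ?_⟩
  have h1 := h w hw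
  rw [← cell_eq] at h1
  rw [facetMeasure_eq_map hN hq,
    (isClosedEmbedding_add_ker p q).measurableEmbedding.integral_map]
  exact h1

/-- Within the hyperplane of the facet, the points of `facetNhd p` lie in the facet. So the facet
contains a nonempty relatively open set on which `w` is positive, and Haar measure charges it. -/
theorem integral_facetMeasure_pos [DecidableEq (Space N)] (hN : 0 < N) (p : s.1)
    {w : Space N → ℝ} (hw : Continuous w) (hw0 : ∀ x, 0 ≤ w x)
    (hpos : 0 < w (barycentre (s.1.erase p))) : 0 < ∫ x, w x ∂(facetMeasure (s.1.erase p)) := by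
  obtain ⟨q, hq⟩ := exists_ne_vertex hN p
  have hHaar := isAddHaarMeasure_facet hq
  rw [facetMeasure_eq_map hN hq,
    (isClosedEmbedding_add_ker p q).measurableEmbedding.integral_map]
  have hcomp := isCompact_preimage_cell p q
  have hcont : Continuous (fun z : LinearMap.ker (s.basis.coord p).linear =>
      w ((q : Space N) + z)) := hw.comp (isClosedEmbedding_add_ker p q).continuous
  rw [setIntegral_pos_iff_support_of_nonneg_ae (Eventually.of_forall fun z => hw0 _)
    (hcont.continuousOn.integrableOn_compact hcomp)]
  set O : Set (LinearMap.ker (s.basis.coord p).linear) :=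
    {z | (q : Space N) + z ∈ facetNhd p} ∩ {z | 0 < w ((q : Space N) + z)} with hO
  have hOo : IsOpen O := ((isOpen_facetNhd p).preimage
    (isClosedEmbedding_add_ker p q).continuous).inter (isOpen_lt continuous_const hcont)
  have hmem : barycentre (s.1.erase p) - q ∈ LinearMap.ker (s.basis.coord p).linear := by
    rw [LinearMap.mem_ker, affineMap_linear_sub, coord_barycentre_erase hN, if_pos rfl,
      coord_vertex p q.2, if_neg (fun h => hq (Subtype.ext h.symm)), sub_zero]
  have hOn : O.Nonempty := ⟨⟨_, hmem⟩, by
    simp only [hO, mem_inter_iff, mem_ofPred_eq, add_sub_cancel]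
    exact ⟨barycentre_mem_facetNhd hN p, hpos⟩⟩
  refine lt_of_lt_of_le (hOo.measure_pos _ hOn) (measure_mono ?_)
  rintro z ⟨hz1, hz2⟩
  refine ⟨ne_of_gt hz2, ?_⟩
  rw [mem_ofPred_eq, mem_cell]
  intro k
  by_cases hk : k = p
  · rw [hk, coord_add_ker hq]
  · exact (hz1 k hk).le

/-- A constant vector field on a simplex as a combination of the radial fields of its vertices. -/
theorem sum_coord_linear_smul (c x : Space N) :
    ∑ p : s.1, (s.basis.coord p).linear c • (x - (p : Space N)) = -c := by
  have h0 : ∑ p : s.1, (s.basis.coord p).linear c = 0 := by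
    have h1 := s.basis.sum_coord_apply_eq_one (0 + c)
    have h2 := s.basis.sum_coord_apply_eq_one 0
    simp_rw [affineMap_add, Finset.sum_add_distrib] at h1
    linarith
  have h3 : ∑ p : s.1, (s.basis.coord p).linear c • (p : Space N) = c := by
    have h1 := sum_coord_smul (s := s) (0 + c)
    have h2 := sum_coord_smul (s := s) 0
    simp_rw [affineMap_add, add_smul, Finset.sum_add_distrib] at h1
    rw [h2, zero_add, zero_add] at h1
    exact h1
  simp_rw [smul_sub, Finset.sum_sub_distrib, ← Finset.sum_smul, h0, h3, zero_smul, zero_sub]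

theorem sum_coord_linear (c : Space N) : ∑ p : s.1, (s.basis.coord p).linear c = 0 := by
  have h1 := s.basis.sum_coord_apply_eq_one (0 + c)
  have h2 := s.basis.sum_coord_apply_eq_one 0
  simp_rw [affineMap_add, Finset.sum_add_distrib] at h1
  linarith

end Element
end SpatialMesh

/-! ### The vertex patch of a tent -/

namespace Tent
open SpatialMesh
variable {N L : ℕ} {mesh : SpatialMesh N} (T : Tent mesh)

/-- The elements of the vertex patch. -/
def elements : Finset mesh.Element := by
  classical exact Finset.univ.filter fun s => T.v ∈ s.1

theorem mem_elements {s : mesh.Element} : s ∈ T.elements ↔ T.v ∈ s.1 := by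
  simp [elements]

theorem patch_eq : T.patch = ⋃ s ∈ T.elements, s.cell := by
  ext x
  simp only [patch, mem_iUnion, mem_elements]
  exact ⟨fun ⟨s, hs⟩ => ⟨s.1, s.2, hs⟩, fun ⟨s, h, hs⟩ => ⟨⟨s, h⟩, hs⟩⟩

theorem isCompact_patch : IsCompact T.patch := by
  rw [patch_eq]
  exact T.elements.isCompact_biUnion fun s _ => s.isCompact_cell

theorem cell_subset_patch {s : mesh.Element} (hs : T.v ∈ s.1) : s.cell ⊆ T.patch := by
  rw [patch_eq]
  exact subset_biUnion_of_mem (u := fun s : mesh.Element => s.cell) (T.mem_elements.mpr hs)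

theorem interior_cell_subset {s : mesh.Element} (hs : T.v ∈ s.1) :
    interior s.cell ⊆ interior T.patch := interior_mono (T.cell_subset_patch hs)

theorem patch_subset_space : T.patch ⊆ mesh.complex.space := by
  rw [patch_eq]
  exact iUnion₂_subset fun s _ => Element.cell_subset_space

theorem interior_patch_subset_domain : interior T.patch ⊆ mesh.domain :=
  interior_mono T.patch_subset_space

/-- The patch is, up to a null set, the union of the open elements. -/
theorem patch_ae_eq : T.patch =ᵐ[volume] (⋃ s ∈ T.elements, interior s.cell : Set (Space N)) := by
  rw [patch_eq]
  exact Filter.EventuallyEq.countable_bUnion T.elements.countable_toSet fun s _ => s.interior_ae_eq.symm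

/-- `H1` lives on the interior of the patch while the energies integrate over the closed patch; this
allows passing between the two. -/
theorem interior_patch_ae_eq : interior T.patch =ᵐ[volume] T.patch := by
  refine (interior_subset : interior T.patch ≤ T.patch).eventuallyLE.antisymm ?_
  have h : (⋃ s ∈ T.elements, interior s.cell : Set (Space N)) ≤ interior T.patch :=
    iUnion₂_subset fun s hs => T.interior_cell_subset (T.mem_elements.mp hs)
  exact T.patch_ae_eq.le.trans h.eventuallyLE

theorem pairwise_disjoint_interior {K : Set mesh.Element} :
    K.Pairwise (Function.onFun Disjoint fun s : mesh.Element => interior s.cell) := by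
  intro s _ t _ hst
  exact Set.disjoint_left.mpr fun x hs ht =>
    hst (Element.eq_of_mem_interior hs (interior_subset ht))

theorem setIntegral_patch {f : Space N → ℝ}
    (hf : ∀ s ∈ T.elements, IntegrableOn f (interior s.cell)) :
    ∫ x in T.patch, f x = ∑ s ∈ T.elements, ∫ x in interior s.cell, f x := by
  rw [setIntegral_congr_set T.patch_ae_eq]
  exact integral_biUnion_finset _ (fun s _ => isOpen_interior.measurableSet)
    pairwise_disjoint_interior hf

end Tent
-- The divergence theorem on one element
namespace SpatialMesh
variable {N : ℕ} {mesh : SpatialMesh N}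
namespace Element
variable {s t : mesh.Element}

/-- The facet of an element opposite to a vertex. -/
def facet (p : s.1) : Finset (Space N) := by classical exact s.1.erase p

theorem mem_facet {p : s.1} {x : Space N} : x ∈ facet p ↔ x ≠ p ∧ x ∈ s.1 := by
  simp [facet]

theorem facet_eq_erase [DecidableEq (Space N)] (p : s.1) : facet p = s.1.erase p := by
  ext x; simp [mem_facet]

/-- The constant of the facet formula. -/
def facetConst (hN : 0 < N) (p : s.1) : ℝ := by
  classical exact (exists_facet_formula hN p).choose

theorem facetConst_pos (hN : 0 < N) (p : s.1) : 0 < facetConst hN p := by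
  classical exact (exists_facet_formula hN p).choose_spec.1

theorem facet_formula (hN : 0 < N) (p : s.1) {w : Space N → ℝ} (hw : ContDiff ℝ 1 w) :
    ∫ x in interior s.cell, (N * w x + fderiv ℝ w x (x - p)) =
        facetConst hN p * ∫ x, w x ∂(facetMeasure (facet p)) := by
  classical exact (exists_facet_formula hN p).choose_spec.2 w hw

theorem integrableOn_interior {E : Type*} [NormedAddCommGroup E] {w : Space N → E}
    (hw : Continuous w) : IntegrableOn w (interior s.cell) :=
  (hw.continuousOn.integrableOn_compact s.isCompact_cell).mono_set interior_subset

theorem ae_facetMeasure (p : s.1) :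
    ∀ᵐ x ∂(facetMeasure (facet p)), x ∈ s.cell ∧ s.basis.coord p x = 0 := by
  classical
  have hc : IsCompact (convexHull ℝ (facet p : Set (Space N))) :=
    (Finset.finite_toSet _).isCompact_convexHull ℝ
  filter_upwards [ae_restrict_mem (μ := Measure.hausdorffMeasure ((N : ℝ) - 1)) hc.measurableSet]
    with x hx
  rw [facet_eq_erase, mem_convexHull_erase_iff] at hx
  exact hx

/-- The constant field `c` is a combination of the radial fields `x - p`, each of which sees only
the facet opposite `p`. The coefficients sum to zero, so the terms `N * w` from the divergences of
the radial fields cancel. -/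
theorem setIntegral_fderiv (hN : 0 < N) {w : Space N → ℝ} (hw : ContDiff ℝ 1 w) (c : Space N) :
    ∫ x in interior s.cell, fderiv ℝ w x c =
      ∑ p : s.1, -(s.basis.coord p).linear c *
        (facetConst hN p * ∫ x, w x ∂(facetMeasure (facet p))) := by
  have h1 : ∀ x, fderiv ℝ w x c = ∑ p : s.1, -(s.basis.coord p).linear c *
      (N * w x + fderiv ℝ w x (x - p)) := by
    intro x
    have h2 := congrArg (fderiv ℝ w x) (sum_coord_linear_smul (s := s) c x)
    rw [map_sum, map_neg] at h2
    simp_rw [map_smul, smul_eq_mul] at h2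
    simp_rw [mul_add, Finset.sum_add_distrib, ← Finset.sum_mul, Finset.sum_neg_distrib,
      sum_coord_linear, neg_mul, Finset.sum_neg_distrib, h2]
    ring
  have hint : ∀ p : s.1, IntegrableOn (fun x => N * w x + fderiv ℝ w x (x - p))
      (interior s.cell) := by
    intro p
    apply integrableOn_interior
    have := hw.continuous
    have := hw.continuous_fderiv (by norm_num)
    fun_prop
  simp_rw [h1]
  rw [integral_finsetSum _ fun p _ => (hint p).const_mul _]
  refine Finset.sum_congr rfl fun p _ => ?_
  rw [integral_const_mul, facet_formula hN p hw]

end Element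
end SpatialMesh

/-! ### Continuity of the normal flux matrix -/

namespace HyperbolicSystem
open SpatialMesh
variable {N L : ℕ} {mesh : SpatialMesh N} (sys : HyperbolicSystem mesh L)
variable {s t : mesh.Element}

/-- A positive multiple of the outward normal matrix on a facet. -/
def facetMatrix (p : s.1) : Matrix (Fin L) (Fin L) ℝ :=
  ∑ j, -(s.basis.coord p).linear (basisVec j) • sys.A j s

theorem facetMatrix_apply (p : s.1) (l m : Fin L) :
    sys.facetMatrix p l m = ∑ j, -(s.basis.coord p).linear (basisVec j) * sys.A j s l m := by
  simp [facetMatrix, Matrix.sum_apply]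

/-- The normal component of the fluxes is continuous across interior facets. -/
theorem facetMatrix_jump (hN : 0 < N) (hst : s ≠ t) {p : s.1} {q : t.1}
    (hf : Element.facet p = Element.facet q) :
    Element.facetConst hN p • sys.facetMatrix p + Element.facetConst hN q • sys.facetMatrix q =
      0 := by
  classical
  have hf' := hf
  rw [Element.facet_eq_erase, Element.facet_eq_erase] at hf'
  set c := barycentre (s.1.erase p) with hc
  set O := Element.facetNhd p ∩ Element.facetNhd q with hO
  have hOo : IsOpen O := (Element.isOpen_facetNhd p).inter (Element.isOpen_facetNhd q)
  have hcO : c ∈ O := ⟨Element.barycentre_mem_facetNhd hN p,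
    by rw [hc, hf']; exact Element.barycentre_mem_facetNhd hN q⟩
  have hOst : O ⊆ s.cell ∪ t.cell := Element.facetNhd_inter_subset hN hst hf'
  have hOd : O ⊆ mesh.domain := interior_maximal
    (hOst.trans (union_subset Element.cell_subset_space Element.cell_subset_space)) hOo
  -- The divergence condition is tested with a bump at the barycentre of the common facet, supported
  -- in `O`. Of all elements only `s` and `t` contribute, up to null sets, and of their facets only
  -- the common one.
  obtain ⟨R, hR, hRO⟩ := Metric.nhds_basis_closedBall.mem_iff.mp (hOo.mem_nhds hcO)
  let ψ : ContDiffBump c := ⟨R / 2, R, by positivity, by linarith⟩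
  have hψO : tsupport ψ ⊆ O := by rw [ψ.tsupport_eq]; exact hRO
  have hψ1 : ContDiff ℝ 1 ψ := ψ.contDiff
  have hψ0 : ∀ x, x ∉ O → ψ x = 0 := fun x hx => image_eq_zero_of_notMem_tsupport
    fun h => hx (hψO h)
  have hdψ0 : ∀ x, x ∉ O → fderiv ℝ ψ x = 0 := fun x hx => image_eq_zero_of_notMem_tsupport
    fun h => hx (hψO (tsupport_fderiv_subset ℝ h))
  set I := ∫ x, ψ x ∂(facetMeasure (Element.facet p)) with hI
  have hIpos : 0 < I := by
    have := Element.integral_facetMeasure_pos hN p ψ.continuous (fun _ => ψ.nonneg)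
      (by rw [← hc]; exact ψ.pos_of_mem_ball (Metric.mem_ball_self hR))
    rw [hI, Element.facet_eq_erase]; exact this
  -- only the common facet contributes
  have hside : ∀ (r : mesh.Element) (k : r.1), O ⊆ Element.facetNhd k → ∀ e : Space N,
      ∫ x in interior r.cell, fderiv ℝ ψ x e = -(r.basis.coord k).linear e *
        (Element.facetConst hN k * ∫ x, ψ x ∂(facetMeasure (Element.facet k))) := by
    intro r k hk e
    rw [Element.setIntegral_fderiv hN hψ1, Finset.sum_eq_single k]
    · intro i _ hik
      have : ∫ x, ψ x ∂(facetMeasure (Element.facet i)) = 0 := by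
        apply integral_eq_zero_of_ae
        filter_upwards [Element.ae_facetMeasure i] with x hx
        exact hψ0 x fun h => (hk h i hik).ne' hx.2
      rw [this]; simp
    · simp
  ext l m
  have hdiv := sys.div_free l m ψ ψ.contDiff ψ.hasCompactSupport (hψO.trans hOd)
  have hsplit : ∀ j, ∫ x in mesh.domain, mesh.field (sys.A j) x l m * fderiv ℝ ψ x (basisVec j) =
      sys.A j s l m * (∫ x in interior s.cell, fderiv ℝ ψ x (basisVec j)) +
      sys.A j t l m * (∫ x in interior t.cell, fderiv ℝ ψ x (basisVec j)) := by
    intro j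
    have hcontd : Continuous fun x => fderiv ℝ ψ x (basisVec j) :=
      (hψ1.continuous_fderiv (by norm_num)).clm_apply continuous_const
    have hon : ∀ r : mesh.Element, EqOn
        (fun x => mesh.field (sys.A j) x l m * fderiv ℝ ψ x (basisVec j))
        (fun x => sys.A j r l m * fderiv ℝ ψ x (basisVec j)) (interior r.cell) := by
      intro r x hx
      simp only [Element.field_eq (sys.A j) hx]
    have hint : ∀ r : mesh.Element, IntegrableOn
        (fun x => mesh.field (sys.A j) x l m * fderiv ℝ ψ x (basisVec j)) (interior r.cell) := by
      intro r
      rw [integrableOn_congr_fun (hon r) isOpen_interior.measurableSet]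
      exact (Element.integrableOn_interior hcontd).const_mul _
    have h1 : ∫ x in mesh.domain, mesh.field (sys.A j) x l m * fderiv ℝ ψ x (basisVec j) =
        ∫ x in interior s.cell ∪ interior t.cell,
          mesh.field (sys.A j) x l m * fderiv ℝ ψ x (basisVec j) := by
      refine setIntegral_eq_of_subset_of_ae_sdiff_eq_zero
        isOpen_interior.measurableSet.nullMeasurableSet
        (union_subset Element.interior_cell_subset_domain Element.interior_cell_subset_domain) ?_
      filter_upwards [s.interior_ae_eq.mem_iff, t.interior_ae_eq.mem_iff] with x hxs hxt hx
      rw [hdψ0 x]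
      · simp
      · intro hxO
        exact hx.2 ((hOst hxO).imp hxs.mpr hxt.mpr)
    rw [h1, setIntegral_union (Set.disjoint_left.mpr fun x hs ht =>
      hst (Element.eq_of_mem_interior hs (interior_subset ht))) isOpen_interior.measurableSet
      (hint s) (hint t), setIntegral_congr_fun isOpen_interior.measurableSet (hon s),
      setIntegral_congr_fun isOpen_interior.measurableSet (hon t), integral_const_mul,
      integral_const_mul]
  simp_rw [hsplit, hside s p inter_subset_left, hside t q inter_subset_right, ← hf, ← hI] at hdiv
  -- The condition reduces to the entry of the jump times the facet integral `I` of the bump, and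
  -- `I` is positive.
  have h2 : (Element.facetConst hN p * sys.facetMatrix p l m +
      Element.facetConst hN q * sys.facetMatrix q l m) * I = 0 := by
    rw [← hdiv, facetMatrix_apply, facetMatrix_apply, Finset.mul_sum, Finset.mul_sum,
      ← Finset.sum_add_distrib, Finset.sum_mul]
    exact Finset.sum_congr rfl fun j _ => by ring
  simpa using (mul_eq_zero.mp h2).resolve_right hIpos.ne'

end HyperbolicSystem

/-! ### Approximation of `H¹` functions by smooth functions -/

section Approximation
variable {N : ℕ} {F : Type*} [NormedAddCommGroup F]

theorem map_smul_add_volume (θ : ℝ) (hθ : θ ≠ 0) (c : Space N) :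
    Measure.map (fun x : Space N => θ • x + c) volume =
      ENNReal.ofReal |(θ ^ N)⁻¹| • (volume : Measure (Space N)) := by
  have h1 := Measure.map_addHaar_smul (volume : Measure (Space N)) hθ
  rw [finrank_euclideanSpace_fin] at h1
  have h2 : (fun x : Space N => θ • x + c) = (fun x => x + c) ∘ (fun x => θ • x) := rfl
  rw [h2, ← Measure.map_map (by fun_prop) (by fun_prop), h1, Measure.map_smul,
    map_add_right_eq_self]

theorem measurable_smul_add (θ : ℝ) (c : Space N) : Measurable (fun x : Space N => θ • x + c) := by
  have : Continuous (fun x : Space N => θ • x + c) := by fun_prop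
  exact this.measurable

theorem quasiMeasurePreserving_smul_add {θ : ℝ} (hθ : θ ≠ 0) (c : Space N) :
    Measure.QuasiMeasurePreserving (fun x : Space N => θ • x + c) volume volume :=
  ⟨measurable_smul_add θ c, by
    rw [map_smul_add_volume θ hθ c]
    exact Measure.smul_absolutelyContinuous⟩

/-- The dilation costs a factor `θ ^ (-N / 2)`; restricting to `θ ≥ 1 / 2` makes the bound uniform
as `θ` tends to 1. -/
theorem eLpNorm_comp_smul_add_le {g : Space N → F} (hg : AEStronglyMeasurable g volume)
    {θ : ℝ} (hθ : 1 / 2 ≤ θ) (c : Space N) :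
    eLpNorm (fun x => g (θ • x + c)) 2 volume ≤
      ENNReal.ofReal (2 ^ N) ^ (1 / 2 : ℝ≥0∞).toReal * eLpNorm g 2 volume := by
  have hθ0 : 0 < θ := by linarith
  have hmap := map_smul_add_volume θ hθ0.ne' c
  have hg' : AEStronglyMeasurable g (Measure.map (fun x : Space N => θ • x + c) volume) := by
    rw [hmap]; exact hg.smul_measure _
  have h1 := eLpNorm_map_measure (p := 2) hg' (measurable_smul_add θ c).aemeasurable
  rw [hmap, eLpNorm_smul_measure_of_ne_top (by norm_num)] at h1
  have h2 : (fun x => g (θ • x + c)) = g ∘ (fun x => θ • x + c) := rfl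
  rw [h2, ← h1, smul_eq_mul]
  gcongr
  rw [abs_of_pos (by positivity)]
  have : (1 / 2 : ℝ) ^ N ≤ θ ^ N := pow_le_pow_left₀ (by norm_num) hθ N
  calc (θ ^ N)⁻¹ ≤ ((1 / 2 : ℝ) ^ N)⁻¹ := by gcongr
    _ = 2 ^ N := by rw [← inv_pow]; norm_num

/-- Continuity in `L²` under contractions and translations. -/
theorem exists_eLpNorm_comp_sub_le [NormedSpace ℝ F] {w : Space N → F} (hw : MemLp w 2 volume) {S : Set (Space N)}
    (hS : volume S ≠ ⊤) {ε : ℝ≥0∞} (hε : ε ≠ 0) :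
    ∃ η : ℝ, 0 < η ∧ ∀ (θ : ℝ) (c : Space N), 1 / 2 ≤ θ → (∀ x ∈ S, ‖θ • x + c - x‖ ≤ η) →
      eLpNorm (fun x => w (θ • x + c) - w x) 2 (volume.restrict S) ≤ ε := by
  set K : ℝ≥0∞ := ENNReal.ofReal (2 ^ N) ^ (1 / 2 : ℝ≥0∞).toReal with hK
  have hKtop : K ≠ ⊤ := ENNReal.rpow_ne_top_of_nonneg (by simp) (by simp)
  -- choice of a continuous approximation
  obtain ⟨ε₁, hε₁, hKε⟩ : ∃ ε₁ : ℝ≥0∞, ε₁ ≠ 0 ∧ K * ε₁ + ε₁ ≤ ε / 2 := by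
    have h1 : Tendsto (fun e : ℝ≥0∞ => K * e + e) (𝓝 0) (𝓝 (K * 0 + 0)) :=
      (ENNReal.Tendsto.const_mul tendsto_id (Or.inr hKtop)).add tendsto_id
    rw [mul_zero, add_zero] at h1
    have h2 := h1.eventually (gt_mem_nhds (ENNReal.half_pos hε))
    obtain ⟨a, ha, hmem⟩ := ENNReal.nhds_zero_basis.mem_iff.mp h2
    obtain ⟨e, he0, hea⟩ := exists_between ha
    exact ⟨e, he0.ne', (hmem hea).le⟩
  obtain ⟨φ, hφc, hφ, hφcont, hφL⟩ := hw.exists_hasCompactSupport_eLpNorm_sub_le (by norm_num) hε₁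
  -- smallness of the modulus of continuity
  obtain ⟨δ, hδ, hSδ⟩ : ∃ δ : ℝ, 0 < δ ∧
      volume S ^ (2 : ℝ≥0∞).toReal⁻¹ * ENNReal.ofReal δ ≤ ε / 2 := by
    have hST : volume S ^ (2 : ℝ≥0∞).toReal⁻¹ ≠ ⊤ := ENNReal.rpow_ne_top_of_nonneg (by simp) hS
    have h1 : Tendsto (fun δ : ℝ => volume S ^ (2 : ℝ≥0∞).toReal⁻¹ * ENNReal.ofReal δ) (𝓝 0)
        (𝓝 (volume S ^ (2 : ℝ≥0∞).toReal⁻¹ * ENNReal.ofReal 0)) :=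
      ENNReal.Tendsto.const_mul (ENNReal.continuous_ofReal.tendsto 0) (Or.inr hST)
    rw [ENNReal.ofReal_zero, mul_zero] at h1
    have h2 := (h1.eventually (gt_mem_nhds (ENNReal.half_pos hε))).filter_mono
      (nhdsWithin_le_nhds (s := Ioi 0))
    obtain ⟨δ, h3, h4⟩ := (h2.and self_mem_nhdsWithin).exists
    exact ⟨δ, h4, h3.le⟩
  obtain ⟨η, hη, hmod⟩ := Metric.uniformContinuous_iff.mp
    (hφc.uniformContinuous_of_continuous hφcont) δ hδ
  refine ⟨η / 2, by positivity, fun θ c hθ hclose => ?_⟩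
  have hd : AEStronglyMeasurable (w - φ) volume := hw.1.sub hφL.1
  have hθ0 : θ ≠ 0 := by linarith
  have hd' : AEStronglyMeasurable (fun x => (w - φ) (θ • x + c)) volume :=
    hd.comp_quasiMeasurePreserving (quasiMeasurePreserving_smul_add hθ0 c)
  have hφ' : AEStronglyMeasurable (fun x => φ (θ • x + c)) volume :=
    (hφcont.comp (by fun_prop)).aestronglyMeasurable
  have hdecomp : (fun x => w (θ • x + c) - w x) =
      ((fun x => (w - φ) (θ • x + c)) - (w - φ)) + (fun x => φ (θ • x + c) - φ x) := by
    ext x; simp only [Pi.add_apply, Pi.sub_apply]; abel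
  have hsup : eLpNorm (fun x => φ (θ • x + c) - φ x) 2 (volume.restrict S) ≤ ε / 2 := by
    have hae : ∀ᵐ x ∂(volume.restrict S), ‖φ (θ • x + c) - φ x‖ ≤ δ := by
      have hcl : IsClosed {x : Space N | ‖θ • x + c - x‖ ≤ η / 2} :=
        isClosed_le (by fun_prop) continuous_const
      have hmem : ∀ᵐ x ∂(volume.restrict S), x ∈ {x : Space N | ‖θ • x + c - x‖ ≤ η / 2} :=
        ae_restrict_of_ae_restrict_of_subset hclose (ae_restrict_mem hcl.measurableSet)
      filter_upwards [hmem] with x hx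
      rw [← dist_eq_norm]
      refine (hmod ?_).le
      rw [dist_eq_norm]
      exact lt_of_le_of_lt hx (by linarith)
    refine (eLpNorm_le_of_ae_bound hae).trans ?_
    rwa [Measure.restrict_apply_univ]
  rw [hdecomp]
  calc _ ≤ eLpNorm ((fun x => (w - φ) (θ • x + c)) - (w - φ)) 2 (volume.restrict S) +
        eLpNorm (fun x => φ (θ • x + c) - φ x) 2 (volume.restrict S) :=
        eLpNorm_add_le (hd'.sub hd).restrict
          (hφ'.sub hφcont.aestronglyMeasurable).restrict (by norm_num)
    _ ≤ ε / 2 + ε / 2 := by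
        refine add_le_add ?_ hsup
        refine (eLpNorm_mono_measure _ Measure.restrict_le_self).trans ?_
        refine (eLpNorm_sub_le hd' hd (by norm_num)).trans ?_
        refine le_trans ?_ hKε
        exact add_le_add ((eLpNorm_comp_smul_add_le hd hθ c).trans (by gcongr)) hφ
    _ = ε := ENNReal.add_halves ε

end Approximation

/-! ### Mollification in L² -/

section Mollification
variable {N : ℕ} {F : Type*} [NormedAddCommGroup F] [NormedSpace ℝ F]

/-- The mollification of `w` by the normalised bump function `ρ`. -/
def mollify (ρ : ContDiffBump (0 : Space N)) (w : Space N → F) : Space N → F :=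
  convolution (ρ.normed volume) w (ContinuousLinearMap.lsmul ℝ ℝ) volume

theorem mollify_apply (ρ : ContDiffBump (0 : Space N)) (w : Space N → F) (z : Space N) :
    mollify ρ w z = ∫ y, ρ.normed volume y • w (z - y) := rfl

theorem lintegral_bump (ρ : ContDiffBump (0 : Space N)) :
    ∫⁻ y, ENNReal.ofReal (ρ.normed volume y) = 1 := by
  rw [← ofReal_integral_eq_lintegral_ofReal ρ.integrable_normed
    (Eventually.of_forall fun y => ρ.nonneg_normed y), ρ.integral_normed, ENNReal.ofReal_one]

theorem integrable_bump_smul (ρ : ContDiffBump (0 : Space N)) {w : Space N → F}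
    (hw : LocallyIntegrable w volume) (z : Space N) :
    Integrable (fun y => ρ.normed volume y • w (z - y)) volume :=
  ρ.hasCompactSupport_normed.convolutionExists_left (ContinuousLinearMap.lsmul ℝ ℝ)
    ρ.continuous_normed hw z

/-- Jensen's inequality: the normalised bump is a probability density, so the L¹ norm with respect
to it is at most the L² norm. -/
theorem enorm_mollify_sub_sq_le (ρ : ContDiffBump (0 : Space N)) {w : Space N → F}
    (hw : LocallyIntegrable w volume) [CompleteSpace F] (z : Space N) (a : F) :
    ‖mollify ρ w z - a‖ₑ ^ (2 : ℝ) ≤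
      ∫⁻ y, ‖w (z - y) - a‖ₑ ^ (2 : ℝ)
        ∂(volume.withDensity fun y => ENNReal.ofReal (ρ.normed volume y)) := by
  set ν : Measure (Space N) := volume.withDensity fun y => ENNReal.ofReal (ρ.normed volume y) with hν
  have hmeas : Measurable fun y => ENNReal.ofReal (ρ.normed volume y) :=
    ENNReal.measurable_ofReal.comp ρ.continuous_normed.measurable
  have hprob : IsProbabilityMeasure ν := ⟨by
    rw [hν, withDensity_apply _ MeasurableSet.univ, Measure.restrict_univ, lintegral_bump]⟩
  have h1 : mollify ρ w z - a = ∫ y, ρ.normed volume y • (w (z - y) - a) := by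
    simp_rw [smul_sub]
    rw [integral_sub (integrable_bump_smul ρ hw z) (ρ.integrable_normed.smul_const a),
      integral_smul_const, ρ.integral_normed, one_smul, mollify_apply]
  have hmw : AEStronglyMeasurable (fun y => w (z - y) - a) volume :=
    (hw.aestronglyMeasurable.comp_measurePreserving
      (Measure.measurePreserving_sub_left volume z)).sub aestronglyMeasurable_const
  have hmν : AEStronglyMeasurable (fun y => w (z - y) - a) ν :=
    hmw.mono_ac (withDensity_absolutelyContinuous _ _)
  have h2 : ‖mollify ρ w z - a‖ₑ ≤ eLpNorm (fun y => w (z - y) - a) 2 ν := by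
    refine le_trans ?_ (eLpNorm_le_eLpNorm_of_exponent_le (p := 1) (by norm_num) hmν)
    rw [eLpNorm_one_eq_lintegral_enorm, h1, hν,
      lintegral_withDensity_eq_lintegral_mul₀ hmeas.aemeasurable hmw.enorm]
    refine (enorm_integral_le_lintegral_enorm _).trans (le_of_eq ?_)
    refine lintegral_congr fun y => ?_
    rw [enorm_smul, Pi.mul_apply, Real.enorm_eq_ofReal (ρ.nonneg_normed y)]
  have h3 := eLpNorm_nnreal_pow_eq_lintegral (f := fun y => w (z - y) - a) (μ := ν)
    (p := 2) (by norm_num)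
  calc ‖mollify ρ w z - a‖ₑ ^ (2 : ℝ) ≤ (eLpNorm (fun y => w (z - y) - a) 2 ν) ^ (2 : ℝ) :=
        ENNReal.rpow_le_rpow h2 (by norm_num)
    _ = _ := by simpa using h3

/-- By Jensen and Tonelli the squared error is at most the average, over the shifts `y` in the
support of the bump, of the squared errors of the shifted functions. A bound uniform in these shifts
is therefore inherited. -/
theorem eLpNorm_mollify_comp_sub_le [CompleteSpace F] (ρ : ContDiffBump (0 : Space N))
    {w : Space N → F} (hw : MemLp w 2 volume) {S : Set (Space N)}
    {θ : ℝ} (c : Space N) {ε : ℝ≥0∞}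
    (h : ∀ y, ‖y‖ ≤ ρ.rOut →
      eLpNorm (fun x => w (θ • x + (c - y)) - w x) 2 (volume.restrict S) ≤ ε) :
    eLpNorm (fun x => mollify ρ w (θ • x + c) - w x) 2 (volume.restrict S) ≤ ε := by
  have hwl : LocallyIntegrable w volume := hw.locallyIntegrable (by norm_num)
  set ν : Measure (Space N) := volume.withDensity fun y => ENNReal.ofReal (ρ.normed volume y) with hν
  have hmeas : Measurable fun y => ENNReal.ofReal (ρ.normed volume y) :=
    ENNReal.measurable_ofReal.comp ρ.continuous_normed.measurable
  have hprob : IsProbabilityMeasure ν := ⟨by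
    rw [hν, withDensity_apply _ MeasurableSet.univ, Measure.restrict_univ, lintegral_bump]⟩
  have hac : ν ≪ volume := withDensity_absolutelyContinuous _ _
  have hsq : ∀ (f : Space N → F), eLpNorm f 2 (volume.restrict S) ^ (2 : ℝ) =
      ∫⁻ x in S, ‖f x‖ₑ ^ (2 : ℝ) := by
    intro f
    have := eLpNorm_nnreal_pow_eq_lintegral (f := f) (μ := volume.restrict S) (p := 2) (by norm_num)
    simpa using this
  rw [← ENNReal.rpow_le_rpow_iff (z := 2) (by norm_num), hsq]
  have hjoint : AEMeasurable (Function.uncurry fun (x y : Space N) =>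
      ‖w (θ • x + c - y) - w x‖ₑ ^ (2 : ℝ)) ((volume.restrict S).prod ν) := by
    have h1 : Measure.QuasiMeasurePreserving (fun q : Space N × Space N => θ • q.1 + c - q.2)
        ((volume.restrict S).prod ν) volume := by
      have h2 : Measure.QuasiMeasurePreserving (fun q : Space N × Space N => θ • q.1 + c - q.2)
          ((volume : Measure (Space N)).prod volume) volume := by
        have hm : Measurable (fun q : Space N × Space N => θ • q.1 + c - q.2) := by
          have : Continuous (fun q : Space N × Space N => θ • q.1 + c - q.2) := by fun_prop
          exact this.measurable
        have h3 := (MeasurePreserving.id (volume : Measure (Space N))).skew_product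
          (g := fun x y => θ • x + c - y) hm
          (Eventually.of_forall fun x =>
            (Measure.measurePreserving_sub_left (volume : Measure (Space N)) _).map_eq)
        exact Measure.quasiMeasurePreserving_snd.comp h3.quasiMeasurePreserving
      exact h2.mono_left (Measure.restrict_le_self.absolutelyContinuous.prod hac)
    have h4 : AEStronglyMeasurable (fun q : Space N × Space N => w (θ • q.1 + c - q.2))
        ((volume.restrict S).prod ν) := hw.1.comp_quasiMeasurePreserving h1
    have h5 : AEStronglyMeasurable (fun q : Space N × Space N => w q.1)
        ((volume.restrict S).prod ν) := hw.1.restrict.comp_fst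
    exact (h4.sub h5).enorm.pow_const _
  calc ∫⁻ x in S, ‖mollify ρ w (θ • x + c) - w x‖ₑ ^ (2 : ℝ)
      ≤ ∫⁻ x in S, ∫⁻ y, ‖w (θ • x + c - y) - w x‖ₑ ^ (2 : ℝ) ∂ν :=
        lintegral_mono fun x => enorm_mollify_sub_sq_le ρ hwl _ _
    _ = ∫⁻ y, (∫⁻ x in S, ‖w (θ • x + c - y) - w x‖ₑ ^ (2 : ℝ)) ∂ν := lintegral_lintegral_swap hjoint
    _ ≤ ∫⁻ _, ε ^ (2 : ℝ) ∂ν := by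
        apply lintegral_mono_ae
        rw [hν, ae_withDensity_iff hmeas]
        filter_upwards with y hy
        have hy1 : y ∈ Function.support (ρ.normed volume) := fun h0 => hy (by rw [h0]; simp)
        rw [ρ.support_normed_eq, mem_ball_zero_iff] at hy1
        have h2 := h y hy1.le
        rw [← ENNReal.rpow_le_rpow_iff (z := 2) (by norm_num), hsq] at h2
        refine le_trans (le_of_eq ?_) h2
        refine lintegral_congr fun x => ?_
        rw [add_sub_assoc]
    _ = ε ^ (2 : ℝ) := by simp

theorem contDiff_mollify [CompleteSpace F] (ρ : ContDiffBump (0 : Space N)) {w : Space N → F}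
    (hw : LocallyIntegrable w volume) : ContDiff ℝ ∞ (mollify ρ w) :=
  ρ.hasCompactSupport_normed.contDiff_convolution_left _ ρ.contDiff_normed hw

theorem fderiv_mollify_apply [CompleteSpace F] (ρ : ContDiffBump (0 : Space N)) {w : Space N → F}
    (hw : LocallyIntegrable w volume) (z e : Space N) :
    fderiv ℝ (mollify ρ w) z e = ∫ y, (fderiv ℝ (ρ.normed volume) y e) • w (z - y) := by
  have hd : ContDiff ℝ 1 (ρ.normed volume) := ρ.contDiff_normed
  have h1 := ρ.hasCompactSupport_normed.hasFDerivAt_convolution_left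
    (ContinuousLinearMap.lsmul ℝ ℝ) hd hw z
  rw [mollify, h1.fderiv, convolution, ContinuousLinearMap.integral_apply]
  · rfl
  · exact (ρ.hasCompactSupport_normed.fderiv ℝ).convolutionExists_left _
      (hd.continuous_fderiv (by norm_num)) hw z

end Mollification

section H1
variable {N L : ℕ} {U : Set (Space N)}

/-- Mollification commutes with weak derivatives away from the boundary. -/
theorem fderiv_mollify_weakPartial (hU : IsOpen U) (z : H1 U L) (ρ : ContDiffBump (0 : Space N))
    (hw : LocallyIntegrable (U.indicator (H1.func z)) volume) (j : Fin N) {x : Space N}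
    (hx : Metric.closedBall x ρ.rOut ⊆ U) :
    fderiv ℝ (mollify ρ (U.indicator (H1.func z))) x (basisVec j) =
      mollify ρ (U.indicator (H1.weakPartial j z)) x := by
  rw [fderiv_mollify_apply ρ hw, mollify_apply]
  -- The reflected and translated bump is an admissible test function because its support lies in
  -- the closed ball around `x`, which is contained in `U`.
  set ψ : Space N → ℝ := fun y => ρ.normed volume (x - y) with hψ
  have hψs : ContDiff ℝ ∞ ψ := ρ.contDiff_normed.comp (contDiff_const.sub contDiff_id)
  have hψc : HasCompactSupport ψ :=
    ρ.hasCompactSupport_normed.comp_homeomorph (Homeomorph.subLeft x)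
  have hψt : tsupport ψ ⊆ U := by
    refine Subset.trans ?_ hx
    refine closure_minimal ?_ Metric.isClosed_closedBall
    intro y hy
    have hy1 : x - y ∈ Function.support (ρ.normed volume) := hy
    rw [ρ.support_normed_eq, mem_ball_zero_iff, ← dist_eq_norm, dist_comm] at hy1
    exact hy1.le
  have hψd : ∀ y e, fderiv ℝ ψ y e = -fderiv ℝ (ρ.normed volume) (x - y) e := by
    intro y e
    have h1 : HasFDerivAt (ρ.normed volume) (fderiv ℝ (ρ.normed volume) (x - y)) (x - y) :=
      ((ρ.contDiff_normed (n := 1)).differentiable (by norm_num) _).hasFDerivAt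
    have h2 : HasFDerivAt (fun y => x - y) (-ContinuousLinearMap.id ℝ (Space N)) y := by
      simpa using (hasFDerivAt_id y).const_sub x
    have h3 := (h1.comp y h2).fderiv
    have h4 : ψ = ρ.normed volume ∘ fun y => x - y := rfl
    rw [h4, h3]; simp
  have hweak := z.2 j ψ hψs hψc hψt
  have e1 : ∫ y, (fderiv ℝ (ρ.normed volume) y (basisVec j)) • U.indicator (H1.func z) (x - y) =
      -∫ y in U, (fderiv ℝ ψ y (basisVec j)) • H1.func z y := by
    rw [← integral_sub_left_eq_self _ volume x, ← integral_indicator hU.measurableSet,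
      ← integral_neg]
    refine integral_congr_ae (Eventually.of_forall fun y => ?_)
    simp only [sub_sub_cancel]
    by_cases hy : y ∈ U
    · simp [indicator_of_mem hy, hψd]
    · simp [indicator_of_notMem hy]
  have e2 : ∫ y, ρ.normed volume y • U.indicator (H1.weakPartial j z) (x - y) =
      ∫ y in U, ψ y • H1.weakPartial j z y := by
    rw [← integral_sub_left_eq_self _ volume x, ← integral_indicator hU.measurableSet]
    refine integral_congr_ae (Eventually.of_forall fun y => ?_)
    simp only [sub_sub_cancel]
    by_cases hy : y ∈ U
    · simp [indicator_of_mem hy, hψ]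
    · simp [indicator_of_notMem hy]
  rw [e1, e2]
  exact neg_eq_iff_eq_neg.mpr hweak

end H1

section H1
variable {N L : ℕ} {U : Set (Space N)}

/-- The smooth functions `W k` converge to `z` in `H¹(S)^L`. -/
def SmoothApprox (z : H1 U L) (S : Set (Space N)) (W : ℕ → Space N → State L) : Prop :=
  (∀ k, ContDiff ℝ ∞ (W k)) ∧
    Tendsto (fun k => eLpNorm (fun x => W k x - H1.func z x) 2 (volume.restrict S)) atTop (𝓝 0) ∧
    ∀ j, Tendsto (fun k => eLpNorm (fun x => fderiv ℝ (W k) x (basisVec j) - H1.weakPartial j z x) 2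
      (volume.restrict S)) atTop (𝓝 0)

theorem SmoothApprox.mono {z : H1 U L} {S S' : Set (Space N)} {W : ℕ → Space N → State L}
    (h : SmoothApprox z S W) (hS : S' ⊆ S) : SmoothApprox z S' W := by
  refine ⟨h.1, ?_, fun j => ?_⟩
  · exact tendsto_of_tendsto_of_tendsto_of_le_of_le tendsto_const_nhds h.2.1 (fun _ => zero_le)
      fun k => eLpNorm_mono_measure _ (Measure.restrict_mono hS le_rfl)
  · exact tendsto_of_tendsto_of_tendsto_of_le_of_le tendsto_const_nhds (h.2.2 j)
      (fun _ => zero_le) fun k => eLpNorm_mono_measure _ (Measure.restrict_mono hS le_rfl)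

/-- The approximation is the mollification evaluated at the contracted point `o + θ • (x - o)`. The
contraction moves `S` into a compact part of `U`, so for a small radius only values inside `U` are
averaged and mollification commutes with the weak derivative, although `S` may reach the boundary of
`U`. -/
theorem exists_smooth_close (hU : IsOpen U) (z : H1 U L) {S : Set (Space N)}
    (hSm : MeasurableSet S) (hSU : S ⊆ U) (hSv : volume S ≠ ⊤) (o : Space N) {D : ℝ}
    (hD : ∀ x ∈ S, ‖x - o‖ ≤ D)
    (hK : ∀ θ ∈ Ioo (0 : ℝ) 1, ∃ K, IsCompact K ∧ K ⊆ U ∧ ∀ x ∈ S, o + θ • (x - o) ∈ K)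
    {ε : ℝ≥0∞} (hε : ε ≠ 0) :
    ∃ W : Space N → State L, ContDiff ℝ ∞ W ∧
      eLpNorm (fun x => W x - H1.func z x) 2 (volume.restrict S) ≤ ε ∧
      ∀ j, eLpNorm (fun x => fderiv ℝ W x (basisVec j) - H1.weakPartial j z x) 2
        (volume.restrict S) ≤ ε + ε := by
  set f : Option (Fin N) → Space N → State L := fun i => U.indicator (z.1 i) with hf
  have hfL : ∀ i, MemLp (f i) 2 volume := fun i =>
    (memLp_indicator_iff_restrict hU.measurableSet).mpr (Lp.memLp _)
  have hfl : ∀ i, LocallyIntegrable (f i) volume := fun i =>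
    (hfL i).locallyIntegrable (by norm_num)
  choose η hη hηf using fun i => exists_eLpNorm_comp_sub_le (hfL i) hSv hε
  obtain ⟨i₀, hi₀⟩ := Finite.exists_min η
  set G : ℝ≥0∞ := ∑ i, eLpNorm (f i) 2 volume with hG
  have hGtop : G ≠ ⊤ := ENNReal.sum_ne_top.mpr fun i _ => (hfL i).2.ne
  -- the contraction factor
  obtain ⟨θ, hθ12, hθ1, hθD, hθG⟩ : ∃ θ : ℝ, 1 / 2 ≤ θ ∧ θ < 1 ∧ (1 - θ) * D ≤ η i₀ / 2 ∧
      ENNReal.ofReal (1 - θ) * G ≤ ε := by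
    have h1 : ∀ᶠ θ : ℝ in 𝓝[<] 1, (1 - θ) * D < η i₀ / 2 := by
      have : Tendsto (fun θ : ℝ => (1 - θ) * D) (𝓝[<] 1) (𝓝 ((1 - 1) * D)) :=
        ((by fun_prop : Continuous fun θ : ℝ => (1 - θ) * D).tendsto 1).mono_left
          nhdsWithin_le_nhds
      rw [sub_self, zero_mul] at this
      exact this.eventually (gt_mem_nhds (half_pos (hη i₀)))
    have h2 : ∀ᶠ θ : ℝ in 𝓝[<] 1, ENNReal.ofReal (1 - θ) * G < ε := by
      have h3 : Tendsto (fun θ : ℝ => ENNReal.ofReal (1 - θ)) (𝓝[<] 1)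
          (𝓝 (ENNReal.ofReal (1 - 1))) :=
        -- The second condition on `θ` pays for the chain rule: differentiating the contracted
        -- function gives `θ` times the mollified derivative, and the defect `1 - θ` multiplies the
        -- L² norms collected in `G`.
        (ENNReal.continuous_ofReal.comp
          (by fun_prop : Continuous fun θ : ℝ => 1 - θ) |>.tendsto 1).mono_left nhdsWithin_le_nhds
      have h4 := ENNReal.Tendsto.mul_const h3 (b := G) (Or.inr hGtop)
      rw [sub_self, ENNReal.ofReal_zero, zero_mul] at h4
      exact h4.eventually (gt_mem_nhds (pos_iff_ne_zero.mpr hε))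
    have h5 : ∀ᶠ θ : ℝ in 𝓝[<] 1, θ ∈ Ico (1 / 2 : ℝ) 1 := Ico_mem_nhdsLT (by norm_num)
    obtain ⟨θ, ⟨ha, hb⟩, hc⟩ := ((h1.and h2).and h5).exists
    exact ⟨θ, hc.1, hc.2, ha.le, hb.le⟩
  have hθ0 : 0 < θ := by linarith
  obtain ⟨K, hKc, hKU, hKS⟩ := hK θ ⟨hθ0, hθ1⟩
  obtain ⟨δ, hδ, hδU⟩ := hKc.exists_cthickening_subset_open hU hKU
  set r := min (η i₀ / 2) δ with hr
  have hr0 : 0 < r := lt_min (half_pos (hη i₀)) hδ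
  let ρ : ContDiffBump (0 : Space N) := ⟨r / 2, r, by positivity, by linarith⟩
  have hρr : ρ.rOut = r := rfl
  set c := o - θ • o with hc
  have hco : ∀ x, θ • x + c = o + θ • (x - o) := fun x => by rw [hc]; module
  have hmoll : ∀ i, eLpNorm (fun x => mollify ρ (f i) (θ • x + c) - f i x) 2
      (volume.restrict S) ≤ ε := by
    intro i
    refine eLpNorm_mollify_comp_sub_le ρ (hfL i) c fun y hy => ?_
    refine hηf i θ (c - y) hθ12 fun x hx => ?_
    have h1 : θ • x + (c - y) - x = -((1 - θ) • (x - o)) - y := by rw [hc]; module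
    rw [h1]
    calc ‖-((1 - θ) • (x - o)) - y‖ ≤ ‖-((1 - θ) • (x - o))‖ + ‖y‖ := norm_sub_le _ _
      _ ≤ η i₀ / 2 + η i₀ / 2 := by
          refine add_le_add ?_ ((hy.trans_eq hρr).trans (min_le_left _ _))
          rw [norm_neg, norm_smul, Real.norm_of_nonneg (by linarith)]
          exact (mul_le_mul_of_nonneg_left (hD x hx) (by linarith)).trans hθD
      _ = η i₀ := by ring
      _ ≤ η i := hi₀ i
  have hfU : ∀ i, ∀ x ∈ S, f i x = z.1 i x := fun i x hx => indicator_of_mem (hSU hx) _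
  have hball : ∀ x ∈ S, Metric.closedBall (θ • x + c) ρ.rOut ⊆ U := by
    intro x hx
    refine Subset.trans ?_ hδU
    rw [hco, hρr]
    exact (Metric.closedBall_subset_closedBall (min_le_right _ _)).trans
      (Metric.closedBall_subset_cthickening (hKS x hx) δ)
  have hsm : ContDiff ℝ ∞ (mollify ρ (f none)) := contDiff_mollify ρ (hfl none)
  refine ⟨fun x => mollify ρ (f none) (θ • x + c), hsm.comp (by fun_prop), ?_, fun j => ?_⟩
  · refine (eLpNorm_congr_ae ?_).trans_le (hmoll none)
    filter_upwards [ae_restrict_mem hSm] with x hx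
    rw [hfU none x hx]; rfl
  · have hder : ∀ x ∈ S, fderiv ℝ (fun x => mollify ρ (f none) (θ • x + c)) x (basisVec j) =
        θ • mollify ρ (f (some j)) (θ • x + c) := by
      intro x hx
      have h1 : HasFDerivAt (fun x : Space N => θ • x + c)
          (θ • ContinuousLinearMap.id ℝ (Space N)) x :=
        ((hasFDerivAt_id x).const_smul θ).add_const c
      have h2 := ((hsm.differentiable (by simp)) (θ • x + c)).hasFDerivAt
      have h3 := (h2.comp x h1).fderiv
      have h4 : (fun x => mollify ρ (f none) (θ • x + c)) =
        mollify ρ (f none) ∘ fun x => θ • x + c := rfl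
      rw [h4, h3]
      have h5 := fderiv_mollify_weakPartial hU z ρ (hfl none) j (hball x hx)
      simp only [ContinuousLinearMap.comp_smul, ContinuousLinearMap.comp_id,
        smul_apply]
      exact congrArg (fun y => θ • y) h5
    have hcongr : (fun x => fderiv ℝ (fun x => mollify ρ (f none) (θ • x + c)) x (basisVec j) -
        H1.weakPartial j z x) =ᵐ[volume.restrict S]
        -- The derivative error splits into `θ` times the mollification error and the defect `-(1 -
        -- θ)` of the contraction; each is at most `ε`.
        (θ • fun x => mollify ρ (f (some j)) (θ • x + c) - f (some j) x) +
          (-(1 - θ)) • f (some j) := by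
      filter_upwards [ae_restrict_mem hSm] with x hx
      rw [hder x hx]
      have : H1.weakPartial j z x = f (some j) x := (hfU (some j) x hx).symm
      rw [this]
      simp only [Pi.add_apply, Pi.smul_apply]
      module
    rw [eLpNorm_congr_ae hcongr]
    have hm1 : AEStronglyMeasurable
        (fun x => mollify ρ (f (some j)) (θ • x + c) - f (some j) x) volume :=
      (((contDiff_mollify ρ (hfl (some j))).continuous.comp
        (by fun_prop)).aestronglyMeasurable).sub (hfL _).1
    refine (eLpNorm_add_le (hm1.const_smul θ).restrict ((hfL _).1.const_smul _).restrict
      (by norm_num)).trans (add_le_add ?_ ?_)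
    · rw [eLpNorm_const_smul]
      refine le_trans ?_ (hmoll (some j))
      refine mul_le_of_le_one_left' ?_
      rw [Real.enorm_eq_ofReal hθ0.le]
      exact ENNReal.ofReal_le_one.mpr hθ1.le
    · rw [eLpNorm_const_smul, enorm_neg, Real.enorm_eq_ofReal (by linarith)]
      refine le_trans ?_ hθG
      gcongr
      refine (eLpNorm_mono_measure _ Measure.restrict_le_self).trans ?_
      exact Finset.single_le_sum (f := fun i => eLpNorm (f i) 2 volume) (fun _ _ => zero_le)
        (Finset.mem_univ (some j))

/-- Density of smooth functions in `H¹`, on a set that can be contracted into the domain. -/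
theorem exists_smoothApprox (hU : IsOpen U) (z : H1 U L) {S : Set (Space N)}
    (hSm : MeasurableSet S) (hSU : S ⊆ U) (hSv : volume S ≠ ⊤) (o : Space N) {D : ℝ}
    (hD : ∀ x ∈ S, ‖x - o‖ ≤ D)
    (hK : ∀ θ ∈ Ioo (0 : ℝ) 1, ∃ K, IsCompact K ∧ K ⊆ U ∧ ∀ x ∈ S, o + θ • (x - o) ∈ K) :
    ∃ W, SmoothApprox z S W := by
  have hpos : ∀ n : ℕ, ((n : ℝ≥0∞) + 1)⁻¹ ≠ 0 := fun n => by simp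
  choose W hW h1 h2 using fun n : ℕ => exists_smooth_close hU z hSm hSU hSv o hD hK (hpos n)
  have hlim : Tendsto (fun n : ℕ => ((n : ℝ≥0∞) + 1)⁻¹) atTop (𝓝 0) := by
    have := (tendsto_add_atTop_iff_nat 1).mpr ENNReal.tendsto_inv_nat_nhds_zero
    simpa using this
  refine ⟨W, hW, ?_, fun j => ?_⟩
  · exact tendsto_of_tendsto_of_tendsto_of_le_of_le tendsto_const_nhds hlim (fun _ => zero_le) h1
  · have := hlim.add hlim
    rw [add_zero] at this
    exact tendsto_of_tendsto_of_tendsto_of_le_of_le tendsto_const_nhds this (fun _ => zero_le)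
      fun n => h2 n j

end H1

/-! ### Quadratic expressions in `L²` -/

/-- The bilinear form of a matrix. -/
def matForm {L : ℕ} (A : Matrix (Fin L) (Fin L) ℝ) : State L →L[ℝ] State L →L[ℝ] ℝ :=
  (innerSL ℝ).comp (Matrix.toEuclideanCLM (𝕜 := ℝ) A)

theorem matForm_apply {L : ℕ} (A : Matrix (Fin L) (Fin L) ℝ) (x y : State L) :
    matForm A x y = (A *ᵥ x.ofLp) ⬝ᵥ y.ofLp := by
  simp only [matForm, ContinuousLinearMap.comp_apply, innerSL_apply_apply]
  rw [EuclideanSpace.inner_eq_star_dotProduct, dotProduct_comm]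
  simp [Matrix.ofLp_toEuclideanCLM]

theorem matForm_comm {L : ℕ} {A : Matrix (Fin L) (Fin L) ℝ} (hA : A.IsSymm) (x y : State L) :
    matForm A x y = matForm A y x := by
  rw [matForm_apply, matForm_apply, dotProduct_comm, Matrix.dotProduct_mulVec,
    ← Matrix.mulVec_transpose, hA.eq]

theorem matForm_add {L : ℕ} (A B : Matrix (Fin L) (Fin L) ℝ) :
    matForm (A + B) = matForm A + matForm B := by
  ext x y; simp [matForm_apply, Matrix.add_mulVec, add_dotProduct]

theorem matForm_smul {L : ℕ} (c : ℝ) (A : Matrix (Fin L) (Fin L) ℝ) :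
    matForm (c • A) = c • matForm A := by
  ext x y; simp [matForm_apply, Matrix.smul_mulVec, smul_dotProduct]

theorem matForm_zero {L : ℕ} : matForm (0 : Matrix (Fin L) (Fin L) ℝ) = 0 := by
  ext x y; simp [matForm_apply]

theorem matForm_sum {L : ℕ} {ι : Type*} (f : Finset ι) (A : ι → Matrix (Fin L) (Fin L) ℝ) :
    matForm (∑ i ∈ f, A i) = ∑ i ∈ f, matForm (A i) := by
  classical
  induction f using Finset.induction_on with
  | empty => simp [matForm_zero]
  | insert i f hi ih => rw [Finset.sum_insert hi, matForm_add, ih, Finset.sum_insert hi]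

section Bilinear
variable {α : Type*} [MeasurableSpace α] {μ : Measure α} {E : Type*} [NormedAddCommGroup E]
  [NormedSpace ℝ E] (B : E →L[ℝ] E →L[ℝ] ℝ) {κ : α → ℝ} {C : ℝ}

theorem aestronglyMeasurable_bilin (hκm : AEStronglyMeasurable κ μ) {u v : α → E}
    (hu : AEStronglyMeasurable u μ) (hv : AEStronglyMeasurable v μ) :
    AEStronglyMeasurable (fun x => κ x * B (u x) (v x)) μ :=
  hκm.mul (B.aestronglyMeasurable_comp₂ hu hv)

theorem eLpNorm_bilin_le (hκ : ∀ᵐ x ∂μ, ‖κ x‖ ≤ C) {u v : α → E}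
    (hu : AEStronglyMeasurable u μ) (hv : AEStronglyMeasurable v μ) :
    eLpNorm (fun x => κ x * B (u x) (v x)) 1 μ ≤
      ENNReal.ofReal C * (‖B‖₊ * eLpNorm u 2 μ * eLpNorm v 2 μ) := by
  have h1 : eLpNorm (fun x => κ x * B (u x) (v x)) 1 μ ≤
      ENNReal.ofReal C * eLpNorm (fun x => B (u x) (v x)) 1 μ := by
    apply eLpNorm_le_mul_eLpNorm_of_ae_le_mul
    filter_upwards [hκ] with x hx
    rw [norm_mul]
    exact mul_le_mul_of_nonneg_right hx (norm_nonneg _)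
  refine h1.trans ?_
  gcongr
  refine eLpNorm_le_eLpNorm_mul_eLpNorm_of_nnnorm hu hv (fun x y => B x y) ‖B‖₊
    (Eventually.of_forall fun x => ?_)
  exact_mod_cast B.le_opNorm₂ (u x) (v x)

theorem integrable_bilin (hκm : AEStronglyMeasurable κ μ) (hκ : ∀ᵐ x ∂μ, ‖κ x‖ ≤ C) {u v : α → E}
    (hu : MemLp u 2 μ) (hv : MemLp v 2 μ) : Integrable (fun x => κ x * B (u x) (v x)) μ := by
  rw [← memLp_one_iff_integrable]
  refine ⟨aestronglyMeasurable_bilin B hκm hu.1 hv.1, (eLpNorm_bilin_le B hκ hu.1 hv.1).trans_lt ?_⟩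
  exact ENNReal.mul_lt_top ENNReal.ofReal_lt_top
    (ENNReal.mul_lt_top (ENNReal.mul_lt_top (by simp) hu.2) hv.2)

/-- Convergence of quadratic expressions under `L²` convergence. -/
theorem tendsto_integral_bilin (hκm : AEStronglyMeasurable κ μ) (hκ : ∀ᵐ x ∂μ, ‖κ x‖ ≤ C)
    {u v : α → E} {un vn : ℕ → α → E} (hu : MemLp u 2 μ) (hv : MemLp v 2 μ)
    (hun : ∀ n, MemLp (un n) 2 μ) (hvn : ∀ n, MemLp (vn n) 2 μ)
    (hu' : Tendsto (fun n => eLpNorm (fun x => un n x - u x) 2 μ) atTop (𝓝 0))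
    (hv' : Tendsto (fun n => eLpNorm (fun x => vn n x - v x) 2 μ) atTop (𝓝 0)) :
    Tendsto (fun n => ∫ x, κ x * B (un n x) (vn n x) ∂μ) atTop
      (𝓝 (∫ x, κ x * B (u x) (v x) ∂μ)) := by
  refine tendsto_integral_of_L1' _ (integrable_bilin B hκm hκ hu hv).1
    (Eventually.of_forall fun n => integrable_bilin B hκm hκ (hun n) (hvn n)) ?_
  have hbound : ∀ n, eLpNorm ((fun x => κ x * B (un n x) (vn n x)) - fun x => κ x * B (u x) (v x))
      1 μ ≤ ENNReal.ofReal C * (‖B‖₊ * eLpNorm (fun x => un n x - u x) 2 μ *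
        (eLpNorm (fun x => vn n x - v x) 2 μ + eLpNorm v 2 μ)) +
        ENNReal.ofReal C * (‖B‖₊ * eLpNorm u 2 μ * eLpNorm (fun x => vn n x - v x) 2 μ) := by
    intro n
    have hdu : AEStronglyMeasurable (fun x => un n x - u x) μ := (hun n).1.sub hu.1
    have hdv : AEStronglyMeasurable (fun x => vn n x - v x) μ := (hvn n).1.sub hv.1
    have hdecomp : ((fun x => κ x * B (un n x) (vn n x)) - fun x => κ x * B (u x) (v x)) =
        (fun x => κ x * B (un n x - u x) (vn n x)) + fun x => κ x * B (u x) (vn n x - v x) := by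
      ext x
      simp only [Pi.sub_apply, Pi.add_apply, map_sub, sub_apply]
      ring
    rw [hdecomp]
    refine (eLpNorm_add_le (aestronglyMeasurable_bilin B hκm hdu (hvn n).1)
      (aestronglyMeasurable_bilin B hκm hu.1 hdv) le_rfl).trans
      (add_le_add ((eLpNorm_bilin_le B hκ hdu (hvn n).1).trans ?_)
        (eLpNorm_bilin_le B hκ hu.1 hdv))
    gcongr
    have : vn n = (fun x => vn n x - v x) + v := by ext x; simp
    calc eLpNorm (vn n) 2 μ = eLpNorm ((fun x => vn n x - v x) + v) 2 μ := by rw [← this]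
      _ ≤ _ := eLpNorm_add_le hdv hv.1 (by norm_num)
  have hlim : Tendsto (fun n => ENNReal.ofReal C * (‖B‖₊ * eLpNorm (fun x => un n x - u x) 2 μ *
        (eLpNorm (fun x => vn n x - v x) 2 μ + eLpNorm v 2 μ)) +
        ENNReal.ofReal C * (‖B‖₊ * eLpNorm u 2 μ * eLpNorm (fun x => vn n x - v x) 2 μ))
      atTop (𝓝 (ENNReal.ofReal C * (‖B‖₊ * 0 * (0 + eLpNorm v 2 μ)) +
        ENNReal.ofReal C * (‖B‖₊ * eLpNorm u 2 μ * 0))) := by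
    refine Tendsto.add (ENNReal.Tendsto.const_mul ?_ (Or.inr ENNReal.ofReal_ne_top))
      (ENNReal.Tendsto.const_mul ?_ (Or.inr ENNReal.ofReal_ne_top))
    · refine ENNReal.Tendsto.mul (ENNReal.Tendsto.const_mul hu' (Or.inr (by simp))) (Or.inr ?_)
        (hv'.add tendsto_const_nhds) (Or.inr (by simp))
      simpa using hv.2.ne
    · exact ENNReal.Tendsto.const_mul hv' (Or.inr (ENNReal.mul_ne_top (by simp) hu.2.ne))
  simp only [mul_zero, zero_mul, add_zero] at hlim
  exact tendsto_of_tendsto_of_tendsto_of_le_of_le tendsto_const_nhds hlim (fun _ => zero_le) hbound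

end Bilinear

theorem memLp_of_continuous_of_isCompact {X : Type*} [TopologicalSpace X] [MeasurableSpace X]
    [OpensMeasurableSpace X] {E : Type*} [NormedAddCommGroup E] [SecondCountableTopologyEither X E]
    {μ : Measure X} [IsFiniteMeasure μ] {K : Set X} (hK : IsCompact K) (hμ : ∀ᵐ x ∂μ, x ∈ K)
    {w : X → E} (hw : Continuous w) (p : ℝ≥0∞) : MemLp w p μ := by
  obtain ⟨C, hC⟩ := hK.exists_bound_of_continuousOn hw.continuousOn
  exact MemLp.of_bound hw.aestronglyMeasurable C (hμ.mono fun x hx => hC x hx)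

open SpatialMesh
-- Facet fluxes of H¹ functions without traces
section FacetFlux
variable {N L : ℕ} {mesh : SpatialMesh N} {U : Set (Space N)} {s t : mesh.Element}

/-- The radial flux `∫ div ((x - p) q)` with `q = a (A w) · w` over an element, for the value `w`
and the partial derivatives `d` of a function. -/
def radialFlux (p : s.1) (a : Space N →ᵃ[ℝ] ℝ) (A : Matrix (Fin L) (Fin L) ℝ)
    (w : Space N → State L) (d : Fin N → Space N → State L) : ℝ :=
  (∫ x in interior s.cell, (N * a x + a.linear (x - (p : Space N))) * matForm A (w x) (w x)) +
    ∑ k, ∫ x in interior s.cell, (2 * a x * (x - (p : Space N)) k) * matForm A (w x) (d k x)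

theorem continuous_linear (a : Space N →ᵃ[ℝ] ℝ) : Continuous a.linear :=
  a.linear.continuous_of_finiteDimensional

instance isFiniteMeasure_interior_cell :
    IsFiniteMeasure ((volume : Measure (Space N)).restrict (interior s.cell)) :=
  ⟨by
    rw [Measure.restrict_apply_univ]
    exact (measure_mono interior_subset).trans_lt s.isCompact_cell.measure_lt_top⟩

theorem ae_interior_mem_cell :
    ∀ᵐ x ∂((volume : Measure (Space N)).restrict (interior s.cell)), x ∈ s.cell :=
  (ae_restrict_mem isOpen_interior.measurableSet).mono fun _ hx => interior_subset hx

theorem memLp_interior_cell {E : Type*} [NormedAddCommGroup E] {w : Space N → E}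
    (hw : Continuous w) (q : ℝ≥0∞) :
    MemLp w q (volume.restrict (interior s.cell)) :=
  memLp_of_continuous_of_isCompact s.isCompact_cell ae_interior_mem_cell hw q

theorem exists_ae_bound_cell {κ : Space N → ℝ} (hκ : Continuous κ) :
    ∃ C, ∀ᵐ x ∂((volume : Measure (Space N)).restrict (interior s.cell)), ‖κ x‖ ≤ C := by
  obtain ⟨C, hC⟩ := s.isCompact_cell.exists_bound_of_continuousOn hκ.continuousOn
  exact ⟨C, ae_interior_mem_cell.mono hC⟩

theorem integrable_bilin_cell (A : Matrix (Fin L) (Fin L) ℝ) {κ : Space N → ℝ} (hκ : Continuous κ)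
    {u v : Space N → State L} (hu : MemLp u 2 (volume.restrict (interior s.cell)))
    (hv : MemLp v 2 (volume.restrict (interior s.cell))) :
    IntegrableOn (fun x => κ x * matForm A (u x) (v x)) (interior s.cell) := by
  obtain ⟨C, hC⟩ := exists_ae_bound_cell (s := s) hκ
  exact integrable_bilin _ hκ.aestronglyMeasurable hC hu hv

theorem H1.memLp_func (z : H1 U L) (hs : interior s.cell ⊆ U) :
    MemLp (H1.func z) 2 (volume.restrict (interior s.cell)) :=
  (Lp.memLp _).mono_measure (Measure.restrict_mono hs le_rfl)

theorem H1.memLp_weakPartial (z : H1 U L) (j : Fin N) (hs : interior s.cell ⊆ U) :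
    MemLp (H1.weakPartial j z) 2 (volume.restrict (interior s.cell)) :=
  (Lp.memLp _).mono_measure (Measure.restrict_mono hs le_rfl)

/-- The radial flux is quadratic in the function and its derivatives with bounded coefficients on
the cell, hence continuous under H¹ convergence. This is what carries facet identities from smooth
functions to `z`. -/
theorem SmoothApprox.tendsto_radialFlux {z : H1 U L} (hs : interior s.cell ⊆ U)
    {W : ℕ → Space N → State L} (hW : SmoothApprox z (interior s.cell) W) (p : s.1)
    (a : Space N →ᵃ[ℝ] ℝ) (A : Matrix (Fin L) (Fin L) ℝ) :
    Tendsto (fun n => radialFlux p a A (W n) fun k x => fderiv ℝ (W n) x (basisVec k)) atTop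
      (𝓝 (radialFlux p a A (H1.func z) fun k => H1.weakPartial k z)) := by
  have ha := continuous_affineMap a
  have hal := continuous_linear a
  have hfun : ∀ n, MemLp (W n) 2 (volume.restrict (interior s.cell)) :=
    fun n => memLp_interior_cell (hW.1 n).continuous 2
  have hder : ∀ k n, MemLp (fun x => fderiv ℝ (W n) x (basisVec k)) 2
      (volume.restrict (interior s.cell)) := fun k n =>
    memLp_interior_cell (((hW.1 n).continuous_fderiv (by simp)).clm_apply continuous_const) 2
  refine Tendsto.add ?_ (tendsto_finsetSum _ fun k _ => ?_)
  · have hκ : Continuous fun x => N * a x + a.linear (x - (p : Space N)) := by fun_prop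
    obtain ⟨C, hC⟩ := exists_ae_bound_cell (s := s) hκ
    exact tendsto_integral_bilin _ hκ.aestronglyMeasurable hC (H1.memLp_func z hs) (H1.memLp_func z hs)
      hfun hfun hW.2.1 hW.2.1
  · have hκ : Continuous fun x => 2 * a x * (x - (p : Space N)) k := by fun_prop
    obtain ⟨C, hC⟩ := exists_ae_bound_cell (s := s) hκ
    exact tendsto_integral_bilin _ hκ.aestronglyMeasurable hC (H1.memLp_func z hs)
      (H1.memLp_weakPartial z k hs) hfun (hder k) hW.2.1 (hW.2.2 k)

theorem hasFDerivAt_affineMap (a : Space N →ᵃ[ℝ] ℝ) (x : Space N) :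
    HasFDerivAt a (LinearMap.toContinuousLinearMap a.linear) x := by
  have h : (a : Space N → ℝ) = fun x => LinearMap.toContinuousLinearMap a.linear x + a 0 := by
    ext x
    have := congrFun a.decomp x
    simpa using this
  rw [h]
  exact (LinearMap.toContinuousLinearMap a.linear).hasFDerivAt.add_const _

theorem contDiff_affineMap (a : Space N →ᵃ[ℝ] ℝ) {n : ℕ∞ω} : ContDiff ℝ n a := by
  have h : (a : Space N → ℝ) = fun x => LinearMap.toContinuousLinearMap a.linear x + a 0 := by
    ext x
    have := congrFun a.decomp x
    simpa using this
  rw [h]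
  exact (LinearMap.toContinuousLinearMap a.linear).contDiff.add contDiff_const

theorem sum_smul_basisVec (x : Space N) : ∑ k, x k • (basisVec k : Space N) = x := by
  ext i
  simp [Finset.sum_apply, Pi.single_apply]

/-- The radial flux of a smooth function is a surface integral. -/
theorem radialFlux_smooth (hN : 0 < N) (p : s.1) (a : Space N →ᵃ[ℝ] ℝ)
    {A : Matrix (Fin L) (Fin L) ℝ} (hA : A.IsSymm) {W : Space N → State L} (hW : ContDiff ℝ ∞ W) :
    radialFlux p a A W (fun k x => fderiv ℝ W x (basisVec k)) =
      Element.facetConst hN p *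
        ∫ x, a x * matForm A (W x) (W x) ∂(facetMeasure (Element.facet p)) := by
  have ha := continuous_affineMap a
  have hal := continuous_linear a
  have hWd : Differentiable ℝ W := hW.differentiable (by simp)
  have hsm : ContDiff ℝ 1 fun x => a x * matForm A (W x) (W x) := by
    have h1 : ContDiff ℝ 1 W := hW.of_le (by exact_mod_cast le_top)
    exact (contDiff_affineMap a).mul (((matForm A).contDiff.comp h1).clm_apply h1)
  rw [← Element.facet_formula hN p hsm, radialFlux, ← integral_finsetSum, ← integral_add]
  · refine integral_congr_ae (Eventually.of_forall fun x => ?_)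
    have h1 := (hWd x).hasFDerivAt
    have h2 : HasFDerivAt (fun x => matForm A (W x)) ((matForm A).comp (fderiv ℝ W x)) x :=
      (matForm A).hasFDerivAt.comp x h1
    have h3 := ((hasFDerivAt_affineMap a x).mul (h2.clm_apply h1)).fderiv
    have h4 : (fun x => a x * matForm A (W x) (W x)) =
      (⇑a * fun y => (matForm A (W y)) (W y)) := rfl
    beta_reduce
    rw [h4, h3]
    have h5 : fderiv ℝ W x (x - (p : Space N)) =
        ∑ k, (x - (p : Space N)) k • fderiv ℝ W x (basisVec k) := by
      conv_lhs => rw [← sum_smul_basisVec (x - (p : Space N))]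
      simp_rw [map_sum, map_smul]
    simp only [add_apply, smul_apply, ContinuousLinearMap.comp_apply,
      ContinuousLinearMap.flip_apply, LinearMap.coe_toContinuousLinearMap', smul_eq_mul]
    rw [matForm_comm hA (fderiv ℝ W x _) (W x), h5, map_sum]
    simp_rw [map_smul, smul_eq_mul]
    have h6 : ∑ k, 2 * a x * (x - (p : Space N)) k * matForm A (W x) (fderiv ℝ W x (basisVec k)) =
        2 * a x * ∑ k, (x - (p : Space N)) k * matForm A (W x) (fderiv ℝ W x (basisVec k)) := by
      rw [Finset.mul_sum]
      exact Finset.sum_congr rfl fun k _ => by ring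
    rw [h6]; ring
  · have hκ : Continuous fun x => N * a x + a.linear (x - (p : Space N)) := by fun_prop
    exact integrable_bilin_cell A hκ (memLp_interior_cell hW.continuous 2)
      (memLp_interior_cell hW.continuous 2)
  · refine integrable_finsetSum _ fun k _ => ?_
    have hκ : Continuous fun x => 2 * a x * (x - (p : Space N)) k := by fun_prop
    exact integrable_bilin_cell A hκ (memLp_interior_cell hW.continuous 2)
      (memLp_interior_cell ((hW.continuous_fderiv (by simp)).clm_apply continuous_const) 2)
  · intro k _
    have hκ : Continuous fun x => 2 * a x * (x - (p : Space N)) k := by fun_prop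
    exact integrable_bilin_cell A hκ (memLp_interior_cell hW.continuous 2)
      (memLp_interior_cell ((hW.continuous_fderiv (by simp)).clm_apply continuous_const) 2)

/-- Facet integrals along an approximating sequence have a limit that is an element integral of `z`,
the same for every sequence. This replaces a trace theorem. -/
theorem tendsto_facet_integral (hN : 0 < N) {z : H1 U L} (hs : interior s.cell ⊆ U)
    {W : ℕ → Space N → State L} (hW : SmoothApprox z (interior s.cell) W) (p : s.1)
    (a : Space N →ᵃ[ℝ] ℝ) {A : Matrix (Fin L) (Fin L) ℝ} (hA : A.IsSymm) :
    Tendsto (fun n => Element.facetConst hN p *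
        ∫ x, a x * matForm A (W n x) (W n x) ∂(facetMeasure (Element.facet p))) atTop
      (𝓝 (radialFlux p a A (H1.func z) fun k => H1.weakPartial k z)) := by
  have := hW.tendsto_radialFlux hs p a A
  simpa only [radialFlux_smooth hN p a hA (hW.1 _)] using this

/-- A facet on which the weight vanishes carries no flux. -/
theorem radialFlux_eq_zero (hN : 0 < N) {z : H1 U L} (hs : interior s.cell ⊆ U)
    {W : ℕ → Space N → State L} (hW : SmoothApprox z (interior s.cell) W) (p : s.1)
    {a : Space N →ᵃ[ℝ] ℝ} {A : Matrix (Fin L) (Fin L) ℝ} (hA : A.IsSymm)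
    (ha : ∀ x, s.basis.coord p x = 0 → a x = 0) :
    radialFlux p a A (H1.func z) (fun k => H1.weakPartial k z) = 0 := by
  refine tendsto_nhds_unique (tendsto_facet_integral hN hs hW p a hA) ?_
  refine tendsto_const_nhds.congr fun n => ?_
  rw [eq_comm, mul_eq_zero]
  right
  apply integral_eq_zero_of_ae
  filter_upwards [Element.ae_facetMeasure p] with x hx
  simp [ha x hx.2]

/-- On an interior facet, the fluxes out of the two adjacent elements cancel. -/
theorem radialFlux_add_eq_zero (sys : HyperbolicSystem mesh L) (hN : 0 < N) {z : H1 U L}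
    (hs : interior s.cell ⊆ U) (ht : interior t.cell ⊆ U) {W : ℕ → Space N → State L}
    (hW : SmoothApprox z (interior s.cell ∪ interior t.cell) W) (hst : s ≠ t) {p : s.1} {q : t.1}
    (hf : Element.facet p = Element.facet q) {a b : Space N →ᵃ[ℝ] ℝ}
    (hab : ∀ x, s.basis.coord p x = 0 → a x = b x)
    (hA : (sys.facetMatrix p).IsSymm) (hB : (sys.facetMatrix q).IsSymm) :
    radialFlux p a (sys.facetMatrix p) (H1.func z) (fun k => H1.weakPartial k z) +
      radialFlux q b (sys.facetMatrix q) (H1.func z) (fun k => H1.weakPartial k z) = 0 := by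
  classical
  -- One and the same sequence approximates on both elements, so the facet values seen from the two
  -- sides coincide. For each smooth `W n` the sum is then zero by the jump relation.
  refine tendsto_nhds_unique ((tendsto_facet_integral hN hs (hW.mono subset_union_left) p a hA).add
    (tendsto_facet_integral hN ht (hW.mono subset_union_right) q b hB)) ?_
  refine tendsto_const_nhds.congr fun n => ?_
  have hWc := (hW.1 n).continuous
  have hb : ∫ x, b x * matForm (sys.facetMatrix q) (W n x) (W n x)
        ∂(facetMeasure (Element.facet q)) =
      ∫ x, a x * matForm (sys.facetMatrix q) (W n x) (W n x)
        ∂(facetMeasure (Element.facet p)) := by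
    rw [← hf]
    refine integral_congr_ae ?_
    filter_upwards [Element.ae_facetMeasure p] with x hx
    rw [hab x hx.2]
  have hint : ∀ A : Matrix (Fin L) (Fin L) ℝ,
      Integrable (fun x => a x * matForm A (W n x) (W n x)) (facetMeasure (Element.facet p)) := by
    intro A
    rw [Element.facet_eq_erase]
    exact Element.integrable_facetMeasure hN p ((continuous_affineMap a).mul
      (((matForm A).continuous.comp hWc).clm_apply hWc))
  rw [hb, ← integral_const_mul, ← integral_const_mul,
    ← integral_add ((hint _).const_mul _) ((hint _).const_mul _), eq_comm]
  apply integral_eq_zero_of_ae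
  filter_upwards with x
  have h1 := congrArg (fun M => matForm M (W n x) (W n x)) (sys.facetMatrix_jump hN hst hf)
  simp only [matForm_add, matForm_smul, matForm_zero, add_apply, smul_apply, smul_eq_mul,
    zero_apply] at h1
  have : a x * (Element.facetConst hN p * matForm (sys.facetMatrix p) (W n x) (W n x) +
      Element.facetConst hN q * matForm (sys.facetMatrix q) (W n x) (W n x)) = 0 := by
    rw [h1, mul_zero]
  rw [Pi.zero_apply, ← this]; ring

/-- A facet with a trace for which the boundary form is nonnegative has nonnegative flux. -/
theorem radialFlux_nonneg (hN : 0 < N) {z : H1 U L} (hs : interior s.cell ⊆ U) (p : s.1)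
    {h : Space N → State L} (hh : IsTrace z s (Element.facet p) h)
    (a : Space N →ᵃ[ℝ] ℝ) {A : Matrix (Fin L) (Fin L) ℝ} (hA : A.IsSymm)
    (hpos : ∀ᵐ x ∂(facetMeasure (Element.facet p)), 0 ≤ a x * matForm A (h x) (h x)) :
    0 ≤ radialFlux p a A (H1.func z) (fun k => H1.weakPartial k z) := by
  classical
  obtain ⟨hhL, W, hWs, hW0, hW1, hWf⟩ := hh
  have hW : SmoothApprox z (interior s.cell) W := ⟨hWs, hW0, hW1⟩
  have hfin : IsFiniteMeasure (facetMeasure (Element.facet p)) := by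
    rw [Element.facet_eq_erase]; exact Element.isFiniteMeasure_facetMeasure hN p
  have hmem : ∀ᵐ x ∂(facetMeasure (Element.facet p)), x ∈ s.cell :=
    (Element.ae_facetMeasure p).mono fun x hx => hx.1
  have hWL : ∀ n, MemLp (W n) 2 (facetMeasure (Element.facet p)) := fun n =>
    memLp_of_continuous_of_isCompact s.isCompact_cell hmem (hWs n).continuous 2
  obtain ⟨C, hC⟩ := s.isCompact_cell.exists_bound_of_continuousOn
    (continuous_affineMap a).continuousOn
  have hlim := (tendsto_integral_bilin (matForm A) (κ := a)
    (continuous_affineMap a).aestronglyMeasurable (hmem.mono hC) hhL hhL hWL hWL hWf hWf).const_mul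
    (Element.facetConst hN p)
  rw [tendsto_nhds_unique (tendsto_facet_integral hN hs hW p a hA) hlim]
  exact mul_nonneg (Element.facetConst_pos hN p).le (integral_nonneg_of_ae hpos)

end FacetFlux
open SpatialMesh

/-! ### The total flux through the boundary of the vertex patch -/

section RadialFlux
variable {N L : ℕ} {mesh : SpatialMesh N} {U : Set (Space N)} {s t : mesh.Element}

theorem radialFlux_zero_left (p : s.1) (A : Matrix (Fin L) (Fin L) ℝ) (w : Space N → State L)
    (d : Fin N → Space N → State L) : radialFlux p 0 A w d = 0 := by
  simp [radialFlux]

theorem integral_sum_mul {ι : Type*} (I : Finset ι) (A : Matrix (Fin L) (Fin L) ℝ)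
    {κ : ι → Space N → ℝ} (hκ : ∀ i, Continuous (κ i)) (c : ι → ℝ) {u v : Space N → State L}
    (hu : MemLp u 2 (volume.restrict (interior s.cell)))
    (hv : MemLp v 2 (volume.restrict (interior s.cell))) :
    ∑ i ∈ I, c i * ∫ x in interior s.cell, κ i x * matForm A (u x) (v x) =
      ∫ x in interior s.cell, (∑ i ∈ I, c i * κ i x) * matForm A (u x) (v x) := by
  simp_rw [← integral_const_mul]
  rw [← integral_finsetSum]
  · refine integral_congr_ae (Eventually.of_forall fun x => ?_)
    beta_reduce
    rw [Finset.sum_mul]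
    exact Finset.sum_congr rfl fun i _ => by ring
  · exact fun i _ => (integrable_bilin_cell A (hκ i) hu hv).const_mul _

/-- The radial fluxes of the vertices add up to the divergence in a constant direction. -/
theorem sum_radialFlux (a : Space N →ᵃ[ℝ] ℝ) (A : Matrix (Fin L) (Fin L) ℝ) {w : Space N → State L}
    {d : Fin N → Space N → State L} (hw : MemLp w 2 (volume.restrict (interior s.cell)))
    (hd : ∀ k, MemLp (d k) 2 (volume.restrict (interior s.cell))) (j : Fin N) :
    ∑ p : s.1, -(s.basis.coord p).linear (basisVec j) * radialFlux p a A w d =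
      (∫ x in interior s.cell, a.linear (basisVec j) * matForm A (w x) (w x)) +
        ∫ x in interior s.cell, 2 * a x * matForm A (w x) (d j x) := by
  have ha := continuous_affineMap a
  have hal := continuous_linear a
  -- With these weights the radial fields add up to the constant field `basisVec j`, and the weights
  -- themselves sum to zero. The rest compares the coefficients of the divergence.
  have hvec : ∀ x : Space N, ∑ p : s.1, -(s.basis.coord p).linear (basisVec j) •
      (x - (p : Space N)) = basisVec j := by
    intro x
    have := Element.sum_coord_linear_smul (s := s) (basisVec j) x
    simp_rw [neg_smul, Finset.sum_neg_distrib, this, neg_neg]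
  have h0 : ∑ p : s.1, -(s.basis.coord p).linear (basisVec j) = 0 := by
    rw [Finset.sum_neg_distrib, Element.sum_coord_linear, neg_zero]
  simp_rw [radialFlux, mul_add, Finset.mul_sum, Finset.sum_add_distrib]
  rw [Finset.sum_comm]
  have e1 := integral_sum_mul (Finset.univ : Finset s.1) A
    (κ := fun p x => N * a x + a.linear (x - (p : Space N))) (fun p => by fun_prop)
    (fun p => -(s.basis.coord p).linear (basisVec j)) hw hw
  have e2 := fun k => integral_sum_mul (Finset.univ : Finset s.1) A
    (κ := fun p x => 2 * a x * (x - (p : Space N)) k) (fun p => by fun_prop)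
    (fun p => -(s.basis.coord p).linear (basisVec j)) hw (hd k)
  rw [e1]
  simp_rw [e2]
  congr 1
  · refine integral_congr_ae (Eventually.of_forall fun x => ?_)
    beta_reduce
    congr 1
    have h2 := congrArg a.linear (hvec x)
    rw [map_sum] at h2
    simp_rw [map_smul, smul_eq_mul] at h2
    rw [← h2]
    simp_rw [mul_add, Finset.sum_add_distrib, ← Finset.sum_mul, h0, zero_mul, zero_add]
  · rw [Finset.sum_eq_single j]
    · refine integral_congr_ae (Eventually.of_forall fun x => ?_)
      beta_reduce
      congr 1
      have h2 := congrArg (fun v : Space N => v j) (hvec x)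
      simp only [WithLp.ofLp_sum, WithLp.ofLp_smul, Finset.sum_apply, Pi.smul_apply,
        smul_eq_mul, PiLp.single_apply, if_true] at h2
      calc ∑ p : s.1, -(s.basis.coord p).linear (basisVec j) * (2 * a x * (x - (p : Space N)) j)
          = 2 * a x * ∑ p : s.1, -(s.basis.coord p).linear (basisVec j) *
              (x - (p : Space N)) j := by
            rw [Finset.mul_sum]; exact Finset.sum_congr rfl fun p _ => by ring
        _ = 2 * a x := by rw [h2, mul_one]
    · intro k _ hk
      have : ∀ x : Space N, ∑ p : s.1, -(s.basis.coord p).linear (basisVec j) *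
          (2 * a x * (x - (p : Space N)) k) = 0 := by
        intro x
        have h2 := congrArg (fun v : Space N => v k) (hvec x)
        simp only [WithLp.ofLp_sum, WithLp.ofLp_smul, Finset.sum_apply, Pi.smul_apply,
          smul_eq_mul, PiLp.single_apply, if_neg hk] at h2
        calc ∑ p : s.1, -(s.basis.coord p).linear (basisVec j) * (2 * a x * (x - (p : Space N)) k)
            = 2 * a x * ∑ p : s.1, -(s.basis.coord p).linear (basisVec j) *
                (x - (p : Space N)) k := by
              rw [Finset.mul_sum]; exact Finset.sum_congr rfl fun p _ => by ring
          _ = 0 := by rw [h2, mul_zero]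
      simp_rw [this, zero_mul, integral_zero]
    · simp

theorem integral_matForm_sum (A : Fin N → Matrix (Fin L) (Fin L) ℝ) (c : Fin N → ℝ)
    {κ : Space N → ℝ} (hκ : Continuous κ) {u v : Space N → State L}
    (hu : MemLp u 2 (volume.restrict (interior s.cell)))
    (hv : MemLp v 2 (volume.restrict (interior s.cell))) :
    ∫ x in interior s.cell, κ x * matForm (∑ j, c j • A j) (u x) (v x) =
      ∑ j, c j * ∫ x in interior s.cell, κ x * matForm (A j) (u x) (v x) := by
  simp_rw [← integral_const_mul]
  rw [← integral_finsetSum]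
  · refine integral_congr_ae (Eventually.of_forall fun x => ?_)
    beta_reduce
    simp_rw [matForm_sum, matForm_smul, sum_apply, smul_apply, smul_eq_mul, Finset.mul_sum]
    exact Finset.sum_congr rfl fun i _ => by ring
  · exact fun j _ => (integrable_bilin_cell (A j) hκ hu hv).const_mul _

theorem radialFlux_matrix_sum (p : s.1) (a : Space N →ᵃ[ℝ] ℝ)
    (A : Fin N → Matrix (Fin L) (Fin L) ℝ) (c : Fin N → ℝ) {w : Space N → State L}
    {d : Fin N → Space N → State L} (hw : MemLp w 2 (volume.restrict (interior s.cell)))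
    (hd : ∀ k, MemLp (d k) 2 (volume.restrict (interior s.cell))) :
    radialFlux p a (∑ j, c j • A j) w d = ∑ j, c j * radialFlux p a (A j) w d := by
  have ha := continuous_affineMap a
  have hal := continuous_linear a
  rw [radialFlux, integral_matForm_sum A c (by fun_prop) hw hw]
  simp_rw [fun k => integral_matForm_sum (s := s) A c
    (κ := fun x => 2 * a x * (x - (p : Space N)) k) (by fun_prop) hw (hd k)]
  rw [Finset.sum_comm, ← Finset.sum_add_distrib]
  refine Finset.sum_congr rfl fun j _ => ?_
  rw [radialFlux, mul_add, Finset.mul_sum]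

/-- The divergence theorem on an element: the facet fluxes add up to the integral of the
divergence of `a (ℒ w) · w`. -/
theorem sum_radialFlux_facetMatrix (sys : HyperbolicSystem mesh L) (a : Space N →ᵃ[ℝ] ℝ)
    {w : Space N → State L} {d : Fin N → Space N → State L}
    (hw : MemLp w 2 (volume.restrict (interior s.cell)))
    (hd : ∀ k, MemLp (d k) 2 (volume.restrict (interior s.cell))) :
    ∑ p : s.1, radialFlux p a (sys.facetMatrix p) w d =
      (∫ x in interior s.cell,
        matForm (∑ j, a.linear (basisVec j) • sys.A j s) (w x) (w x)) +
        ∑ j, ∫ x in interior s.cell, 2 * a x * matForm (sys.A j s) (w x) (d j x) := by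
  simp_rw [HyperbolicSystem.facetMatrix, radialFlux_matrix_sum _ a _ _ hw hd]
  rw [Finset.sum_comm]
  simp_rw [sum_radialFlux a (sys.A _ s) hw hd, Finset.sum_add_distrib, integral_const_mul]
  congr 1
  have := integral_matForm_sum (s := s) (fun j => sys.A j s) (fun j => a.linear (basisVec j))
    (κ := fun _ => 1) continuous_const hw hw
  simp only [one_mul] at this
  rw [this]

theorem HyperbolicSystem.facetMatrix_isSymm (sys : HyperbolicSystem mesh L) (p : s.1) :
    (sys.facetMatrix p).IsSymm := by
  unfold Matrix.IsSymm HyperbolicSystem.facetMatrix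
  rw [Matrix.transpose_sum]
  exact Finset.sum_congr rfl fun j _ => by rw [Matrix.transpose_smul, (sys.A_symm j s).eq]

end RadialFlux

/-! ### Contractions into an element or a pair of elements -/

namespace SpatialMesh.Element
variable {N : ℕ} {mesh : SpatialMesh N} {s t : mesh.Element}

theorem exists_norm_sub_le (o : Space N) : ∃ D, ∀ x ∈ s.cell, ‖x - o‖ ≤ D :=
  s.isCompact_cell.exists_bound_of_continuousOn (f := fun x => x - o) (by fun_prop)

theorem coord_contraction (p : s.1) (o x : Space N) (θ : ℝ) :
    s.basis.coord p (o + θ • (x - o)) =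
      (1 - θ) * s.basis.coord p o + θ * s.basis.coord p x := by
  rw [affineMap_add, map_smul, affineMap_linear_sub, smul_eq_mul]; ring

/-- All barycentric coordinates of the barycentre are positive, and those of points of the cell are
nonnegative, so proper convex combinations have only positive coordinates. -/
theorem contraction_mem_interior {θ : ℝ} (hθ : θ ∈ Ioo (0 : ℝ) 1) {x : Space N}
    (hx : x ∈ s.cell) : barycentre s.1 + θ • (x - barycentre s.1) ∈ interior s.cell := by
  classical
  rw [mem_interior_cell]
  intro k
  rw [coord_contraction]
  have h1 : 0 < s.basis.coord k (barycentre s.1) := by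
    rw [affineMap_barycentre _ ⟨k, k.2⟩]
    refine Finset.sum_pos' (fun q hq => ?_) ⟨k, k.2, ?_⟩
    · rw [coord_vertex k hq]; positivity
    · rw [coord_vertex k k.2, if_pos rfl, mul_one]
      have : 0 < s.1.card := by rw [s.2.2]; omega
      positivity
  have h2 := s.mem_cell.mp hx k
  have := mul_pos (sub_pos.mpr hθ.2) h1
  have := mul_nonneg hθ.1.le h2
  linarith

/-- The centre is the barycentre of the common facet, where only the `p`-coordinate vanishes. Points
with positive `p`-coordinate move into the interior of `s`; points of the facet move into its
relative interior, which is interior to the union of the two cells. -/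
theorem contraction_mem_interior_union [DecidableEq (Space N)] (hN : 0 < N) (hst : s ≠ t)
    {p : s.1} {q : t.1} (hf : s.1.erase p = t.1.erase q) {θ : ℝ} (hθ : θ ∈ Ioo (0 : ℝ) 1)
    {x : Space N} (hx : x ∈ s.cell) :
    barycentre (s.1.erase p) + θ • (x - barycentre (s.1.erase p)) ∈
      interior (s.cell ∪ t.cell) := by
  set y := barycentre (s.1.erase p) + θ • (x - barycentre (s.1.erase p)) with hy
  have hcoord : ∀ k, s.basis.coord k y =
      (1 - θ) * (if k = p then 0 else 1 / (N : ℝ)) + θ * s.basis.coord k x := by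
    intro k
    rw [hy, coord_contraction, coord_barycentre_erase hN]
  have h1 : y ∈ facetNhd p := by
    intro k hk
    rw [hcoord, if_neg hk]
    have h2 := mul_nonneg hθ.1.le (s.mem_cell.mp hx k)
    have h3 : 0 < (1 - θ) * (1 / (N : ℝ)) := mul_pos (sub_pos.mpr hθ.2) (by positivity)
    linarith
  have h2 : s.basis.coord p y = θ * s.basis.coord p x := by
    rw [hcoord, if_pos rfl, mul_zero, zero_add]
  rcases (s.mem_cell.mp hx p).eq_or_lt with h0 | h0
  · rw [← h0, mul_zero] at h2
    have h3 : y ∈ facetNhd q := by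
      intro k hk
      have hks : (k : Space N) ∈ s.1.erase p := by
        rw [hf]; exact Finset.mem_erase.mpr ⟨fun h => hk (Subtype.ext h), k.2⟩
      rw [Finset.mem_erase] at hks
      have h4 := coord_eq_of_common_facet hf h2 hks.2 k.2
      have h5 := h1 ⟨k, hks.2⟩ (fun h => hks.1 (congrArg Subtype.val h))
      rw [← h4] at h5
      exact h5
    exact interior_maximal (facetNhd_inter_subset hN hst hf)
      ((isOpen_facetNhd p).inter (isOpen_facetNhd q)) ⟨h1, h3⟩
  · refine interior_mono subset_union_left ?_
    rw [mem_interior_cell]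
    intro k
    by_cases hk : k = p
    · rw [hk, h2]; exact mul_pos hθ.1 h0
    · exact h1 k hk

theorem volume_interior_ne_top : volume (interior s.cell) ≠ ⊤ :=
  ((measure_mono interior_subset).trans_lt s.isCompact_cell.measure_lt_top).ne

theorem isCompact_contraction_image {K : Set (Space N)} (hK : IsCompact K) (o : Space N) (θ : ℝ) :
    IsCompact ((fun x => o + θ • (x - o)) '' K) := hK.image (by fun_prop)

end SpatialMesh.Element

section Approx
variable {N L : ℕ} {mesh : SpatialMesh N} {U : Set (Space N)} {s t : mesh.Element}

theorem exists_smoothApprox_cell (hU : IsOpen U) (z : H1 U L) (hs : interior s.cell ⊆ U) :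
    ∃ W, SmoothApprox z (interior s.cell) W := by
  obtain ⟨D, hD⟩ := Element.exists_norm_sub_le (s := s) (barycentre s.1)
  refine exists_smoothApprox hU z isOpen_interior.measurableSet hs
    Element.volume_interior_ne_top (barycentre s.1) (fun x hx => hD x (interior_subset hx))
    fun θ hθ => ⟨_, Element.isCompact_contraction_image s.isCompact_cell (barycentre s.1) θ, ?_,
      fun x hx => mem_image_of_mem _ (interior_subset hx)⟩
  rintro _ ⟨x, hx, rfl⟩
  exact hs (Element.contraction_mem_interior hθ hx)

/-- Contracting each element to its own barycentre would give separate sequences whose facet values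
need not match. The barycentre of the common facet serves both elements at once, and this is where
`z` being weakly differentiable across the facet is used. -/
theorem exists_smoothApprox_pair (hN : 0 < N) (hU : IsOpen U) (z : H1 U L)
    (hUst : interior (s.cell ∪ t.cell) ⊆ U) (hst : s ≠ t) {p : s.1} {q : t.1}
    (hf : Element.facet p = Element.facet q) :
    ∃ W, SmoothApprox z (interior s.cell ∪ interior t.cell) W := by
  classical
  rw [Element.facet_eq_erase, Element.facet_eq_erase] at hf
  set c := barycentre (s.1.erase p) with hc
  obtain ⟨D, hD⟩ := Element.exists_norm_sub_le (s := s) c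
  obtain ⟨D', hD'⟩ := Element.exists_norm_sub_le (s := t) c
  have hsub : interior s.cell ∪ interior t.cell ⊆ s.cell ∪ t.cell :=
    union_subset_union interior_subset interior_subset
  refine exists_smoothApprox hU z (isOpen_interior.union isOpen_interior).measurableSet
    (Subset.trans (union_subset (interior_mono subset_union_left)
      (interior_mono subset_union_right)) hUst)
    ((measure_union_lt_top Element.volume_interior_ne_top.lt_top
      Element.volume_interior_ne_top.lt_top).ne) c (D := max D D') ?_
    fun θ hθ => ⟨_, Element.isCompact_contraction_image
      (s.isCompact_cell.union t.isCompact_cell) c θ, ?_,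
      fun x hx => mem_image_of_mem _ (hsub hx)⟩
  · intro x hx
    rcases hsub hx with h | h
    · exact (hD x h).trans (le_max_left _ _)
    · exact (hD' x h).trans (le_max_right _ _)
  · rintro _ ⟨x, hx | hx, rfl⟩
    · exact hUst (Element.contraction_mem_interior_union hN hst hf hθ hx)
    · apply hUst
      rw [union_comm]
      have := Element.contraction_mem_interior_union hN hst.symm hf.symm hθ hx
      rw [← hf] at this
      exact this

end Approx
open SpatialMesh

/-! ### The tent height and the sign of the total flux -/

namespace Tent
variable {N L : ℕ} {mesh : SpatialMesh N} (T : Tent mesh) {s t : mesh.Element}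

/-- The affine function that extends the height `δ` of the tent over an element of the patch. -/
def deltaAff (s : mesh.Element) : Space N →ᵃ[ℝ] ℝ := by
  classical exact if h : T.v ∈ s.1 then T.delta T.v • s.basis.coord ⟨T.v, h⟩ else 0

theorem deltaAff_eq (hs : T.v ∈ s.1) :
    T.deltaAff s = T.delta T.v • s.basis.coord ⟨T.v, hs⟩ := by
  rw [deltaAff, dif_pos hs]

theorem deltaAff_apply (hs : T.v ∈ s.1) (x : Space N) :
    T.deltaAff s x = T.delta T.v * s.basis.coord ⟨T.v, hs⟩ x := by
  rw [deltaAff_eq T hs]; rfl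

theorem deltaAff_of_notMem (hs : T.v ∉ s.1) : T.deltaAff s = 0 := by
  rw [deltaAff, dif_neg hs]

theorem delta_v_pos : 0 < T.delta T.v := sub_pos.mpr T.pitched

/-- The affine function that extends the bottom of the tent over an element of the patch. -/
def botAff (s : mesh.Element) : Space N →ᵃ[ℝ] ℝ := by
  classical exact if h : T.v ∈ s.1 then (T.bot_linear s h).choose else 0

theorem eqOn_bot (hs : T.v ∈ s.1) : EqOn T.bot (T.botAff s) s.cell := by
  rw [botAff, dif_pos hs]
  exact (T.bot_linear s hs).choose_spec

/-- An affine function on a simplex is determined by its vertex values, and δ vanishes at all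
vertices but `T.v`. So δ is a multiple of the hat function of that vertex. -/
theorem eqOn_delta (hs : T.v ∈ s.1) : EqOn T.delta (T.deltaAff s) s.cell := by
  obtain ⟨a, ha⟩ := T.bot_linear s hs
  obtain ⟨b, hb⟩ := T.top_linear s hs
  intro x hx
  have h1 : T.delta x = (b - a) x := by
    rw [delta, ha hx, hb hx]; rfl
  have h2 : ∀ p : s.1, (b - a) (p : Space N) = T.delta p := by
    intro p
    rw [delta, ha (s.mem_cell_of_mem p.2), hb (s.mem_cell_of_mem p.2)]; rfl
  rw [h1, Element.affineMap_eq_sum (s := s) (b - a) x, Finset.sum_eq_single ⟨T.v, hs⟩, h2,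
    deltaAff_apply T hs, mul_comm]
  · intro p _ hp
    rw [h2, delta, T.fixed s hs p p.2 (fun h => hp (Subtype.ext h)), sub_self, mul_zero]
  · simp

theorem eqOn_top (hs : T.v ∈ s.1) : EqOn T.top (T.botAff s + T.deltaAff s) s.cell := by
  intro x hx
  have h1 := T.eqOn_bot hs hx
  have h2 := T.eqOn_delta hs hx
  rw [delta] at h2
  show T.top x = T.botAff s x + T.deltaAff s x
  linarith

theorem delta_nonneg (hs : T.v ∈ s.1) {x : Space N} (hx : x ∈ s.cell) : 0 ≤ T.delta x := by
  rw [T.eqOn_delta hs hx, deltaAff_apply T hs]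
  exact mul_nonneg T.delta_v_pos.le (s.mem_cell.mp hx _)

theorem deltaAff_pos (hs : T.v ∈ s.1) {x : Space N} (hx : x ∈ interior s.cell) :
    0 < T.deltaAff s x := by
  rw [deltaAff_apply T hs]
  exact mul_pos T.delta_v_pos (s.mem_interior_cell.mp hx _)

/-- Points over the boundary of the domain between bottom and top lie in `∂_bdr`. -/
theorem Phi_mem_bdrBoundary (hs : T.v ∈ s.1) {x : Space N} (hx : x ∈ s.cell)
    (hxd : x ∈ frontier mesh.domain) (hδ : 0 < T.delta x) {τ : ℝ} (hτ : τ ∈ Ioo (0 : ℝ) 1) :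
    T.Phi (x, τ) ∈ T.bdrBoundary := by
  have hxp : x ∈ T.patch := T.cell_subset_patch hs hx
  have h0 : 0 < τ * T.delta x := mul_pos hτ.1 hδ
  have h1 : τ * T.delta x < T.delta x := by nlinarith [hτ.2]
  have hd : T.delta x = T.top x - T.bot x := rfl
  have hbot : T.bot x < T.phi x τ := by rw [phi]; linarith
  have htop : T.phi x τ < T.top x := by rw [phi]; linarith
  refine ⟨⟨subset_closure ⟨hxp, hbot.le, htop.le⟩, fun hint => ?_⟩, fun h => ?_, fun h => ?_⟩
  · have h2 : interior T.region ⊆ Prod.fst ⁻¹' interior T.patch := by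
      rw [isOpenMap_fst.preimage_interior_eq_interior_preimage continuous_fst]
      exact interior_mono fun p hp => hp.1
    have h3 : x ∈ mesh.domain := T.interior_patch_subset_domain (h2 hint)
    have hdom : IsOpen mesh.domain := isOpen_interior
    rw [hdom.frontier_eq] at hxd
    exact hxd.2 h3
  · exact htop.ne h.2
  · exact hbot.ne' h.2

variable (sys : HyperbolicSystem mesh L)

/-- The flux through a facet in the boundary of the domain is nonnegative. -/
theorem boundary_radialFlux_nonneg (hN : 0 < N) {uhat : ℝ → H1 (interior T.patch) L}
    (hbc : T.SatisfiesBoundaryCondition sys uhat) {τ : ℝ} (hτ : τ ∈ Ioo (0 : ℝ) 1)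
    (hs : T.v ∈ s.1) (p : s.1)
    (hp : ∀ t : mesh.Element, Element.facet p ⊆ t.1 → t = s) :
    0 ≤ radialFlux p (T.deltaAff s) (sys.facetMatrix p) (H1.func (uhat τ))
      (fun k => H1.weakPartial k (uhat τ)) := by
  classical
  have hfr : convexHull ℝ (Element.facet p : Set (Space N)) ⊆ frontier mesh.domain := by
    rw [Element.facet_eq_erase]
    refine facet_subset_frontier hN fun t ht => hp t ?_
    rwa [Element.facet_eq_erase]
  set ℓ := (s.basis.coord p).linear with hℓ
  -- `g` is the gradient of the barycentric coordinate of `p`: normal to the facet and pointing into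
  -- the element. The outward unit normal is therefore its negative, normalised.
  set g : Space N := WithLp.toLp 2 fun j => ℓ (basisVec j) with hg
  have hgin : ∀ x, inner ℝ g x = ℓ x := by
    intro x
    conv_rhs => rw [← sum_smul_basisVec x]
    rw [map_sum, PiLp.inner_apply]
    simp_rw [map_smul, smul_eq_mul]
    exact Finset.sum_congr rfl fun j _ => by simp [hg]
  obtain ⟨q, hq⟩ := Element.exists_ne_vertex hN p
  have hg0 : 0 < ‖g‖ := by
    rw [norm_pos_iff]
    intro h0
    have h1 := hgin ((q : Space N) - p)
    rw [h0, inner_zero_left, hℓ, Element.coord_linear_sub_vertex hq] at h1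
    norm_num at h1
  set n : Space N := -(‖g‖⁻¹ • g) with hn
  have hnin : ∀ x, inner ℝ n x = -(‖g‖⁻¹ * ℓ x) := by
    intro x
    rw [hn, inner_neg_left, real_inner_smul_left, hgin]
  have hfacet : mesh.IsBoundaryFacet s (Element.facet p) n := by
    refine ⟨fun x hx => (Element.mem_facet.mp hx).2, ?_, hfr, ?_, ?_, ?_⟩
    · rw [Element.facet_eq_erase]; exact Element.card_erase p
    · rw [hn, norm_neg, norm_smul, norm_inv, norm_norm, inv_mul_cancel₀ hg0.ne']
    · intro a ha b hb
      rw [Element.mem_facet] at ha hb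
      rw [hnin, hℓ, affineMap_linear_sub, Element.coord_vertex p hb.2, Element.coord_vertex p ha.2,
        if_neg hb.1.symm, if_neg ha.1.symm]
      simp
    · intro a ha b hb hbf
      rw [Element.mem_facet] at ha
      have hbp : (p : Space N) = b := by
        by_contra h
        exact hbf (Element.mem_facet.mpr ⟨fun h' => h h'.symm, hb⟩)
      rw [hnin, hℓ, affineMap_linear_sub, Element.coord_vertex p hb, Element.coord_vertex p ha.2,
        if_pos hbp, if_neg ha.1.symm]
      simpa using hg0
  have hmat : sys.facetMatrix p = ‖g‖ • sys.normalMatrix s n := by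
    rw [HyperbolicSystem.facetMatrix, HyperbolicSystem.normalMatrix, Finset.smul_sum]
    refine Finset.sum_congr rfl fun j _ => ?_
    rw [smul_smul]
    congr 1
    have h1 : n j = -(‖g‖⁻¹ * ℓ (basisVec j)) := rfl
    rw [h1, mul_neg, mul_inv_cancel_left₀ hg0.ne']
  obtain ⟨h, htr, hcond⟩ := hbc τ hτ s (Element.facet p) n hs hfacet
  refine radialFlux_nonneg hN (T.interior_cell_subset hs) p htr _ (sys.facetMatrix_isSymm p) ?_
  filter_upwards [hcond, sys.bdry_nonneg s (Element.facet p) n hfacet, Element.ae_facetMeasure p]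
    with x hx hx2 hx3
  have hδ : T.deltaAff s x = T.delta x := (T.eqOn_delta hs hx3.1).symm
  rw [hδ]
  -- Where δ vanishes, the boundary condition gives no information, but the weight kills the flux.
  rcases (T.delta_nonneg hs hx3.1).eq_or_lt with h0 | h0
  · rw [← h0, zero_mul]
  refine mul_nonneg h0.le ?_
  have hxf : x ∈ frontier mesh.domain := hfr (by
    rw [Element.facet_eq_erase, Element.mem_convexHull_erase_iff]; exact hx3)
  have h1 := hx (T.Phi_mem_bdrBoundary hs hx3.1 hxf h0 hτ)
  rw [Matrix.sub_mulVec, sub_eq_zero] at h1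
  rw [hmat, matForm_smul, smul_apply, smul_apply, smul_eq_mul]
  refine mul_nonneg hg0.le ?_
  rw [matForm_apply, h1]
  -- The form of `ℬ + ℬᵗ` is twice that of `ℬ`, and `ℬ h` equals `𝒟 h` by the boundary condition.
  have h2 := hx2.dotProduct_mulVec_nonneg (h x).ofLp
  rw [star_trivial, Matrix.add_mulVec, dotProduct_add, Matrix.mulVec_transpose,
    dotProduct_comm _ ((h x).ofLp ᵥ* _), ← Matrix.dotProduct_mulVec,
    dotProduct_comm (h x).ofLp] at h2
  linarith

/-- The total flux of the tent-weighted energy through the boundary is nonnegative. -/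
theorem sum_radialFlux_nonneg (hN : 0 < N) {uhat : ℝ → H1 (interior T.patch) L}
    (hbc : T.SatisfiesBoundaryCondition sys uhat) {τ : ℝ} (hτ : τ ∈ Ioo (0 : ℝ) 1) :
    0 ≤ ∑ s : mesh.Element, ∑ p : s.1, radialFlux p (T.deltaAff s) (sys.facetMatrix p)
      (H1.func (uhat τ)) (fun k => H1.weakPartial k (uhat τ)) := by
  classical
  set F : (Σ s : mesh.Element, s.1) → ℝ := fun x => radialFlux x.2 (T.deltaAff x.1)
    (sys.facetMatrix x.2) (H1.func (uhat τ)) (fun k => H1.weakPartial k (uhat τ)) with hF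
  have hsum : ∑ s : mesh.Element, ∑ p : s.1, radialFlux p (T.deltaAff s) (sys.facetMatrix p)
      (H1.func (uhat τ)) (fun k => H1.weakPartial k (uhat τ)) = ∑ x, F x := by
    rw [Fintype.sum_sigma]
  rw [hsum]
  -- Pairs of an element and a vertex stand for one-sided facets. `P` selects those which contain
  -- `T.v` and have a second side.
  set P : (Σ s : mesh.Element, s.1) → Prop := fun x => T.v ∈ x.1.1 ∧ (x.2 : Space N) ≠ T.v ∧
    ∃ y : (Σ s : mesh.Element, s.1), y.1 ≠ x.1 ∧ Element.facet x.2 = Element.facet y.2 with hP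
  rw [← Finset.sum_filter_add_sum_filter_not Finset.univ P]
  have hint : ∑ x ∈ Finset.univ.filter P, F x = 0 := by
    have hnb : ∀ x ∈ Finset.univ.filter P, ∃ y : (Σ s : mesh.Element, s.1),
        y.1 ≠ x.1 ∧ Element.facet x.2 = Element.facet y.2 :=
      fun x hx => (Finset.mem_filter.mp hx).2.2.2
    choose g hg1 hg2 using hnb
    have hvg : ∀ x hx, T.v ∈ Element.facet (g x hx).2 := by
      intro x hx
      obtain ⟨h1, h2, _⟩ := (Finset.mem_filter.mp hx).2
      rw [← hg2 x hx]
      exact Element.mem_facet.mpr ⟨h2.symm, h1⟩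
    have hgP : ∀ x hx, g x hx ∈ Finset.univ.filter P := by
      intro x hx
      have h1 := Element.mem_facet.mp (hvg x hx)
      exact Finset.mem_filter.mpr
        ⟨Finset.mem_univ _, h1.2, h1.1.symm, x, (hg1 x hx).symm, (hg2 x hx).symm⟩
    -- Passing to the other side is an involution because at most two elements share a facet and the
    -- facet determines its opposite vertex. The two sides cancel since the coordinates of `T.v` in
    -- both elements, and so both weights, agree on the facet.
    refine Finset.sum_involution g ?_ ?_ hgP ?_
    · intro x hx
      obtain ⟨hv, hpv, _⟩ := (Finset.mem_filter.mp hx).2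
      have hv' := (Element.mem_facet.mp (hvg x hx)).2
      have hpv' := (Element.mem_facet.mp (hvg x hx)).1
      have hsub : interior (x.1.cell ∪ (g x hx).1.cell) ⊆ interior T.patch :=
        interior_mono (union_subset (T.cell_subset_patch hv) (T.cell_subset_patch hv'))
      obtain ⟨W, hW⟩ := exists_smoothApprox_pair hN isOpen_interior (uhat τ) hsub
        (hg1 x hx).symm (hg2 x hx)
      refine radialFlux_add_eq_zero sys hN (T.interior_cell_subset hv)
        (T.interior_cell_subset hv') hW (hg1 x hx).symm (hg2 x hx) ?_
        (sys.facetMatrix_isSymm _) (sys.facetMatrix_isSymm _)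
      intro y hy
      rw [deltaAff_apply T hv, deltaAff_apply T hv']
      congr 1
      have hfe := hg2 x hx
      rw [Element.facet_eq_erase, Element.facet_eq_erase] at hfe
      exact (Element.coord_eq_of_common_facet hfe hy hv hv').symm
    · intro x hx _ h
      exact hg1 x hx (congrArg Sigma.fst h)
    · intro x hx
      have hgx := hgP x hx
      have e1 := hg2 x hx
      have e2 := hg2 _ hgx
      have h1 := hg1 x hx
      have h2 := hg1 _ hgx
      have h3 : (g (g x hx) hgx).1 = x.1 := by
        rw [Element.facet_eq_erase, Element.facet_eq_erase] at e1 e2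
        exact (Element.eq_of_common_facet hN h1 h2.symm e1.symm e2).symm
      have e3 : Element.facet x.2 = Element.facet (g (g x hx) hgx).2 := e1.trans e2
      obtain ⟨s, p⟩ := x
      generalize g (g ⟨s, p⟩ hx) hgx = y at h3 e3
      obtain ⟨s', p'⟩ := y
      obtain rfl : s' = s := h3
      congr 1
      by_contra hne
      have h4 : (p : Space N) ∈ Element.facet p' :=
        Element.mem_facet.mpr ⟨fun h => hne (Subtype.ext h.symm), p.2⟩
      exact (Element.mem_facet.mp (e3 ▸ h4)).1 rfl
  rw [hint, zero_add]
  refine Finset.sum_nonneg fun x hx => ?_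
  have hxP : ¬P x := (Finset.mem_filter.mp hx).2
  obtain ⟨s, p⟩ := x
  by_cases hv : T.v ∈ s.1
  swap
  · simp only [hF, deltaAff_of_notMem T hv, radialFlux_zero_left, le_refl]
  by_cases hpv : (p : Space N) = T.v
  -- The facet opposite to `T.v`: the weight is a multiple of the coordinate of `T.v`, which
  -- vanishes there.
  · obtain ⟨W, hW⟩ := exists_smoothApprox_cell isOpen_interior (uhat τ) (T.interior_cell_subset hv)
    refine (radialFlux_eq_zero hN (T.interior_cell_subset hv) hW p (sys.facetMatrix_isSymm p)
      fun x hx => ?_).ge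
    have : p = ⟨T.v, hv⟩ := Subtype.ext hpv
    rw [deltaAff_apply T hv, ← this, hx, mul_zero]
  -- The facet contains `T.v` and has no second side, so it lies in `∂Ω`.
  · refine T.boundary_radialFlux_nonneg sys hN hbc hτ hv p fun t ht => ?_
    by_contra hts
    rw [Element.facet_eq_erase] at ht
    obtain ⟨q, hq⟩ := Element.exists_erase_eq ht
    refine hxP ⟨hv, hpv, ⟨t, q⟩, hts, ?_⟩
    rw [Element.facet_eq_erase, Element.facet_eq_erase]
    exact hq

end Tent
open SpatialMesh

/-! ### The pull-back of a tent to a cylinder -/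

section Cylinder
variable {N : ℕ} (b d : Space N →ᵃ[ℝ] ℝ)

/-- The map `(x, τ) ↦ (x, b(x) + τ d(x))`. -/
def cylinderMap (p : Space N × ℝ) : Space N × ℝ := (p.1, b p.1 + p.2 * d p.1)

/-- The derivative of `cylinderMap`. -/
def cylinderDeriv (p : Space N × ℝ) : Space N × ℝ →L[ℝ] Space N × ℝ :=
  (ContinuousLinearMap.fst ℝ (Space N) ℝ).prod
    ((LinearMap.toContinuousLinearMap b.linear).comp (ContinuousLinearMap.fst ℝ (Space N) ℝ) +
      (p.2 • (LinearMap.toContinuousLinearMap d.linear).comp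
          (ContinuousLinearMap.fst ℝ (Space N) ℝ) +
        d p.1 • ContinuousLinearMap.snd ℝ (Space N) ℝ))

theorem cylinderDeriv_apply (p v : Space N × ℝ) :
    cylinderDeriv b d p v = (v.1, b.linear v.1 + (p.2 * d.linear v.1 + d p.1 * v.2)) := rfl

theorem hasFDerivAt_cylinderMap (p : Space N × ℝ) :
    HasFDerivAt (cylinderMap b d) (cylinderDeriv b d p) p := by
  have h1 : HasFDerivAt (fun p : Space N × ℝ => p.1) (ContinuousLinearMap.fst ℝ (Space N) ℝ) p :=
    hasFDerivAt_fst
  have h2 : HasFDerivAt (fun p : Space N × ℝ => p.2) (ContinuousLinearMap.snd ℝ (Space N) ℝ) p :=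
    hasFDerivAt_snd
  exact h1.prodMk (((hasFDerivAt_affineMap b p.1).comp p h1).add
    (h2.mul ((hasFDerivAt_affineMap d p.1).comp p h1)))

theorem continuous_cylinderMap : Continuous (cylinderMap b d) := by
  have := continuous_affineMap b
  have := continuous_affineMap d
  unfold cylinderMap
  fun_prop

/-- The derivative fixes the space component, so it is the identity plus a rank one map into the
time direction, with determinant 1 plus the functional evaluated at that direction, namely `1 + (d -
1)`. -/
theorem det_cylinderDeriv (p : Space N × ℝ) : (cylinderDeriv b d p).det = d p.1 := by
  have h : ((cylinderDeriv b d p : Space N × ℝ →L[ℝ] Space N × ℝ) :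
      Space N × ℝ →ₗ[ℝ] Space N × ℝ) = LinearMap.transvection
        ((b.linear + p.2 • d.linear).comp (LinearMap.fst ℝ (Space N) ℝ) +
          (d p.1 - 1) • LinearMap.snd ℝ (Space N) ℝ) ((0 : Space N), (1 : ℝ)) := by
    refine LinearMap.ext fun v => ?_
    rw [LinearMap.transvection.apply]
    refine Prod.ext ?_ ?_
    · simp [cylinderDeriv_apply]
    · simp [cylinderDeriv_apply]; ring
  rw [ContinuousLinearMap.det, h, LinearMap.transvection.det]
  simp

theorem injOn_cylinderMap {O : Set (Space N)} (hd : ∀ x ∈ O, 0 < d x) (J : Set ℝ) :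
    InjOn (cylinderMap b d) (O ×ˢ J) := by
  rintro ⟨x, τ⟩ hx ⟨y, σ⟩ hy h
  simp only [cylinderMap, Prod.mk.injEq] at h
  obtain ⟨rfl, h2⟩ := h
  have h3 : τ * d x = σ * d x := by linarith
  rw [mul_right_cancel₀ (hd x hx.1).ne' h3]

theorem cylinderMap_image {O : Set (Space N)} (hd : ∀ x ∈ O, 0 < d x) :
    cylinderMap b d '' (O ×ˢ Ioo (0 : ℝ) 1) = {p | p.1 ∈ O ∧ b p.1 < p.2 ∧ p.2 < b p.1 + d p.1} := by
  ext ⟨x, t⟩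
  constructor
  · rintro ⟨⟨y, τ⟩, ⟨hy, hτ0, hτ1⟩, h⟩
    simp only [cylinderMap, Prod.mk.injEq] at h
    obtain ⟨rfl, rfl⟩ := h
    have h1 := hd y hy
    have h2 : 0 < τ * d y := mul_pos hτ0 h1
    have h3 : τ * d y < d y := by nlinarith
    exact ⟨hy, by simpa using h2, by simpa using h3⟩
  · rintro ⟨hx, h1, h2⟩
    have h3 := hd x hx
    have h4 : t < b x + d x := h2
    have h5 : b x < t := h1
    refine ⟨(x, (t - b x) / d x), ⟨hx, div_pos (by linarith) h3, ?_⟩, ?_⟩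
    · rw [div_lt_one h3]; linarith
    · simp only [cylinderMap, Prod.mk.injEq, true_and]
      rw [div_mul_cancel₀ _ h3.ne']; ring

theorem isOpen_prism {O : Set (Space N)} (hO : IsOpen O) :
    IsOpen {p : Space N × ℝ | p.1 ∈ O ∧ b p.1 < p.2 ∧ p.2 < b p.1 + d p.1} := by
  have hb := continuous_affineMap b
  have hd := continuous_affineMap d
  have h1 : IsOpen {p : Space N × ℝ | b p.1 < p.2} :=
    isOpen_lt (hb.comp continuous_fst) continuous_snd
  have h2 : IsOpen {p : Space N × ℝ | p.2 < b p.1 + d p.1} :=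
    isOpen_lt continuous_snd ((hb.comp continuous_fst).add (hd.comp continuous_fst))
  exact (hO.preimage continuous_fst).inter (h1.inter h2)

/-- A tensor product test function on the cylinder, transported to the tent. -/
def tentTest (χ : Space N → ℝ) (κ : ℝ → ℝ) (p : Space N × ℝ) : ℝ :=
  χ p.1 * κ ((p.2 - b p.1) / d p.1)

variable {O : Set (Space N)} {χ : Space N → ℝ} {κ : ℝ → ℝ}

/-- The quotient is singular where `d` vanishes, but near points over the complement of `O` the
factor `χ` is identically zero. -/
theorem contDiff_tentTest (hd : ∀ x ∈ O, 0 < d x) (hχ : ContDiff ℝ ∞ χ)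
    (hχO : tsupport χ ⊆ O) (hκ : ContDiff ℝ ∞ κ) : ContDiff ℝ ∞ (tentTest b d χ κ) := by
  rw [contDiff_iff_contDiffAt]
  intro p
  by_cases hp : p.1 ∈ O
  · have h1 : ContDiffAt ℝ ∞ (fun p : Space N × ℝ => (p.2 - b p.1) / d p.1) p := by
      refine ContDiffAt.div ?_ ?_ (hd _ hp).ne'
      · exact (contDiff_snd.sub ((contDiff_affineMap b).comp contDiff_fst)).contDiffAt
      · exact ((contDiff_affineMap d).comp contDiff_fst).contDiffAt
    exact (hχ.comp contDiff_fst).contDiffAt.mul (hκ.contDiffAt.comp p h1)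
  · have h1 : p ∈ Prod.fst ⁻¹' (tsupport χ)ᶜ := fun h => hp (hχO h)
    have h2 : IsOpen (Prod.fst ⁻¹' (tsupport χ)ᶜ : Set (Space N × ℝ)) :=
      (isClosed_tsupport χ).isOpen_compl.preimage continuous_fst
    refine (contDiffAt_const (c := (0 : ℝ))).congr_of_eventuallyEq ?_
    filter_upwards [h2.mem_nhds h1] with q hq
    rw [tentTest, image_eq_zero_of_notMem_tsupport hq, zero_mul]

theorem tsupport_tentTest_subset (hd : ∀ x ∈ O, 0 < d x) (hχO : tsupport χ ⊆ O)
    (hχc : HasCompactSupport χ) (hκc : HasCompactSupport κ) :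
    tsupport (tentTest b d χ κ) ⊆ cylinderMap b d '' (tsupport χ ×ˢ tsupport κ) := by
  have hK : IsCompact (cylinderMap b d '' (tsupport χ ×ˢ tsupport κ)) :=
    (hχc.isCompact.prod hκc.isCompact).image (continuous_cylinderMap b d)
  refine closure_minimal ?_ hK.isClosed
  rintro ⟨x, t⟩ hp
  have h1 : χ x * κ ((t - b x) / d x) ≠ 0 := hp
  have h2 : x ∈ tsupport χ := subset_tsupport _ (left_ne_zero_of_mul h1)
  have h3 : (t - b x) / d x ∈ tsupport κ := subset_tsupport _ (right_ne_zero_of_mul h1)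
  refine ⟨(x, (t - b x) / d x), ⟨h2, h3⟩, ?_⟩
  simp only [cylinderMap, Prod.mk.injEq, true_and]
  rw [div_mul_cancel₀ _ (hd x (hχO h2)).ne']; ring

/-- In cylinder coordinates the test function is the product of `χ` and `κ`, so the chain rule gives
its derivative along every vector in the range of `cylinderDeriv`. -/
theorem fderiv_tentTest_comp (hO : IsOpen O) (hd : ∀ x ∈ O, 0 < d x) (hχ : ContDiff ℝ ∞ χ)
    (hχO : tsupport χ ⊆ O) (hκ : ContDiff ℝ ∞ κ) {x : Space N} (hx : x ∈ O) (τ : ℝ)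
    (v : Space N × ℝ) :
    fderiv ℝ (tentTest b d χ κ) (cylinderMap b d (x, τ)) (cylinderDeriv b d (x, τ) v) =
      fderiv ℝ χ x v.1 * κ τ + χ x * (deriv κ τ * v.2) := by
  have h1 := ((contDiff_tentTest b d hd hχ hχO hκ).differentiable (by simp)
    (cylinderMap b d (x, τ))).hasFDerivAt
  have h2 := h1.comp (x, τ) (hasFDerivAt_cylinderMap b d (x, τ))
  have hloc : (tentTest b d χ κ ∘ cylinderMap b d) =ᶠ[𝓝 (x, τ)] fun p => χ p.1 * κ p.2 := by
    have : Prod.fst ⁻¹' O ∈ 𝓝 (x, τ) := (hO.preimage continuous_fst).mem_nhds hx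
    filter_upwards [this] with p hp
    simp only [Function.comp_apply, tentTest, cylinderMap, add_sub_cancel_left]
    rw [mul_div_cancel_right₀ _ (hd _ hp).ne']
  have h3 := h2.congr_of_eventuallyEq hloc.symm
  have h4 : HasFDerivAt (fun p : Space N × ℝ => χ p.1)
      ((fderiv ℝ χ x).comp (ContinuousLinearMap.fst ℝ (Space N) ℝ)) (x, τ) :=
    ((hχ.differentiable (by simp) x).hasFDerivAt).comp (x, τ) hasFDerivAt_fst
  have h5 : HasFDerivAt (fun p : Space N × ℝ => κ p.2)
      ((fderiv ℝ κ τ).comp (ContinuousLinearMap.snd ℝ (Space N) ℝ)) (x, τ) :=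
    ((hκ.differentiable (by simp) τ).hasFDerivAt).comp (x, τ) hasFDerivAt_snd
  have h6 := congrArg (fun l => l v) (h3.unique (h4.mul h5))
  simp only [ContinuousLinearMap.comp_apply, add_apply, smul_apply, smul_eq_mul,
    ContinuousLinearMap.coe_fst', ContinuousLinearMap.coe_snd'] at h6
  rw [h6]
  rw [fderiv_eq_deriv_mul]; ring

end Cylinder
open SpatialMesh

/-! ### A weak formulation in time -/

/-- If `m' = n` holds weakly in `(0, 1)`, it holds pointwise. -/
theorem deriv_eq_of_weak {m m' n : ℝ → ℝ} (hm : ContinuousOn m (Icc 0 1))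
    (hmd : ∀ τ ∈ Ioo (0 : ℝ) 1, HasDerivAt m (m' τ) τ) (hm' : ContinuousOn m' (Icc 0 1))
    (hn : ContinuousOn n (Icc 0 1))
    (h : ∀ κ : ℝ → ℝ, ContDiff ℝ ∞ κ → HasCompactSupport κ → tsupport κ ⊆ Ioo 0 1 →
      ∫ τ in Ioo (0 : ℝ) 1, (deriv κ τ * m τ + κ τ * n τ) = 0) {τ : ℝ} (hτ : τ ∈ Ioo (0 : ℝ) 1) :
    m' τ = n τ := by
  have hint : ∀ f : ℝ → ℝ, ContinuousOn f (Icc 0 1) → IntegrableOn f (Ioo 0 1) := fun f hf =>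
    (hf.integrableOn_compact isCompact_Icc).mono_set Ioo_subset_Icc_self
  have hsub : ContinuousOn (fun τ => m' τ - n τ) (Icc 0 1) := hm'.sub hn
  have hz : ∀ᵐ τ, τ ∈ Ioo (0 : ℝ) 1 → m' τ - n τ = 0 := by
    refine isOpen_Ioo.ae_eq_zero_of_integral_contDiff_smul_eq_zero
      ((hint _ hsub).locallyIntegrableOn) fun κ hκ hκc hκs => ?_
    have hκ0 : ∀ t, t ∉ Ioo (0 : ℝ) 1 → κ t = 0 := fun t ht =>
      image_eq_zero_of_notMem_tsupport fun h => ht (hκs h)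
    have hdκ : Continuous (deriv κ) := hκ.continuous_deriv (by simp)
    have h1 : ∫ τ, κ τ • (m' τ - n τ) = ∫ τ in Ioo (0 : ℝ) 1, κ τ • (m' τ - n τ) := by
      rw [setIntegral_eq_integral_of_forall_compl_eq_zero]
      intro t ht
      rw [hκ0 t ht, zero_smul]
    -- Integration by parts moves the derivative from `κ` to `m`, so `κ * (m' - n)` has integral
    -- zero. This gives equality almost everywhere, and continuity gives it at every time.
    have h2 : ∫ τ in Ioo (0 : ℝ) 1, (deriv κ τ * m τ + κ τ * m' τ) = 0 := by
      have h3 := intervalIntegral.integral_eq_sub_of_hasDerivAt_of_le (f := fun τ => κ τ * m τ)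
        (f' := fun τ => deriv κ τ * m τ + κ τ * m' τ) zero_le_one
        (hκ.continuous.continuousOn.mul hm)
        (fun τ hτ => ((hκ.differentiable (by simp) τ).hasDerivAt).mul (hmd τ hτ))
        (by
          refine ContinuousOn.intervalIntegrable ?_
          rw [uIcc_of_le zero_le_one]
          exact (hdκ.continuousOn.mul hm).add (hκ.continuous.continuousOn.mul hm'))
      rw [intervalIntegral.integral_of_le zero_le_one, integral_Ioc_eq_integral_Ioo] at h3
      rw [h3, hκ0 1 (by simp), hκ0 0 (by simp)]
      ring
    have h4 := integral_sub
      (hint _ ((hdκ.continuousOn.mul hm).add (hκ.continuous.continuousOn.mul hm')))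
      (hint _ ((hdκ.continuousOn.mul hm).add (hκ.continuous.continuousOn.mul hn)))
    simp only [Pi.add_apply, Pi.mul_apply] at h4
    rw [h2, h κ hκ hκc hκs, sub_zero] at h4
    refine (h1.trans ?_).trans h4
    refine integral_congr_ae (Eventually.of_forall fun t => ?_)
    simp only [smul_eq_mul]
    ring
  have h1 : (fun τ => m' τ - n τ) =ᵐ[volume.restrict (Ioo 0 1)] fun _ => (0 : ℝ) :=
    (ae_restrict_iff' measurableSet_Ioo).mpr hz
  have h2 := Measure.eqOn_open_of_ae_eq h1 isOpen_Ioo (hsub.mono Ioo_subset_Icc_self)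
    continuousOn_const hτ
  exact sub_eq_zero.mp h2

/-! ### Quadratic forms on `L²` -/

/-- `(w, z) ↦ ∫ κ A w · z` over an element is a bounded bilinear form on `L²`. -/
theorem exists_elementForm {N L : ℕ} {mesh : SpatialMesh N} {U : Set (Space N)}
    {s : mesh.Element} (hs : interior s.cell ⊆ U) (A : Matrix (Fin L) (Fin L) ℝ) {κ : Space N → ℝ}
    (hκ : Continuous κ) :
    ∃ B : Lp (State L) 2 (volume.restrict U) →L[ℝ] Lp (State L) 2 (volume.restrict U) →L[ℝ] ℝ,
      ∀ w z, B w z = ∫ x in interior s.cell, κ x * matForm A (w x) (z x) := by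
  have hmem : ∀ w : Lp (State L) 2 (volume.restrict U),
      MemLp w 2 (volume.restrict (interior s.cell)) := fun w =>
    (Lp.memLp w).mono_measure (Measure.restrict_mono hs le_rfl)
  have hint := fun w z : Lp (State L) 2 (volume.restrict U) =>
    integrable_bilin_cell (s := s) A hκ (hmem w) (hmem z)
  have habs : volume.restrict (interior s.cell) ≤ volume.restrict U := Measure.restrict_mono hs le_rfl
  obtain ⟨C, hC⟩ := exists_ae_bound_cell (s := s) hκ
  have hC' : ∀ᵐ x ∂((volume : Measure (Space N)).restrict (interior s.cell)), ‖κ x‖ ≤ |C| :=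
    hC.mono fun x hx => hx.trans (le_abs_self C)
  refine ⟨LinearMap.mkContinuous₂ (LinearMap.mk₂ ℝ
    (fun w z => ∫ x in interior s.cell, κ x * matForm A (w x) (z x)) ?_ ?_ ?_ ?_)
    (|C| * ‖matForm A‖) ?_, fun w z => rfl⟩
  · intro w w' z
    rw [← integral_add (hint w z) (hint w' z)]
    refine integral_congr_ae ?_
    filter_upwards [(Lp.coeFn_add w w').filter_mono (ae_mono habs)] with x hx
    rw [hx, Pi.add_apply, map_add, add_apply, mul_add]
  · intro c w z
    rw [smul_eq_mul, ← integral_const_mul]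
    refine integral_congr_ae ?_
    filter_upwards [(Lp.coeFn_smul c w).filter_mono (ae_mono habs)] with x hx
    rw [hx, Pi.smul_apply, map_smul, smul_apply, smul_eq_mul]
    ring
  · intro w z z'
    rw [← integral_add (hint w z) (hint w z')]
    refine integral_congr_ae ?_
    filter_upwards [(Lp.coeFn_add z z').filter_mono (ae_mono habs)] with x hx
    rw [hx, Pi.add_apply, map_add, mul_add]
  · intro c w z
    rw [smul_eq_mul, ← integral_const_mul]
    refine integral_congr_ae ?_
    filter_upwards [(Lp.coeFn_smul c z).filter_mono (ae_mono habs)] with x hx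
    rw [hx, Pi.smul_apply, map_smul, smul_eq_mul]
    ring
  · intro w z
    rw [LinearMap.mk₂_apply]
    have h1 := eLpNorm_bilin_le (matForm A) hC' (hmem w).1 (hmem z).1
    have h2 : ENNReal.ofReal |C| * (‖matForm A‖₊ * eLpNorm w 2 (volume.restrict (interior s.cell)) *
        eLpNorm z 2 (volume.restrict (interior s.cell))) ≤
        ENNReal.ofReal |C| * (‖matForm A‖₊ * eLpNorm w 2 (volume.restrict U) *
        eLpNorm z 2 (volume.restrict U)) := by
      gcongr
    have h3 := ENNReal.toReal_mono (by
      exact ENNReal.mul_ne_top ENNReal.ofReal_ne_top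
        (ENNReal.mul_ne_top (ENNReal.mul_ne_top (by simp) (Lp.eLpNorm_ne_top w))
          (Lp.eLpNorm_ne_top z))) (h1.trans h2)
    rw [ENNReal.toReal_mul, ENNReal.toReal_mul, ENNReal.toReal_mul,
      ENNReal.toReal_ofReal (abs_nonneg C), ← Lp.norm_def, ← Lp.norm_def] at h3
    refine (norm_integral_le_integral_norm _).trans ?_
    rw [integral_norm_eq_lintegral_enorm (hint w z).1, ← eLpNorm_one_eq_lintegral_enorm]
    refine h3.trans (le_of_eq ?_)
    simp only [ENNReal.coe_toReal, coe_nnnorm]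
    ring

/-- The inclusion of `H¹` into `L²`. -/
def H1.funcL {N L : ℕ} {U : Set (Space N)} :
    H1 U L →L[ℝ] Lp (State L) 2 (volume.restrict U) :=
  (PiLp.proj 2 (𝕜 := ℝ) (fun _ : Option (Fin N) => Lp (State L) 2 (volume.restrict U)) none).comp
    (H1 U L).subtypeL

open SpatialMesh

namespace Tent
variable {N L : ℕ} {mesh : SpatialMesh N} (T : Tent mesh) (sys : HyperbolicSystem mesh L)
  {s : mesh.Element}

/-! ### The equation on the cylinder -/

/-- The value of `M₀` on an element. -/
def elemM0 (s : mesh.Element) : Matrix (Fin L) (Fin L) ℝ :=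
  sys.G s - ∑ j, (T.botAff s).linear (basisVec j) • sys.A j s

/-- The value of `M₁` on an element. -/
def elemM1 (s : mesh.Element) : Matrix (Fin L) (Fin L) ℝ :=
  ∑ j, (T.deltaAff s).linear (basisVec j) • sys.A j s

theorem isClosed_region : IsClosed T.region := by
  have hp : IsClosed {p : Space N × ℝ | p.1 ∈ T.patch} :=
    T.isCompact_patch.isClosed.preimage continuous_fst
  have hb : ContinuousOn (fun p : Space N × ℝ => T.bot p.1) {p | p.1 ∈ T.patch} :=
    ContinuousOn.comp T.bot_continuous continuous_fst.continuousOn fun p hp => hp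
  have ht : ContinuousOn (fun p : Space N × ℝ => T.top p.1) {p | p.1 ∈ T.patch} :=
    ContinuousOn.comp T.top_continuous continuous_fst.continuousOn fun p hp => hp
  have h1 := hp.isClosed_le hb continuous_snd.continuousOn
  have h2 := hp.isClosed_le continuous_snd.continuousOn ht
  convert h1.inter h2 using 1
  ext p
  constructor
  · rintro ⟨h, h', h''⟩
    exact ⟨⟨h, h'⟩, ⟨h, h''⟩⟩
  · rintro ⟨⟨h, h'⟩, ⟨_, h''⟩⟩
    exact ⟨h, h', h''⟩

/-- The image of the open cylinder over an element lies in the interior of the tent. -/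
theorem cylinderMap_image_subset (hs : T.v ∈ s.1) :
    cylinderMap (T.botAff s) (T.deltaAff s) '' (interior s.cell ×ˢ Ioo (0 : ℝ) 1) ⊆
      interior T.region := by
  rw [cylinderMap_image _ _ fun x hx => T.deltaAff_pos hs hx]
  refine interior_maximal ?_ (isOpen_prism _ _ isOpen_interior)
  rintro ⟨x, t⟩ ⟨hx, h1, h2⟩
  have hx' := interior_subset hx
  refine ⟨T.cell_subset_patch hs hx', ?_, ?_⟩
  · show T.bot x ≤ t
    rw [T.eqOn_bot hs hx']
    exact le_of_lt h1
  · show t ≤ T.top x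
    rw [T.eqOn_top hs hx']
    exact le_of_lt h2

theorem sum_matForm_apply {ι : Type*} (f : Finset ι) (c : ι → ℝ)
    (A : ι → Matrix (Fin L) (Fin L) ℝ) (y e : State L) :
    matForm (∑ i ∈ f, c i • A i) y e = ∑ i ∈ f, c i * matForm (A i) y e := by
  simp [matForm_sum, matForm_smul, sum_apply]

/-- The integrand of the weak formulation in tent coordinates. -/
def cylinderIntegrand (s : mesh.Element) (u : Space N × ℝ → State L) (e : State L)
    (χ : Space N → ℝ) (κ : ℝ → ℝ) (p : Space N × ℝ) : ℝ :=
  deriv κ p.2 * (χ p.1 * matForm (T.elemM0 sys s - p.2 • T.elemM1 sys s)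
    (u (cylinderMap (T.botAff s) (T.deltaAff s) p)) e) +
  κ p.2 * ∑ j, T.deltaAff s p.1 * fderiv ℝ χ p.1 (basisVec j) *
    matForm (sys.A j s) (u (cylinderMap (T.botAff s) (T.deltaAff s) p)) e

variable {χ : Space N → ℝ} {κ : ℝ → ℝ}

/-- This is where `M(τ)` appears. The vector `(0, 1)` times δ is the image of `(0, 1)`, and
`(basisVec j, 0)` is the image of `basisVec j` with time component `-∂_j φ / δ`. Multiplying by the
Jacobian δ removes the denominators and collects `𝒢 - ∑ (∂_j φ) ℒ^j` in front of the time
derivative. -/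
theorem det_smul_integrand (hs : T.v ∈ s.1) (u : Space N × ℝ → State L) (e : State L)
    (hχ : ContDiff ℝ ∞ χ) (hχO : tsupport χ ⊆ interior s.cell) (hκ : ContDiff ℝ ∞ κ)
    {p : Space N × ℝ} (hp : p.1 ∈ interior s.cell) :
    T.deltaAff s p.1 *
      (matForm (sys.G s) (u (cylinderMap (T.botAff s) (T.deltaAff s) p)) e *
          fderiv ℝ (tentTest (T.botAff s) (T.deltaAff s) χ κ)
            (cylinderMap (T.botAff s) (T.deltaAff s) p) (0, 1) +
        ∑ j, matForm (sys.A j s) (u (cylinderMap (T.botAff s) (T.deltaAff s) p)) e *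
          fderiv ℝ (tentTest (T.botAff s) (T.deltaAff s) χ κ)
            (cylinderMap (T.botAff s) (T.deltaAff s) p) (basisVec j, 0)) =
      T.cylinderIntegrand sys s u e χ κ p := by
  obtain ⟨x, τ⟩ := p
  have hd0 : T.deltaAff s x ≠ 0 := (T.deltaAff_pos hs hp).ne'
  have key := fderiv_tentTest_comp (T.botAff s) (T.deltaAff s) isOpen_interior
    (fun x hx => T.deltaAff_pos hs hx) hχ hχO hκ hp τ
  set D := fderiv ℝ (tentTest (T.botAff s) (T.deltaAff s) χ κ)
    (cylinderMap (T.botAff s) (T.deltaAff s) (x, τ)) with hD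
  set y := u (cylinderMap (T.botAff s) (T.deltaAff s) (x, τ)) with hy
  have ht : T.deltaAff s x * D (0, 1) = χ x * deriv κ τ := by
    have h1 : cylinderDeriv (T.botAff s) (T.deltaAff s) (x, τ) (0, 1) =
        T.deltaAff s x • ((0 : Space N), (1 : ℝ)) := by
      rw [cylinderDeriv_apply]
      simp
    have h2 := key (0, 1)
    rw [h1, map_smul, smul_eq_mul] at h2
    rw [h2]
    simp
  have hj : ∀ j, T.deltaAff s x * D (basisVec j, 0) =
      T.deltaAff s x * fderiv ℝ χ x (basisVec j) * κ τ - χ x * deriv κ τ *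
        ((T.botAff s).linear (basisVec j) + τ * (T.deltaAff s).linear (basisVec j)) := by
    intro j
    set w : ℝ := -((T.botAff s).linear (basisVec j) + τ * (T.deltaAff s).linear (basisVec j)) /
      T.deltaAff s x with hw
    have h1 : cylinderDeriv (T.botAff s) (T.deltaAff s) (x, τ) (basisVec j, w) =
        ((basisVec j : Space N), (0 : ℝ)) := by
      rw [cylinderDeriv_apply]
      refine Prod.ext rfl ?_
      show (T.botAff s).linear (basisVec j) + (τ * (T.deltaAff s).linear (basisVec j) +
        T.deltaAff s x * w) = 0
      rw [hw, mul_div_cancel₀ _ hd0]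
      ring
    have h2 := key (basisVec j, w)
    rw [h1] at h2
    rw [h2]
    have h3 : T.deltaAff s x * w = -((T.botAff s).linear (basisVec j) +
        τ * (T.deltaAff s).linear (basisVec j)) := by
      rw [hw, mul_div_cancel₀ _ hd0]
    linear_combination χ x * deriv κ τ * h3
  have hM : matForm (T.elemM0 sys s - τ • T.elemM1 sys s) y e = matForm (sys.G s) y e -
      ∑ j, ((T.botAff s).linear (basisVec j) + τ * (T.deltaAff s).linear (basisVec j)) *
        matForm (sys.A j s) y e := by
    rw [elemM0, elemM1, Finset.smul_sum, sub_sub, ← Finset.sum_add_distrib, sub_eq_add_neg,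
      matForm_add, ← neg_one_smul ℝ, matForm_smul]
    simp_rw [smul_smul, ← add_smul]
    rw [add_apply, add_apply, smul_apply, smul_apply, sum_matForm_apply]
    simp [sub_eq_add_neg]
  rw [cylinderIntegrand, hM, mul_add, Finset.mul_sum, Finset.mul_sum, mul_sub, mul_sub,
    Finset.mul_sum, Finset.mul_sum]
  have h5 : ∀ j, T.deltaAff s x * (matForm (sys.A j s) y e * D (basisVec j, 0)) =
      matForm (sys.A j s) y e * (T.deltaAff s x * fderiv ℝ χ x (basisVec j) * κ τ - χ x * deriv κ τ *
        ((T.botAff s).linear (basisVec j) + τ * (T.deltaAff s).linear (basisVec j))) := by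
    intro j
    rw [← hj]; ring
  have h6 : T.deltaAff s x * (matForm (sys.G s) y e * D (0, 1)) =
      matForm (sys.G s) y e * (χ x * deriv κ τ) := by
    rw [← ht]; ring
  simp only [h5, h6]
  rw [sub_add_eq_add_sub, add_sub_assoc, ← Finset.sum_sub_distrib]
  congr 1
  · ring
  · exact Finset.sum_congr rfl fun j _ => by ring

/-- The weak formulation in tent coordinates. -/
theorem cylinder_equation {u : Space N × ℝ → State L} (hsol : T.IsSolution sys u)
    (hs : T.v ∈ s.1) (e : State L)
    (hχ : ContDiff ℝ ∞ χ) (hχc : HasCompactSupport χ) (hχO : tsupport χ ⊆ interior s.cell)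
    (hκ : ContDiff ℝ ∞ κ) (hκc : HasCompactSupport κ) (hκI : tsupport κ ⊆ Ioo 0 1) :
    IntegrableOn (T.cylinderIntegrand sys s u e χ κ) (interior s.cell ×ˢ Ioo (0 : ℝ) 1) ∧
      ∫ p in interior s.cell ×ˢ Ioo (0 : ℝ) 1, T.cylinderIntegrand sys s u e χ κ p = 0 := by
  set b := T.botAff s with hb
  set d := T.deltaAff s with hd
  have hdpos : ∀ x ∈ interior s.cell, 0 < d x := fun x hx => T.deltaAff_pos hs hx
  set C : Set (Space N × ℝ) := interior s.cell ×ˢ Ioo (0 : ℝ) 1 with hC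
  have hCm : MeasurableSet C := isOpen_interior.measurableSet.prod measurableSet_Ioo
  set K : Set (Space N × ℝ) := cylinderMap b d '' (tsupport χ ×ˢ tsupport κ) with hK
  have hKc : IsCompact K := (hχc.isCompact.prod hκc.isCompact).image (continuous_cylinderMap b d)
  have hKC : K ⊆ cylinderMap b d '' C := image_mono (prod_mono hχO hκI)
  have hCreg : cylinderMap b d '' C ⊆ interior T.region := T.cylinderMap_image_subset hs
  have hCo : IsOpen (cylinderMap b d '' C) := by
    rw [hC, cylinderMap_image b d hdpos]
    exact isOpen_prism b d isOpen_interior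
  set θ := tentTest b d χ κ with hθ
  have hθd : ContDiff ℝ ∞ θ := contDiff_tentTest b d hdpos hχ hχO hκ
  have hθK : tsupport θ ⊆ K := tsupport_tentTest_subset b d hdpos hχO hχc hκc
  have hθ0 : ∀ p ∉ K, fderiv ℝ θ p = 0 := fun p hp =>
    image_eq_zero_of_notMem_tsupport fun h => hp (hθK (tsupport_fderiv_subset ℝ h))
  set F : Space N × ℝ → ℝ := fun p => matForm (sys.G s) (u p) e * fderiv ℝ θ p (0, 1) +
    ∑ j, matForm (sys.A j s) (u p) e * fderiv ℝ θ p (basisVec j, 0) with hF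
  have hF0 : ∀ p ∉ K, F p = 0 := by
    intro p hp
    simp [hF, hθ0 p hp]
  have huK : IntegrableOn u K :=
    -- The solution is only locally integrable inside the tent, so integrability is first obtained
    -- on the compact image `K` of the supports; off `K` the derivatives of the test function
    -- vanish.
    hsol.1.integrableOn_compact_subset (hKC.trans hCreg) hKc
  have hterm : ∀ (A : Matrix (Fin L) (Fin L) ℝ) (w : Space N × ℝ),
      IntegrableOn (fun p => matForm A (u p) e * fderiv ℝ θ p w) K := by
    intro A w
    have h1 : IntegrableOn (fun p => matForm A (u p) e) K :=
      ((matForm A).flip e).integrable_comp huK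
    exact h1.mul_continuousOn
      ((hθd.continuous_fderiv (by simp)).clm_apply continuous_const).continuousOn hKc
  have hFK : IntegrableOn F K := (hterm _ _).add (integrable_finsetSum _ fun j _ => hterm _ _)
  have hFC : IntegrableOn F (cylinderMap b d '' C) :=
    hFK.of_forall_sdiff_eq_zero hCo.measurableSet fun p hp => hF0 p hp.2
  have hder : ∀ p ∈ C, HasFDerivWithinAt (cylinderMap b d) (cylinderDeriv b d p) C p :=
    fun p _ => (hasFDerivAt_cylinderMap b d p).hasFDerivWithinAt
  have hinj : InjOn (cylinderMap b d) C := injOn_cylinderMap b d hdpos _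
  have hcov : ∀ p ∈ C, |(cylinderDeriv b d p).det| • F (cylinderMap b d p) =
      T.cylinderIntegrand sys s u e χ κ p := by
    intro p hp
    rw [det_cylinderDeriv, abs_of_pos (hdpos _ hp.1), smul_eq_mul]
    exact T.det_smul_integrand sys hs u e hχ hχO hκ hp.1
  have hHaar : (volume : Measure (Space N × ℝ)).IsAddHaarMeasure :=
    inferInstanceAs ((volume : Measure (Space N)).prod (volume : Measure ℝ)).IsAddHaarMeasure
  refine ⟨?_, ?_⟩
  · refine ((integrableOn_image_iff_integrableOn_abs_det_fderiv_smul volume hCm hder hinj F).mp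
      hFC).congr_fun hcov hCm
  · rw [← setIntegral_congr_fun hCm hcov,
      ← integral_image_eq_integral_abs_det_fderiv_smul volume hCm hder hinj F]
    have hψ : ∀ p w, fderiv ℝ (fun p => θ p • e) p w = fderiv ℝ θ p w • e := by
      intro p w
      rw [((hθd.differentiable (by simp) p).hasFDerivAt.smul_const e).fderiv]
      rfl
    have hsupp : tsupport (fun p => θ p • e) ⊆ tsupport θ :=
      closure_mono fun p hp hp' => hp (by simp only [hp', zero_smul])
    have h0 := hsol.2 (fun p => θ p • e) (hθd.smul contDiff_const)
      (hKc.of_isClosed_subset (isClosed_tsupport _) (hsupp.trans hθK))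
      (hsupp.trans (hθK.trans (hKC.trans hCreg)))
    rw [← h0, eq_comm]
    rw [setIntegral_eq_of_subset_of_forall_sdiff_eq_zero T.isClosed_region.measurableSet
      (hCreg.trans interior_subset)]
    · refine setIntegral_congr_fun hCo.measurableSet fun p hp => ?_
      obtain ⟨q, hq, rfl⟩ := hp
      have hx : (cylinderMap b d q).1 ∈ interior s.cell := hq.1
      set p := cylinderMap b d q
      simp only [hψ, hF]
      congr 1
      · rw [HyperbolicSystem.g, Element.field_eq _ hx, matForm_apply]
        simp [mul_comm]
      · refine Finset.sum_congr rfl fun j _ => ?_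
        have h1 : (sys.f p.1 (u p)).col j = sys.A j s *ᵥ (u p).ofLp := by
          ext l
          simp only [HyperbolicSystem.f, Matrix.col_apply, Matrix.of_apply, Element.field_eq _ hx]
        rw [h1, matForm_apply]
        simp [mul_comm]
    · intro p hp
      have h1 : p ∉ K := fun h => hp.2 (hKC h)
      simp [hψ, hθ0 p h1]

end Tent
open SpatialMesh

/-- `w ↦ ∫ κ A w · e` over an element is a bounded linear functional on `L²`. -/
theorem exists_elementFunctional {N L : ℕ} {mesh : SpatialMesh N} {U : Set (Space N)}
    (hU : volume U ≠ ⊤) {s : mesh.Element} (hs : interior s.cell ⊆ U)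
    (A : Matrix (Fin L) (Fin L) ℝ) {κ : Space N → ℝ} (hκ : Continuous κ) (e : State L) :
    ∃ l : Lp (State L) 2 (volume.restrict U) →L[ℝ] ℝ,
      ∀ w, l w = ∫ x in interior s.cell, κ x * matForm A (w x) e := by
  have hfin : IsFiniteMeasure ((volume : Measure (Space N)).restrict U) :=
    ⟨by rw [Measure.restrict_apply_univ]; exact hU.lt_top⟩
  obtain ⟨B, hB⟩ := exists_elementForm hs A hκ
  refine ⟨B.flip (Lp.const 2 (volume.restrict U) e), fun w => ?_⟩
  rw [ContinuousLinearMap.flip_apply, hB]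
  refine integral_congr_ae ?_
  filter_upwards [(Lp.coeFn_const (p := 2) (μ := volume.restrict U) e).filter_mono
    (ae_mono (Measure.restrict_mono hs le_rfl))] with x hx
  rw [hx, Function.const_apply]

namespace Tent
variable {N L : ℕ} {mesh : SpatialMesh N} (T : Tent mesh) (sys : HyperbolicSystem mesh L)
  {s : mesh.Element} {χ : Space N → ℝ} {κ : ℝ → ℝ}

theorem volume_interior_patch_ne_top : volume (interior T.patch) ≠ ⊤ :=
  ((measure_mono interior_subset).trans_lt T.isCompact_patch.measure_lt_top).ne

theorem cylinderMap_eq_Phi (hs : T.v ∈ s.1) {x : Space N} (hx : x ∈ s.cell) (τ : ℝ) :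
    cylinderMap (T.botAff s) (T.deltaAff s) (x, τ) = T.Phi (x, τ) := by
  rw [Phi, phi, cylinderMap, T.eqOn_bot hs hx, T.eqOn_delta hs hx]

/-- The weak formulation for the curve `û`. -/
theorem weak_equation {u : Space N × ℝ → State L} (hsol : T.IsSolution sys u)
    {uhat : ℝ → H1 (interior T.patch) L}
    (hpull : ∀ τ ∈ Icc (0 : ℝ) 1, H1.func (uhat τ) =ᵐ[volume.restrict (interior T.patch)]
      fun x => u (T.Phi (x, τ)))
    (hs : T.v ∈ s.1) (e : State L)
    (hχ : ContDiff ℝ ∞ χ) (hχc : HasCompactSupport χ) (hχO : tsupport χ ⊆ interior s.cell)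
    (hκ : ContDiff ℝ ∞ κ) (hκc : HasCompactSupport κ) (hκI : tsupport κ ⊆ Ioo 0 1) :
    ∫ τ in Ioo (0 : ℝ) 1, (deriv κ τ * (∫ x in interior s.cell, χ x *
        matForm (T.elemM0 sys s - τ • T.elemM1 sys s) (H1.func (uhat τ) x) e) +
      κ τ * ∑ j, ∫ x in interior s.cell, T.deltaAff s x * fderiv ℝ χ x (basisVec j) *
        matForm (sys.A j s) (H1.func (uhat τ) x) e) = 0 := by
  obtain ⟨h1, h2⟩ := T.cylinder_equation sys hsol hs e hχ hχc hχO hκ hκc hκI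
  rw [Measure.volume_eq_prod, ← Measure.prod_restrict,
    integral_prod_symm _ (by rw [Measure.prod_restrict]; exact h1)] at h2
  refine Eq.trans ?_ h2
  refine setIntegral_congr_fun measurableSet_Ioo fun τ hτ => ?_
  have hsub := T.interior_cell_subset hs
  have hmem := H1.memLp_func (uhat τ) hsub
  have hd := continuous_affineMap (T.deltaAff s)
  have hdχ : ∀ j, Continuous fun x => T.deltaAff s x * fderiv ℝ χ x (basisVec j) := fun j =>
    hd.mul ((hχ.continuous_fderiv (by simp)).clm_apply continuous_const)
  have hc : MemLp (fun _ : Space N => e) 2 (volume.restrict (interior s.cell)) :=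
    memLp_interior_cell continuous_const 2
  beta_reduce
  rw [← integral_const_mul, ← integral_finsetSum _ fun j _ =>
    integrable_bilin_cell (sys.A j s) (hdχ j) hmem hc, ← integral_const_mul, ← integral_add]
  · refine integral_congr_ae ?_
    filter_upwards [(hpull τ (Ioo_subset_Icc_self hτ)).filter_mono
      (ae_mono (Measure.restrict_mono hsub le_rfl)),
      ae_restrict_mem isOpen_interior.measurableSet] with x hx hxs
    rw [cylinderIntegrand, T.cylinderMap_eq_Phi hs (interior_subset hxs), ← hx]
  · exact (integrable_bilin_cell _ hχ.continuous hmem hc).const_mul _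
  · exact (integrable_finsetSum _ fun j _ =>
      integrable_bilin_cell (sys.A j s) (hdχ j) hmem hc).const_mul _

/-- Integration by parts in an element against the height function of the tent. -/
theorem integral_delta_fderiv (hs : T.v ∈ s.1) (z : H1 (interior T.patch) L) (e : State L)
    (A : Matrix (Fin L) (Fin L) ℝ) (j : Fin N)
    (hχ : ContDiff ℝ ∞ χ) (hχc : HasCompactSupport χ) (hχO : tsupport χ ⊆ interior s.cell) :
    ∫ x in interior s.cell, T.deltaAff s x * fderiv ℝ χ x (basisVec j) *
        matForm A (H1.func z x) e =
      - ∫ x in interior s.cell, χ x *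
        ((T.deltaAff s).linear (basisVec j) * matForm A (H1.func z x) e +
          T.deltaAff s x * matForm A (H1.weakPartial j z x) e) := by
  have hsub := T.interior_cell_subset hs
  have hmem := H1.memLp_func z hsub
  have hmem' := H1.memLp_weakPartial z j hsub
  have hd := continuous_affineMap (T.deltaAff s)
  have hdχ : Continuous fun x => fderiv ℝ χ x (basisVec j) :=
    (hχ.continuous_fderiv (by simp)).clm_apply continuous_const
  have hc : MemLp (fun _ : Space N => e) 2 (volume.restrict (interior s.cell)) :=
    memLp_interior_cell continuous_const 2
  -- The weak derivative is tested with δχ; the product rule produces the additional term with the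
  -- constant slope of δ.
  set ψ : Space N → ℝ := fun x => T.deltaAff s x * χ x with hψ
  have hψd : ContDiff ℝ ∞ ψ := (contDiff_affineMap _).mul hχ
  have hψs : tsupport ψ ⊆ tsupport χ :=
    closure_mono fun x hx hx' => hx (by simp only [hψ, hx', mul_zero])
  have hψc : HasCompactSupport ψ := hχc.isCompact.of_isClosed_subset (isClosed_tsupport _) hψs
  have hψj : ∀ x, fderiv ℝ ψ x (basisVec j) =
      T.deltaAff s x * fderiv ℝ χ x (basisVec j) + χ x * (T.deltaAff s).linear (basisVec j) := by
    intro x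
    have h1 := ((hasFDerivAt_affineMap (T.deltaAff s) x).mul
      (hχ.differentiable (by simp) x).hasFDerivAt).fderiv
    have h2 : ψ = ⇑(T.deltaAff s) * χ := rfl
    rw [h2, h1]
    simp
  have h0 : ∫ x in interior T.patch, fderiv ℝ ψ x (basisVec j) • H1.func z x =
      - ∫ x in interior T.patch, ψ x • H1.weakPartial j z x :=
    z.2 j ψ hψd hψc (hψs.trans (hχO.trans hsub))
  have hψ0 : ∀ x, x ∉ interior s.cell → ψ x = 0 := fun x hx =>
    image_eq_zero_of_notMem_tsupport fun h => hx (hχO (hψs h))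
  have hψ0' : ∀ x, x ∉ interior s.cell → fderiv ℝ ψ x (basisVec j) = 0 := fun x hx => by
    have : fderiv ℝ ψ x = 0 := image_eq_zero_of_notMem_tsupport fun h =>
      hx (hχO (hψs (tsupport_fderiv_subset ℝ h)))
    rw [this, zero_apply]
  rw [setIntegral_eq_of_subset_of_forall_sdiff_eq_zero isOpen_interior.measurableSet hsub
      (fun x hx => by rw [hψ0' x hx.2, zero_smul]),
    setIntegral_eq_of_subset_of_forall_sdiff_eq_zero isOpen_interior.measurableSet hsub
      (fun x hx => by rw [hψ0 x hx.2, zero_smul])] at h0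
  have hi : ∀ {g : Space N → ℝ} {w : Space N → State L}, Continuous g →
      MemLp w 2 (volume.restrict (interior s.cell)) →
      Integrable (fun x => g x • w x) (volume.restrict (interior s.cell)) := by
    intro g w hg hw
    obtain ⟨C, hC⟩ := exists_ae_bound_cell (s := s) hg
    exact (hw.integrable (by norm_num)).bdd_smul C hg.aestronglyMeasurable hC
  have h3 := congrArg ((matForm A).flip e) h0
  rw [map_neg, ← ContinuousLinearMap.integral_comp_comm _
      (hi ((hψd.continuous_fderiv (by simp)).clm_apply continuous_const) hmem),
    ← ContinuousLinearMap.integral_comp_comm _ (hi hψd.continuous hmem')] at h3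
  simp only [map_smul, smul_eq_mul, ContinuousLinearMap.flip_apply, hψj] at h3
  have h4 : ∀ x, (T.deltaAff s x * fderiv ℝ χ x (basisVec j) +
      χ x * (T.deltaAff s).linear (basisVec j)) * matForm A (H1.func z x) e =
      T.deltaAff s x * fderiv ℝ χ x (basisVec j) * matForm A (H1.func z x) e +
      (T.deltaAff s).linear (basisVec j) * (χ x * matForm A (H1.func z x) e) := fun x => by ring
  have h5 : ∀ x, χ x * ((T.deltaAff s).linear (basisVec j) * matForm A (H1.func z x) e +
      T.deltaAff s x * matForm A (H1.weakPartial j z x) e) =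
      (T.deltaAff s).linear (basisVec j) * (χ x * matForm A (H1.func z x) e) +
      ψ x * matForm A (H1.weakPartial j z x) e := fun x => by simp only [hψ]; ring
  have i1 := integrable_bilin_cell (s := s) A (hd.mul hdχ) hmem hc
  have i2 := (integrable_bilin_cell (s := s) A hχ.continuous hmem hc).const_mul
    ((T.deltaAff s).linear (basisVec j))
  have i3 := integrable_bilin_cell (s := s) A hψd.continuous hmem' hc
  simp only [Pi.mul_apply] at i1
  simp only [h4] at h3
  simp only [h5]
  rw [integral_add i1 i2] at h3
  rw [integral_add i2 i3]
  linarith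

section Curve
variable {u : Space N × ℝ → State L} {uhat : ℝ → H1 (interior T.patch) L}

theorem hasDerivAt_curve {E : Type*} [NormedAddCommGroup E] [NormedSpace ℝ E] {w : ℝ → E}
    (hw : ContDiffOn ℝ 1 w (Icc 0 1)) {τ : ℝ} (hτ : τ ∈ Ioo (0 : ℝ) 1) :
    HasDerivAt w (derivWithin w (Icc 0 1) τ) τ :=
  ((hw.differentiableOn (by simp) τ (Ioo_subset_Icc_self hτ)).hasDerivWithinAt).hasDerivAt
    (Icc_mem_nhds hτ.1 hτ.2)

/-- The equation for `û`, tested with `χ e`. -/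
theorem integral_equation (hsol : T.IsSolution sys u)
    (huhat : ContDiffOn ℝ 1 uhat (Icc 0 1))
    (hpull : ∀ τ ∈ Icc (0 : ℝ) 1, H1.func (uhat τ) =ᵐ[volume.restrict (interior T.patch)]
      fun x => u (T.Phi (x, τ)))
    (hs : T.v ∈ s.1) (e : State L)
    (hχ : ContDiff ℝ ∞ χ) (hχc : HasCompactSupport χ) (hχO : tsupport χ ⊆ interior s.cell)
    {τ : ℝ} (hτ : τ ∈ Ioo (0 : ℝ) 1) :
    ∫ x in interior s.cell, χ x * (matForm (T.elemM0 sys s - τ • T.elemM1 sys s)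
        (H1.func (derivWithin uhat (Icc 0 1) τ) x) e +
      ∑ j, T.deltaAff s x * matForm (sys.A j s) (H1.weakPartial j (uhat τ) x) e) = 0 := by
  have hsub := T.interior_cell_subset hs
  have hd := continuous_affineMap (T.deltaAff s)
  have hdχ : ∀ j, Continuous fun x => T.deltaAff s x * fderiv ℝ χ x (basisVec j) := fun j =>
    hd.mul ((hχ.continuous_fderiv (by simp)).clm_apply continuous_const)
  have hc : MemLp (fun _ : Space N => e) 2 (volume.restrict (interior s.cell)) :=
    memLp_interior_cell continuous_const 2
  have hU := T.volume_interior_patch_ne_top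
  obtain ⟨l0, hl0⟩ := exists_elementFunctional hU hsub (T.elemM0 sys s) hχ.continuous e
  obtain ⟨l1, hl1⟩ := exists_elementFunctional hU hsub (T.elemM1 sys s) hχ.continuous e
  choose l hl using fun j => exists_elementFunctional hU hsub (sys.A j s) (hdχ j) e
  have hl01 : ∀ (σ : ℝ) (z : H1 (interior T.patch) L), l0 (H1.func z) - σ * l1 (H1.func z) =
      ∫ x in interior s.cell, χ x *
        matForm (T.elemM0 sys s - σ • T.elemM1 sys s) (H1.func z x) e := by
    intro σ z
    have i0 := integrable_bilin_cell (s := s) (T.elemM0 sys s) hχ.continuous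
      (H1.memLp_func z hsub) hc
    have i1 := integrable_bilin_cell (s := s) (T.elemM1 sys s) hχ.continuous
      (H1.memLp_func z hsub) hc
    rw [hl0, hl1, ← integral_const_mul, ← integral_sub i0 (i1.const_mul σ)]
    refine integral_congr_ae (Eventually.of_forall fun x => ?_)
    beta_reduce
    rw [sub_eq_add_neg (T.elemM0 sys s), ← neg_smul, matForm_add, matForm_smul, add_apply,
      add_apply, smul_apply, smul_apply, smul_eq_mul]
    ring
  set u' := derivWithin uhat (Icc 0 1) with hu'
  have hcont : ContinuousOn (fun τ => H1.func (uhat τ)) (Icc 0 1) :=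
    H1.funcL.continuous.comp_continuousOn huhat.continuousOn
  have hcont' : ContinuousOn (fun τ => H1.func (u' τ)) (Icc 0 1) :=
    H1.funcL.continuous.comp_continuousOn
      (huhat.continuousOn_derivWithin (uniqueDiffOn_Icc zero_lt_one) le_rfl)
  have hder : ∀ τ ∈ Ioo (0 : ℝ) 1, HasDerivAt (fun τ => H1.func (uhat τ)) (H1.func (u' τ)) τ :=
    fun τ hτ => H1.funcL.hasFDerivAt.comp_hasDerivAt τ (hasDerivAt_curve huhat hτ)
  -- Pairing with `χ e` turns the equation into a scalar one. The three functionals are continuous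
  -- on L², so the C¹ regularity of the curve makes the weak time derivative an ordinary one.
  have key := deriv_eq_of_weak
    (m := fun τ => l0 (H1.func (uhat τ)) - τ * l1 (H1.func (uhat τ)))
    (m' := fun τ => l0 (H1.func (u' τ)) -
      (1 * l1 (H1.func (uhat τ)) + τ * l1 (H1.func (u' τ))))
    (n := fun τ => ∑ j, l j (H1.func (uhat τ)))
    ((l0.continuous.comp_continuousOn hcont).sub
      (continuousOn_id.mul (l1.continuous.comp_continuousOn hcont)))
    (fun τ hτ => (l0.hasFDerivAt.comp_hasDerivAt τ (hder τ hτ)).sub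
      ((hasDerivAt_id τ).mul (l1.hasFDerivAt.comp_hasDerivAt τ (hder τ hτ))))
    ((l0.continuous.comp_continuousOn hcont').sub
      ((continuousOn_const.mul (l1.continuous.comp_continuousOn hcont)).add
      (continuousOn_id.mul (l1.continuous.comp_continuousOn hcont'))))
    (continuousOn_finsetSum _ fun j _ => (l j).continuous.comp_continuousOn hcont)
    (fun κ hκ hκc hκI => by
      have h := T.weak_equation sys hsol hpull hs e hχ hχc hχO hκ hκc hκI
      simp only [← hl01, ← hl] at h
      exact h) hτ
  have i1 : ∀ j, Integrable (fun x => (T.deltaAff s).linear (basisVec j) *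
      (χ x * matForm (sys.A j s) (H1.func (uhat τ) x) e)) (volume.restrict (interior s.cell)) :=
    fun j => (integrable_bilin_cell (s := s) (sys.A j s) hχ.continuous
      (H1.memLp_func (uhat τ) hsub) hc).const_mul ((T.deltaAff s).linear (basisVec j))
  have i2 : ∀ j, Integrable (fun x => χ x *
      (T.deltaAff s x * matForm (sys.A j s) (H1.weakPartial j (uhat τ) x) e))
      (volume.restrict (interior s.cell)) := fun j =>
    (integrable_bilin_cell (s := s) (sys.A j s) (hχ.continuous.mul hd)
      (H1.memLp_weakPartial (uhat τ) j hsub) hc).congr (Eventually.of_forall fun x => by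
        simp only [Pi.mul_apply]; ring)
  have h1 : l1 (H1.func (uhat τ)) = ∑ j, ∫ x in interior s.cell,
      (T.deltaAff s).linear (basisVec j) * (χ x * matForm (sys.A j s) (H1.func (uhat τ) x) e) := by
    rw [hl1, ← integral_finsetSum _ fun j _ => i1 j]
    refine integral_congr_ae (Eventually.of_forall fun x => ?_)
    beta_reduce
    rw [elemM1, sum_matForm_apply, Finset.mul_sum]
    exact Finset.sum_congr rfl fun j _ => by ring
  -- Integrating by parts in space yields `-l1` of the curve, the very term that the explicit `τ` in
  -- `M₀ - τ M₁` contributes to the time derivative. After this cancellation no derivative of the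
  -- coefficients is left.
  have hn : ∑ j, l j (H1.func (uhat τ)) = - (l1 (H1.func (uhat τ)) + ∑ j,
      ∫ x in interior s.cell, χ x *
        (T.deltaAff s x * matForm (sys.A j s) (H1.weakPartial j (uhat τ) x) e)) := by
    rw [h1, ← Finset.sum_add_distrib, ← Finset.sum_neg_distrib]
    refine Finset.sum_congr rfl fun j _ => ?_
    rw [hl, T.integral_delta_fderiv hs (uhat τ) e (sys.A j s) j hχ hχc hχO,
      ← integral_add (i1 j) (i2 j)]
    congr 1
    refine integral_congr_ae (Eventually.of_forall fun x => ?_)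
    beta_reduce
    ring
  simp only [mul_add, Finset.mul_sum]
  rw [integral_add (integrable_bilin_cell _ hχ.continuous (H1.memLp_func (u' τ) hsub) hc)
    (integrable_finsetSum _ fun j _ => i2 j), integral_finsetSum _ fun j _ => i2 j, ← hl01]
  linarith

/-- The equation for `û` holds almost everywhere in every element. -/
theorem ae_equation (hsol : T.IsSolution sys u)
    (huhat : ContDiffOn ℝ 1 uhat (Icc 0 1))
    (hpull : ∀ τ ∈ Icc (0 : ℝ) 1, H1.func (uhat τ) =ᵐ[volume.restrict (interior T.patch)]
      fun x => u (T.Phi (x, τ)))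
    (hs : T.v ∈ s.1) {τ : ℝ} (hτ : τ ∈ Ioo (0 : ℝ) 1) :
    ∀ᵐ x ∂volume.restrict (interior s.cell), ∀ y,
      matForm (T.elemM0 sys s - τ • T.elemM1 sys s)
        (H1.func (derivWithin uhat (Icc 0 1) τ) x) y +
      ∑ j, T.deltaAff s x * matForm (sys.A j s) (H1.weakPartial j (uhat τ) x) y = 0 := by
  have hsub := T.interior_cell_subset hs
  have hd := continuous_affineMap (T.deltaAff s)
  have hbasis : ∀ e : State L, ∀ᵐ x ∂volume.restrict (interior s.cell),
      matForm (T.elemM0 sys s - τ • T.elemM1 sys s)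
        (H1.func (derivWithin uhat (Icc 0 1) τ) x) e +
      ∑ j, T.deltaAff s x * matForm (sys.A j s) (H1.weakPartial j (uhat τ) x) e = 0 := by
    intro e
    have hc : MemLp (fun _ : Space N => e) 2 (volume.restrict (interior s.cell)) :=
      memLp_interior_cell continuous_const 2
    have i0 := integrable_bilin_cell (s := s) (T.elemM0 sys s - τ • T.elemM1 sys s)
      (continuous_const (y := (1 : ℝ))) (H1.memLp_func (derivWithin uhat (Icc 0 1) τ) hsub) hc
    simp only [one_mul] at i0
    have i1 := fun j => integrable_bilin_cell (s := s) (sys.A j s) hd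
      (H1.memLp_weakPartial (uhat τ) j hsub) hc
    have hint : IntegrableOn (fun x => matForm (T.elemM0 sys s - τ • T.elemM1 sys s)
        (H1.func (derivWithin uhat (Icc 0 1) τ) x) e +
      ∑ j, T.deltaAff s x * matForm (sys.A j s) (H1.weakPartial j (uhat τ) x) e)
        (interior s.cell) := i0.add (integrable_finsetSum _ fun j _ => i1 j)
    rw [ae_restrict_iff' isOpen_interior.measurableSet]
    refine isOpen_interior.ae_eq_zero_of_integral_contDiff_smul_eq_zero
      hint.locallyIntegrableOn fun χ hχ hχc hχO => ?_
    refine Eq.trans ?_ (T.integral_equation sys hsol huhat hpull hs e hχ hχc hχO hτ)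
    rw [setIntegral_eq_integral_of_forall_compl_eq_zero]
    · rfl
    · intro x hx
      rw [image_eq_zero_of_notMem_tsupport fun h => hx (hχO h), zero_mul]
  -- The exceptional null set depends on the test vector; using only the basis vectors makes it
  -- common to all `y`, so that later `y` may be the value of the solution at `x`.
  have hall := ae_all_iff.mpr fun i : Fin L => hbasis (EuclideanSpace.single i 1)
  filter_upwards [hall] with x hx y
  set Λ : State L →L[ℝ] ℝ := matForm (T.elemM0 sys s - τ • T.elemM1 sys s)
        (H1.func (derivWithin uhat (Icc 0 1) τ) x) +
      ∑ j, T.deltaAff s x • matForm (sys.A j s) (H1.weakPartial j (uhat τ) x) with hΛ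
  have hΛa : ∀ y, Λ y = matForm (T.elemM0 sys s - τ • T.elemM1 sys s)
        (H1.func (derivWithin uhat (Icc 0 1) τ) x) y +
      ∑ j, T.deltaAff s x * matForm (sys.A j s) (H1.weakPartial j (uhat τ) x) y := by
    intro y
    simp [hΛ, add_apply, sum_apply, smul_apply]
  rw [← hΛa, ← sum_smul_basisVec y, map_sum]
  refine Finset.sum_eq_zero fun i _ => ?_
  rw [map_smul, hΛa, hx i, smul_zero]

end Curve

end Tent
open SpatialMesh

/-- The partial derivatives of a function that is affine near a point. -/
theorem gradient_apply_of_eqOn {N : ℕ} {φ : Space N → ℝ} {a : Space N →ᵃ[ℝ] ℝ} {O : Set (Space N)}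
    (hO : IsOpen O) (h : EqOn φ a O) {x : Space N} (hx : x ∈ O) (j : Fin N) :
    (∇ φ x) j = a.linear (basisVec j) := by
  have h1 : HasFDerivAt φ (LinearMap.toContinuousLinearMap a.linear) x :=
    (hasFDerivAt_affineMap a x).congr_of_eventuallyEq (h.eventuallyEq_of_mem (hO.mem_nhds hx))
  have h2 : inner ℝ (∇ φ x) (basisVec j) = a.linear (basisVec j) := by
    rw [gradient, InnerProductSpace.toDual_symm_apply, h1.fderiv]
    rfl
  rw [← h2, EuclideanSpace.inner_single_right]
  simp

namespace Tent
variable {N L : ℕ} {mesh : SpatialMesh N} (T : Tent mesh) (sys : HyperbolicSystem mesh L)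
  {s : mesh.Element}

/-! ### The energy estimate -/

theorem M0_eq (hs : T.v ∈ s.1) {x : Space N} (hx : x ∈ interior s.cell) :
    T.M0 sys x = T.elemM0 sys s := by
  rw [M0, elemM0, Element.field_eq _ hx]
  congr 1
  refine Finset.sum_congr rfl fun j _ => ?_
  rw [Element.field_eq _ hx, gradient_apply_of_eqOn isOpen_interior
    ((T.eqOn_bot hs).mono interior_subset) hx]

theorem M1_eq (hs : T.v ∈ s.1) {x : Space N} (hx : x ∈ interior s.cell) :
    T.M1 sys x = T.elemM1 sys s := by
  rw [M1, elemM1]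
  refine Finset.sum_congr rfl fun j _ => ?_
  rw [Element.field_eq _ hx, gradient_apply_of_eqOn isOpen_interior
    ((T.eqOn_delta hs).mono interior_subset) hx]

theorem elemM0_isSymm (s : mesh.Element) : (T.elemM0 sys s).IsSymm := by
  have hG : (sys.G s).IsSymm := by
    have := (sys.G_posDef s).isHermitian
    rwa [Matrix.IsHermitian, Matrix.conjTranspose_eq_transpose_of_trivial] at this
  rw [elemM0, Matrix.IsSymm, Matrix.transpose_sub, Matrix.transpose_sum, hG.eq]
  congr 1
  exact Finset.sum_congr rfl fun j _ => by rw [Matrix.transpose_smul, (sys.A_symm j s).eq]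

theorem elemM1_isSymm (s : mesh.Element) : (T.elemM1 sys s).IsSymm := by
  rw [elemM1, Matrix.IsSymm, Matrix.transpose_sum]
  exact Finset.sum_congr rfl fun j _ => by rw [Matrix.transpose_smul, (sys.A_symm j s).eq]

theorem massForm_eq_sum (τ : ℝ) (z z' : H1 (interior T.patch) L) :
    T.massForm sys τ (H1.func z) (H1.func z') = ∑ s ∈ T.elements, ∫ x in interior s.cell,
      matForm (T.elemM0 sys s - τ • T.elemM1 sys s) (H1.func z x) (H1.func z' x) := by
  have heq : ∀ s ∈ T.elements, EqOn (fun x => ((T.M0 sys x - τ • T.M1 sys x) *ᵥ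
      (H1.func z x).ofLp) ⬝ᵥ (H1.func z' x).ofLp) (fun x =>
      matForm (T.elemM0 sys s - τ • T.elemM1 sys s) (H1.func z x) (H1.func z' x))
      (interior s.cell) := by
    intro s hs x hx
    rw [T.mem_elements] at hs
    beta_reduce
    rw [T.M0_eq sys hs hx, T.M1_eq sys hs hx, matForm_apply]
  have hint : ∀ s ∈ T.elements, IntegrableOn (fun x =>
      matForm (T.elemM0 sys s - τ • T.elemM1 sys s) (H1.func z x) (H1.func z' x))
      (interior s.cell) := by
    intro s hs
    have hsub := T.interior_cell_subset (T.mem_elements.mp hs)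
    have h := integrable_bilin_cell (s := s) (T.elemM0 sys s - τ • T.elemM1 sys s)
      (continuous_const (y := (1 : ℝ))) (H1.memLp_func z hsub) (H1.memLp_func z' hsub)
    simpa only [one_mul] using h
  rw [massForm, T.setIntegral_patch fun s hs =>
    (hint s hs).congr_fun (heq s hs).symm isOpen_interior.measurableSet]
  exact Finset.sum_congr rfl fun s hs =>
    setIntegral_congr_fun isOpen_interior.measurableSet (heq s hs)

theorem matForm_sub_smul (A B : Matrix (Fin L) (Fin L) ℝ) (τ : ℝ) (x y : State L) :
    matForm (A - τ • B) x y = matForm A x y - τ * matForm B x y := by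
  rw [sub_eq_add_neg, ← neg_smul, matForm_add, matForm_smul, add_apply, add_apply, smul_apply,
    smul_apply, smul_eq_mul, neg_mul, sub_eq_add_neg]

theorem hasDerivAt_quadratic {X : Type*} [NormedAddCommGroup X] [NormedSpace ℝ X]
    {B₀ B₁ : X →L[ℝ] X →L[ℝ] ℝ} (h₀ : ∀ x y, B₀ x y = B₀ y x) (h₁ : ∀ x y, B₁ x y = B₁ y x)
    {w : ℝ → X} {w' : X} {τ : ℝ} (hw : HasDerivAt w w' τ) :
    HasDerivAt (fun τ => B₀ (w τ) (w τ) - τ * B₁ (w τ) (w τ))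
      (2 * (B₀ w' (w τ) - τ * B₁ w' (w τ)) - B₁ (w τ) (w τ)) τ := by
  have hB : ∀ B : X →L[ℝ] X →L[ℝ] ℝ,
      HasDerivAt (fun τ => B (w τ) (w τ)) (B w' (w τ) + B (w τ) w') τ := fun B =>
    (B.hasFDerivAt.comp_hasDerivAt τ hw).clm_apply hw
  refine ((hB B₀).sub ((hasDerivAt_id τ).mul (hB B₁))).congr_deriv ?_
  rw [h₀ (w τ) w', h₁ (w τ) w', id]
  ring

theorem continuousOn_quadratic {X : Type*} [NormedAddCommGroup X] [NormedSpace ℝ X]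
    {B₀ B₁ : X →L[ℝ] X →L[ℝ] ℝ} {w : ℝ → X} {J : Set ℝ} (hw : ContinuousOn w J) :
    ContinuousOn (fun τ => B₀ (w τ) (w τ) - τ * B₁ (w τ) (w τ)) J :=
  ((B₀.continuous.comp_continuousOn hw).clm_apply hw).sub
    (continuousOn_id.mul ((B₁.continuous.comp_continuousOn hw).clm_apply hw))

/-- The forms of `M₀` and `M₁` on an element as bounded forms on `L²`. -/
theorem exists_massForms (s : mesh.Element) :
    ∃ B₀ B₁ : Lp (State L) 2 (volume.restrict (interior T.patch)) →L[ℝ]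
        Lp (State L) 2 (volume.restrict (interior T.patch)) →L[ℝ] ℝ,
      (∀ w z, B₀ w z = B₀ z w) ∧ (∀ w z, B₁ w z = B₁ z w) ∧ (T.v ∈ s.1 →
        (∀ (τ : ℝ) (z z' : H1 (interior T.patch) L), ∫ x in interior s.cell,
          matForm (T.elemM0 sys s - τ • T.elemM1 sys s) (H1.func z x) (H1.func z' x) =
          B₀ (H1.func z) (H1.func z') - τ * B₁ (H1.func z) (H1.func z')) ∧
        ∀ z z' : H1 (interior T.patch) L, ∫ x in interior s.cell,
          matForm (T.elemM1 sys s) (H1.func z x) (H1.func z' x) =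
          B₁ (H1.func z) (H1.func z')) := by
  by_cases hs : T.v ∈ s.1
  · have hsub := T.interior_cell_subset hs
    obtain ⟨B₀, hB₀⟩ := exists_elementForm hsub (T.elemM0 sys s) (continuous_const (y := (1 : ℝ)))
    obtain ⟨B₁, hB₁⟩ := exists_elementForm hsub (T.elemM1 sys s) (continuous_const (y := (1 : ℝ)))
    simp only [one_mul] at hB₀ hB₁
    refine ⟨B₀, B₁, fun w z => ?_, fun w z => ?_, fun _ => ⟨fun τ z z' => ?_, fun z z' => ?_⟩⟩
    · simp only [hB₀, matForm_comm (T.elemM0_isSymm sys s) (w _)]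
    · simp only [hB₁, matForm_comm (T.elemM1_isSymm sys s) (w _)]
    · have hi : ∀ A : Matrix (Fin L) (Fin L) ℝ, IntegrableOn
          (fun x => matForm A (H1.func z x) (H1.func z' x)) (interior s.cell) := fun A => by
        simpa only [one_mul] using integrable_bilin_cell (s := s) A
          (continuous_const (y := (1 : ℝ))) (H1.memLp_func z hsub) (H1.memLp_func z' hsub)
      rw [hB₀, hB₁, ← integral_const_mul, ← integral_sub (hi _) ((hi _).const_mul τ)]
      simp only [matForm_sub_smul]
    · rw [hB₁]
  · exact ⟨0, 0, fun _ _ => rfl, fun _ _ => rfl, fun h => absurd h hs⟩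

section Curve
variable {uhat : ℝ → H1 (interior T.patch) L}

/-- The energy is continuous, and its derivative is given by the product rule. -/
theorem massForm_curve (huhat : ContDiffOn ℝ 1 uhat (Icc 0 1)) :
    ContinuousOn (fun τ => T.massForm sys τ (H1.func (uhat τ)) (H1.func (uhat τ))) (Icc 0 1) ∧
    ∀ τ ∈ Ioo (0 : ℝ) 1,
      HasDerivAt (fun τ => T.massForm sys τ (H1.func (uhat τ)) (H1.func (uhat τ)))
        (∑ s ∈ T.elements, (2 * (∫ x in interior s.cell,
          matForm (T.elemM0 sys s - τ • T.elemM1 sys s)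
            (H1.func (derivWithin uhat (Icc 0 1) τ) x) (H1.func (uhat τ) x)) -
          ∫ x in interior s.cell, matForm (T.elemM1 sys s) (H1.func (uhat τ) x)
            (H1.func (uhat τ) x))) τ := by
  choose B₀ B₁ h₀ h₁ hB using T.exists_massForms sys
  have hE : (fun τ => T.massForm sys τ (H1.func (uhat τ)) (H1.func (uhat τ))) = fun τ =>
      ∑ s ∈ T.elements, (B₀ s (H1.func (uhat τ)) (H1.func (uhat τ)) -
        τ * B₁ s (H1.func (uhat τ)) (H1.func (uhat τ))) := by
    funext τ
    rw [massForm_eq_sum]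
    exact Finset.sum_congr rfl fun s hs => (hB s (T.mem_elements.mp hs)).1 τ _ _
  rw [hE]
  refine ⟨continuousOn_finsetSum _ fun s _ => continuousOn_quadratic
    (H1.funcL.continuous.comp_continuousOn huhat.continuousOn), fun τ hτ => ?_⟩
  refine HasDerivAt.fun_sum fun s hs => ?_
  rw [T.mem_elements] at hs
  rw [(hB s hs).1, (hB s hs).2]
  exact hasDerivAt_quadratic (h₀ s) (h₁ s)
    (H1.funcL.hasFDerivAt.comp_hasDerivAt τ (hasDerivAt_curve huhat hτ))

/-- The energy of a solution does not increase. -/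
theorem antitoneOn_massForm (hN : 0 < N) {u : Space N × ℝ → State L} (hsol : T.IsSolution sys u)
    (huhat : ContDiffOn ℝ 1 uhat (Icc 0 1))
    (hpull : ∀ τ ∈ Icc (0 : ℝ) 1, H1.func (uhat τ) =ᵐ[volume.restrict (interior T.patch)]
      fun x => u (T.Phi (x, τ)))
    (hbc : T.SatisfiesBoundaryCondition sys uhat) :
    AntitoneOn (fun τ => T.massForm sys τ (H1.func (uhat τ)) (H1.func (uhat τ))) (Icc 0 1) := by
  obtain ⟨hcont, hder⟩ := T.massForm_curve sys huhat
  refine antitoneOn_of_hasDerivWithinAt_nonpos (convex_Icc 0 1) hcont (fun τ hτ => ?_)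
    -- The derivative is minus the total facet flux. Summing over all mesh elements is harmless
    -- because `deltaAff` is zero off the patch.
    (fun τ hτ => ?_) (f' := fun τ => -∑ s : mesh.Element, ∑ p : s.1, radialFlux p (T.deltaAff s)
      (sys.facetMatrix p) (H1.func (uhat τ)) (fun k => H1.weakPartial k (uhat τ)))
  · rw [interior_Icc] at hτ
    refine ((hder τ hτ).congr_deriv ?_).hasDerivWithinAt
    rw [← Finset.sum_subset (Finset.subset_univ T.elements) fun s _ hs => ?_,
      ← Finset.sum_neg_distrib]
    · refine Finset.sum_congr rfl fun s hs => ?_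
      rw [T.mem_elements] at hs
      have hsub := T.interior_cell_subset hs
      rw [sum_radialFlux_facetMatrix sys (T.deltaAff s) (H1.memLp_func (uhat τ) hsub)
        fun k => H1.memLp_weakPartial (uhat τ) k hsub]
      have hd : Continuous fun x => 2 * T.deltaAff s x :=
        continuous_const.mul (continuous_affineMap (T.deltaAff s))
      have hi := fun j => integrable_bilin_cell (s := s) (sys.A j s)
        hd (H1.memLp_func (uhat τ) hsub) (H1.memLp_weakPartial (uhat τ) j hsub)
      -- The pointwise equation is tested with the solution itself. With the term from `M₁`, the
      -- right side completes the divergence of δ ℒû·û, since symmetry of the `ℒ^j` accounts for the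
      -- factor 2.
      have h1 : 2 * (∫ x in interior s.cell, matForm (T.elemM0 sys s - τ • T.elemM1 sys s)
            (H1.func (derivWithin uhat (Icc 0 1) τ) x) (H1.func (uhat τ) x)) =
          -∑ j, ∫ x in interior s.cell, 2 * T.deltaAff s x *
            matForm (sys.A j s) (H1.func (uhat τ) x) (H1.weakPartial j (uhat τ) x) := by
        rw [← integral_finsetSum _ fun j _ => hi j, ← integral_const_mul, ← integral_neg]
        refine integral_congr_ae ?_
        filter_upwards [T.ae_equation sys hsol huhat hpull hs hτ] with x hx
        have h2 := hx (H1.func (uhat τ) x)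
        rw [eq_neg_of_add_eq_zero_left h2, mul_neg, Finset.mul_sum]
        congr 1
        refine Finset.sum_congr rfl fun j _ => ?_
        rw [matForm_comm (sys.A_symm j s)]
        ring
      rw [h1, ← elemM1]
      ring
    · simp only [T.mem_elements] at hs
      simp only [deltaAff_of_notMem T hs, radialFlux_zero_left, Finset.sum_const_zero]
  · rw [interior_Icc] at hτ
    exact neg_nonpos.mpr (T.sum_radialFlux_nonneg sys hN hbc hτ)

end Curve

/-- The norm on a front is the mass norm of the pull-back. -/
theorem frontNorm_eq_massNorm {u : Space N × ℝ → State L} {φ : Space N → ℝ} {τ : ℝ}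
    (hφ : ∀ s : mesh.Element, T.v ∈ s.1 →
      EqOn φ (T.botAff s + τ • T.deltaAff s : Space N →ᵃ[ℝ] ℝ) s.cell)
    {z : H1 (interior T.patch) L}
    (hz : H1.func z =ᵐ[volume.restrict (interior T.patch)] fun x => u (T.Phi (x, τ))) :
    T.frontNorm sys φ u = T.massNorm sys τ (H1.func z) := by
  rw [frontNorm, massNorm, massForm]
  congr 1
  refine integral_congr_ae ?_
  have hz' : ∀ᵐ x ∂volume.restrict T.patch, H1.func z x = u (T.Phi (x, τ)) := by
    rw [← Measure.restrict_congr_set T.interior_patch_ae_eq]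
    exact hz
  have hmem : ∀ᵐ x ∂volume.restrict T.patch, x ∈ ⋃ s ∈ T.elements, interior s.cell := by
    rw [Measure.restrict_congr_set T.patch_ae_eq]
    exact ae_restrict_mem (MeasurableSet.biUnion (Finset.countable_toSet _)
      fun s _ => isOpen_interior.measurableSet)
  filter_upwards [hz', hmem] with x hx hxs
  simp only [mem_iUnion] at hxs
  obtain ⟨s, hs, hxs⟩ := hxs
  rw [T.mem_elements] at hs
  have hxc := interior_subset hxs
  have hphi : T.Phi (x, τ) = (x, φ x) := by
    rw [← T.cylinderMap_eq_Phi hs hxc, hφ s hs hxc]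
    rfl
  rw [hx, hphi, T.M0_eq sys hs hxs, T.M1_eq sys hs hxs]
  set y := u (x, φ x)
  -- On an element the front has the constant gradient of `φ_bot + τ δ`, so subtracting the flux in
  -- this direction from `𝒢` gives exactly `M(τ)`.
  have hf : sys.f x y *ᵥ (∇ φ x).ofLp =
      (∑ j, (T.botAff s + τ • T.deltaAff s).linear (basisVec j) • sys.A j s) *ᵥ y.ofLp := by
    ext l
    rw [Matrix.sum_mulVec, Finset.sum_apply]
    simp only [Matrix.mulVec, dotProduct, HyperbolicSystem.f, Matrix.of_apply]
    refine Finset.sum_congr rfl fun j _ => ?_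
    rw [Element.field_eq _ hxs, gradient_apply_of_eqOn isOpen_interior
      ((hφ s hs).mono interior_subset) hxs, Finset.sum_mul]
    refine Finset.sum_congr rfl fun k _ => ?_
    simp only [Matrix.smul_apply, smul_eq_mul]
    ring
  rw [hf, HyperbolicSystem.g, Element.field_eq _ hxs, ← Matrix.sub_mulVec]
  have hM : T.elemM0 sys s - τ • T.elemM1 sys s = sys.G s -
      ∑ j, (T.botAff s + τ • T.deltaAff s).linear (basisVec j) • sys.A j s := by
    rw [elemM0, elemM1, Finset.smul_sum, sub_sub, ← Finset.sum_add_distrib]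
    congr 1
    refine Finset.sum_congr rfl fun j _ => ?_
    rw [smul_smul, ← add_smul]
    rfl
  rw [hM]

end Tent
end TentPitching
end

/-! ### The energy estimate in terms of norms -/

theorem mainTheorem10 {N L : ℕ} (hN : 0 < N) (hL : 0 < L)
    (mesh : TentPitching.SpatialMesh N) (sys : TentPitching.HyperbolicSystem mesh L)
    (T : TentPitching.Tent mesh) (chat : ℝ) (hcausal : T.IsCausal sys chat)
    (u : TentPitching.Space N × ℝ → TentPitching.State L)
    (uhat : ℝ → TentPitching.H1 (interior T.patch) L)
    (huhat : ContDiffOn ℝ 1 uhat (Set.Icc 0 1))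
    (hpull : ∀ τ ∈ Set.Icc (0 : ℝ) 1,
      TentPitching.H1.func (uhat τ) =ᵐ[MeasureTheory.volume.restrict (interior T.patch)] fun x => u (T.Phi (x, τ)))
    (hsol : T.IsSolution sys u) (hbc : T.SatisfiesBoundaryCondition sys uhat) :
    (∀ τ ∈ Set.Icc (0 : ℝ) 1,
      T.massNorm sys τ (TentPitching.H1.func (uhat τ)) ≤ T.massNorm sys 0 (TentPitching.H1.func (uhat 0))) ∧
    T.frontNorm sys T.top u ≤ T.frontNorm sys T.bot u := by
  have hanti := T.antitoneOn_massForm sys hN hsol huhat hpull hbc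
  have hle : ∀ τ ∈ Set.Icc (0 : ℝ) 1, T.massNorm sys τ (TentPitching.H1.func (uhat τ)) ≤
      T.massNorm sys 0 (TentPitching.H1.func (uhat 0)) := fun τ hτ =>
    Real.sqrt_le_sqrt (hanti (Set.left_mem_Icc.mpr zero_le_one) hτ hτ.1)
  refine ⟨hle, ?_⟩
  have h0 : (0 : ℝ) ∈ Set.Icc (0 : ℝ) 1 := Set.left_mem_Icc.mpr zero_le_one
  have h1 : (1 : ℝ) ∈ Set.Icc (0 : ℝ) 1 := Set.right_mem_Icc.mpr zero_le_one
  -- The top and the bottom of the tent are the fronts at `τ = 1` and `τ = 0`.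
  rw [T.frontNorm_eq_massNorm sys (fun s hs => ?_) (hpull 1 h1),
    T.frontNorm_eq_massNorm sys (fun s hs => ?_) (hpull 0 h0)]
  · exact hle 1 h1
  · rw [zero_smul, add_zero]
    exact T.eqOn_bot hs
  · rw [one_smul]
    exact T.eqOn_top hs
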